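/- **Proposition (Odd local contrast for the sign-symmetrized family).** Let $C$ be a random finite simple counting measure on $\mathbb{R}$ with $C(\{0\})=1$ a.s., $\mathrm{supp}(C)\subset[0,\infty)$ a.s. and $\mathbb{E}[C(\mathbb{R})^3]<\infty$. Let $\{U_j\}$ be a homogeneous Poisson process on $\mathbb{R}$ with rate $\nu>0$, independent of i.i.d. copies $\{C_j\}$ of $C$. For each $\theta\in[-1,1]$ let $\{S_{j,\theta}\}_j$ be i.i.d. signs with $\mathbb{P}(S_{j,\theta}=\pm1)=\tfrac{1\pm\theta}{2}$, independent of $\{U_j,C_j\}_j$, and let $$N_\theta:=\sum_j\vartheta_{U_j}(S_{j,\theta}C_j),$$ where $s\mu$ is the pushforward of $\mu$ under $x\mapsto sx$ and $\vartheta_u\mu$ is the translate of $\mu$ by $u$. Write $\mathbb{E}_\theta$ for expectation under the law of $N_\theta$. For a point process $N$ let $\alpha_n(f_0,\dots,f_{n-1})=\mathbb{E}\sum^{\neq}_{x_0,\dots,x_{n-1}\in N}\prod_i f_i(x_i)$ be its factorial moments (sums over ordered tuples of pairwise distinct points), and let its third factorial cumulant be $$\begin{aligned}\kappa_3(f_0,f_1,f_2)={}&\alpha_3(f_0,f_1,f_2)-\alpha_2(f_0,f_1)\alpha_1(f_2)-\alpha_2(f_0,f_2)\alpha_1(f_1)\\&-\alpha_2(f_1,f_2)\alpha_1(f_0)+2\alpha_1(f_0)\alpha_1(f_1)\alpha_1(f_2).\end{aligned}$$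 Assume that the reduced third factorial cumulant of $N_1$ has a density $c_{3,1}\in L^1(\mathbb{R}^2)$, i.e. that for $N=N_1$ and all bounded, compactly supported Borel functions $f_0,f_1,f_2$, $$\kappa_3(f_0,f_1,f_2)=\int_{\mathbb{R}}\iint_{\mathbb{R}^2}f_0(t)f_1(t+\tau_1)f_2(t+\tau_2)\,c_{3,1}(\tau_1,\tau_2)\,d\tau_1d\tau_2\,dt.$$ Put $c_3^{\mathrm o}(\tau):=\tfrac12\big(c_{3,1}(\tau)-c_{3,1}(-\tau)\big)$ and $B_1(\omega):=\iint_{\mathbb{R}^2} c_{3,1}(\tau)e^{-i\omega\cdot\tau}\,d\tau$. Let $g:\mathbb{R}^2\to\mathbb{R}$ be bounded Borel, compactly supported and jointly odd, $g(-\tau)=-g(\tau)$, and for $T>0$ put $$\mathcal O_{T,g}:=\frac1T\sum^{\neq}_{x_0,x_1,x_2\in N\cap[0,T]}g(x_1-x_0,x_2-x_0).$$ Then: 1. For every $T>0$ and $\theta\in[-1,1]$, $\mathcal O_{T,g}$ is integrable under the law of $N_\theta$ and $\mathbb{E}_\theta[\mathcal O_{T,g}]=\theta\,\mu_{T,g}$,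 where $$\mu_{T,g}=\frac1T\int_0^T\iint_{\mathbb{R}^2}g(\tau_1,\tau_2)\,\mathbf 1_{\{0\le x_0+\tau_1\le T,\ 0\le x_0+\tau_2\le T\}}\,c_3^{\mathrm o}(\tau_1,\tau_2)\,d\tau_1d\tau_2\,dx_0.$$ 2. As $T\to\infty$, $\mu_{T,g}=\mu_g+O(T^{-1})$, where $\mu_g:=\iint_{\mathbb{R}^2}g(\tau)\,c_3^{\mathrm o}(\tau)\,d\tau$. 3. If $\widehat g=iH_g$ with $H_g$ real-valued and integrable, where $\widehat g(\omega):=\iint_{\mathbb{R}^2} e^{-i\omega\cdot\tau}g(\tau)\,d\tau$, then $$\mu_g=\frac1{(2\pi)^2}\iint_{\mathbb{R}^2}H_g(\omega_1,\omega_2)\,\mathrm{Im}\,B_1(\omega_1,\omega_2)\,d\omega_1d\omega_2.$$ -/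

import Mathlib

open MeasureTheory ProbabilityTheory Set Filter Asymptotics
open scoped NNReal ENNReal

noncomputable section

namespace ClusterContrast

variable {Ω : Type*} [MeasurableSpace Ω]

/-! ### Point configurations and sums over distinct points -/

/-- The points (atoms) of a counting measure on the line. -/
def points (μ : Measure ℝ) : Set ℝ := {x | μ {x} ≠ 0}

/-- A finite simple counting measure: a finite sum of unit point masses at distinct points. -/
def IsFiniteSimpleCounting (μ : Measure ℝ) : Prop :=
  ∃ s : Finset ℝ, μ = ∑ x ∈ s, Measure.dirac x

/-- The sum of `F` over ordered `n`-tuples of pairwise distinct elements of `A`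
(injections `Fin n ↪ A`). -/
def sumDistinct {n : ℕ} (A : Set ℝ) (F : (Fin n → ℝ) → ℝ) : ℝ :=
  ∑' x : Fin n ↪ A, F (fun i => (x i : ℝ))

/-- Bounded compactly supported Borel functions. -/
structure IsTestFunction {X : Type*} [TopologicalSpace X] [MeasurableSpace X]
    (f : X → ℝ) : Prop where
  measurable : Measurable f
  bounded : ∃ M : ℝ, ∀ x, |f x| ≤ M
  compactSupport : HasCompactSupport f

/-! ### Factorial moments and factorial cumulants of a point process -/

/-- The `n`-th factorial moment measure of the point process `N`, tested against the product
`f 0 ⊗ ⋯ ⊗ f (n - 1)`: the mean of the sum of `∏ i, f i (x i)` over ordered `n`-tuples of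
pairwise distinct points of `N`. -/
def factorialMoment (P : Measure Ω) (N : Ω → Measure ℝ) {n : ℕ} (f : Fin n → ℝ → ℝ) : ℝ :=
  ∫ ω, sumDistinct (points (N ω)) (fun x : Fin n → ℝ => ∏ i, f i (x i)) ∂P

/-- The third factorial cumulant measure of `N`, tested against `f 0 ⊗ f 1 ⊗ f 2`: the third
mixed derivative at the origin of the logarithm of the factorial moment generating functional,
written out through the factorial moments. -/
def factorialCumulant3 (P : Measure Ω) (N : Ω → Measure ℝ) (f : Fin 3 → ℝ → ℝ) : ℝ :=
  factorialMoment P N ![f 0, f 1, f 2]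
    - factorialMoment P N ![f 0, f 1] * factorialMoment P N ![f 2]
    - factorialMoment P N ![f 0, f 2] * factorialMoment P N ![f 1]
    - factorialMoment P N ![f 1, f 2] * factorialMoment P N ![f 0]
    + 2 * factorialMoment P N ![f 0] * factorialMoment P N ![f 1] * factorialMoment P N ![f 2]

/-- `c` is an integrable density of the reduced third factorial cumulant measure of `N`. -/
structure IsReducedCumulantDensity3 (P : Measure Ω) (N : Ω → Measure ℝ) (c : ℝ × ℝ → ℝ) :
    Prop where
  integrable : Integrable c
  disintegration : ∀ f : Fin 3 → ℝ → ℝ, (∀ i, IsTestFunction (f i)) →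
    factorialCumulant3 P N f =
      ∫ t : ℝ, ∫ τ : ℝ × ℝ, f 0 t * f 1 (t + τ.1) * f 2 (t + τ.2) * c τ

/-! ### The sign-symmetrized Poisson cluster family -/

/-- The random points `U 0, U 1, …` form a homogeneous Poisson process on the line with
rate `ν`. -/
structure IsPoissonProcess (P : Measure Ω) (ν : ℝ≥0) (U : ℕ → Ω → ℝ) : Prop where
  measurable : ∀ j, Measurable (U j)
  law : ∀ A : Set ℝ, MeasurableSet A → volume A ≠ ∞ →
    P.map (fun ω => Measure.sum (fun j => Measure.dirac (U j ω)) A) =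
      (poissonMeasure (ν * (volume A).toNNReal)).map (fun k : ℕ => (k : ℝ≥0∞))
  indep : ∀ (n : ℕ) (A : Fin n → Set ℝ), (∀ i, MeasurableSet (A i)) →
    Pairwise (fun i j => Disjoint (A i) (A j)) →
    iIndepFun (fun i ω => Measure.sum (fun j => Measure.dirac (U j ω)) (A i)) P

/-- `Q` is the law of a random finite simple counting measure `C` on the line with `C({0}) = 1`,
`C` carried by `[0, ∞)`, and total mass having a finite third moment. -/
structure IsClusterLaw (Q : Measure (Measure ℝ)) : Prop where
  isProbability : IsProbabilityMeasure Q
  finiteSimple : ∀ᵐ μ ∂Q, IsFiniteSimpleCounting μ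
  rooted : ∀ᵐ μ ∂Q, μ {0} = 1
  forward : ∀ᵐ μ ∂Q, μ (Iio 0) = 0
  thirdMoment : ∫⁻ μ, (μ univ) ^ 3 ∂Q < ∞

/-- The data of the sign-symmetrized family: Poisson immigrants `U` of rate `ν`, independent of
i.i.d. clusters `C j` of law `Q`, and, for each `θ ∈ [-1, 1]`, i.i.d. signs `S θ j`
independent of `(U, C)` with `P(S = ±1) = (1 ± θ) / 2`. -/
structure IsSignSymmetrizedFamily (P : Measure Ω) (ν : ℝ≥0) (Q : Measure (Measure ℝ))
    (U : ℕ → Ω → ℝ) (C : ℕ → Ω → Measure ℝ) (S : ℝ → ℕ → Ω → ℝ) : Prop where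
  rate_pos : 0 < ν
  poisson : IsPoissonProcess P ν U
  clusterLaw : IsClusterLaw Q
  measurable_cluster : ∀ j, Measurable (C j)
  law_cluster : ∀ j, P.map (C j) = Q
  indep_clusters : iIndepFun C P
  indep_immigrants_clusters : IndepFun (fun ω j => U j ω) (fun ω j => C j ω) P
  measurable_sign : ∀ θ ∈ Icc (-1 : ℝ) 1, ∀ j, Measurable (S θ j)
  sign_pos : ∀ θ ∈ Icc (-1 : ℝ) 1, ∀ j, P {ω | S θ j ω = 1} = ENNReal.ofReal ((1 + θ) / 2)
  sign_neg : ∀ θ ∈ Icc (-1 : ℝ) 1, ∀ j, P {ω | S θ j ω = -1} = ENNReal.ofReal ((1 - θ) / 2)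
  indep_signs : ∀ θ ∈ Icc (-1 : ℝ) 1, iIndepFun (S θ) P
  indep_signs_rest : ∀ θ ∈ Icc (-1 : ℝ) 1,
    IndepFun (fun ω j => S θ j ω) (fun ω => ((fun j => U j ω), (fun j => C j ω))) P

/-- The process `N_θ`: the superposition over `j` of the clusters `S θ j • C j`, each translated
by its immigrant `U j`. -/
def signedClusterProcess (U : ℕ → Ω → ℝ) (C : ℕ → Ω → Measure ℝ) (S : ℝ → ℕ → Ω → ℝ)
    (θ : ℝ) (ω : Ω) : Measure ℝ :=
  Measure.sum fun j => ((C j ω).map (fun x => S θ j ω * x)).map (fun x => x + U j ω)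

/-! ### The odd contrast -/

/-- The finite-window statistic: `T⁻¹` times the sum of `g (x₁ - x₀, x₂ - x₀)` over ordered
triples of pairwise distinct points in `[0, T]`. -/
def oddStatistic (T : ℝ) (g : ℝ × ℝ → ℝ) (μ : Measure ℝ) : ℝ :=
  1 / T * sumDistinct (points μ ∩ Icc 0 T) (fun x : Fin 3 → ℝ => g (x 1 - x 0, x 2 - x 0))

/-- The odd part of a function on the plane. -/
def oddPart (c : ℝ × ℝ → ℝ) (τ : ℝ × ℝ) : ℝ := (c τ - c (-τ)) / 2

/-- The finite-window contrast `μ_{T,g}`. -/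
def windowContrast (c : ℝ × ℝ → ℝ) (g : ℝ × ℝ → ℝ) (T : ℝ) : ℝ :=
  1 / T * ∫ x₀ in (0 : ℝ)..T, ∫ τ : ℝ × ℝ,
    g τ * indicator {τ : ℝ × ℝ | x₀ + τ.1 ∈ Icc 0 T ∧ x₀ + τ.2 ∈ Icc 0 T} 1 τ * oddPart c τ

/-- The limiting contrast `μ_g`. -/
def limitContrast (c : ℝ × ℝ → ℝ) (g : ℝ × ℝ → ℝ) : ℝ :=
  ∫ τ : ℝ × ℝ, g τ * oddPart c τ

/-- The Fourier transform `∬ f(τ) exp(-i ω·τ) dτ`; applied to the reduced third factorial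
cumulant density it is the factorial bispectrum. -/
def planeFourier (f : ℝ × ℝ → ℝ) (ω : ℝ × ℝ) : ℂ :=
  ∫ τ : ℝ × ℝ, Complex.exp (-Complex.I * ((ω.1 * τ.1 + ω.2 * τ.2 : ℝ) : ℂ)) * (f τ : ℂ)

end ClusterContrast

end

noncomputable section

namespace ClusterContrast

/-! ### Factorial moment measures of a Poisson process -/

/-! The triples `(U j, C j, S θ j)` behave like a Poisson process with intensity `markLaw`, that is
`ν` times Lebesgue measure times cluster law times sign law. All that is needed of this is that its
factorial moment measures are product measures (`IsPoissonProcess.sum_map_embedding`,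
`IsSignSymmetrizedFamily.sum_map_embedding`).

Write K1 for the intensity of the point process, and K2, K3 for the mean measures of pairs and
triples of distinct points inside one cluster. Sorting triples of points by which of them share a
cluster gives the third factorial moment measure as K3, plus the three placements of K2 ⊗ K1, plus
K1 ⊗ K1 ⊗ K1 (`lintegral_moment3`). The lower terms cancel in the cumulant, so the third factorial
cumulant is K3 (`factorialCumulant3_eq`).

The mean of the odd statistic is the integral of a summand that changes sign under the reflection `x
↦ T - x` of all three points. K1 is a multiple of Lebesgue measure. K2 is also invariant under
reflection, since a reflected pair is the swapped pair up to a translation, and the uniform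
immigrant position absorbs translations (`measurePreserving_clusterCumulant2`). Every mixed term is
therefore invariant and contributes zero. A triple has no such symmetry, but a cluster of sign -1 is
the reflection of one of sign +1, again up to translation. So K3 at parameter θ is the mixture of K3
at 1 and its reflection with weights (1 ± θ)/2 (`clusterCumulant3_markLaw`), and an antisymmetric
integrand sees the factor (1 + θ)/2 - (1 - θ)/2 = θ.

The density hypothesis describes K3 at θ = 1 on product functions only; a uniqueness argument on
boxes extends it to the non-product summand (`eq_densityMeasure`). Symmetry of the window under
reflection then replaces `c` by its odd part (`integral_oddSummand`).

For the limit, the window constrains the displacements only when the base point is within the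
support radius of `g` of an endpoint, which costs O(1) before division by `T`. The bispectral
formula is Parseval's identity for the integrable functions `g` and `c`, where the integrability of
the transform of `g` supplies Fourier inversion. -/

theorem lintegral_natCast_poissonMeasure (r : ℝ≥0) :
    ∫⁻ k : ℕ, (k : ℝ≥0∞) ∂poissonMeasure r = r := by
  rw [lintegral_countable', tsum_eq_zero_add' ENNReal.summable]
  have h : ∀ n : ℕ, ((n + 1 : ℕ) : ℝ≥0∞) * poissonMeasure r {n + 1}
      = r * poissonMeasure r {n} := by
    intro n
    rw [poissonMeasure_singleton, poissonMeasure_singleton, ← ENNReal.ofReal_natCast,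
      ← ENNReal.ofReal_coe_nnreal, ← ENNReal.ofReal_mul (by positivity),
      ← ENNReal.ofReal_mul (by positivity), Nat.factorial_succ]
    congr 1
    push_cast
    field_simp
    ring
  simp_rw [h]
  rw [ENNReal.tsum_mul_left]
  have h1 := lintegral_countable' (μ := poissonMeasure r) (fun _ => 1)
  simp only [lintegral_const, measure_univ, one_mul] at h1
  rw [← h1]
  simp

/-- The mass at `n + 2` is at most `r ^ 2` times the mass at `n`, because (n + 1)(n + 2) ≥ 1. This
second-order smallness is what rules out coincident immigrants. -/
theorem poissonMeasure_two_le (r : ℝ≥0) :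
    poissonMeasure r {k | 2 ≤ k} ≤ (r : ℝ≥0∞) ^ 2 := by
  rw [← lintegral_indicator_one (by measurability), lintegral_countable',
    tsum_eq_zero_add' ENNReal.summable, tsum_eq_zero_add' ENNReal.summable]
  have h : ∀ n : ℕ, indicator {k : ℕ | 2 ≤ k} (1 : ℕ → ℝ≥0∞) (n + 1 + 1)
      * poissonMeasure r {n + 1 + 1} ≤ (r : ℝ≥0∞) ^ 2 * poissonMeasure r {n} := by
    intro n
    rw [indicator_of_mem (by simp), Pi.one_apply, one_mul, poissonMeasure_singleton,
      poissonMeasure_singleton, ← ENNReal.ofReal_coe_nnreal, ← ENNReal.ofReal_pow (by positivity),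
      ← ENNReal.ofReal_mul (by positivity)]
    apply ENNReal.ofReal_le_ofReal
    rw [pow_add, pow_add, Nat.factorial_succ, Nat.factorial_succ]
    have h2 : (1 : ℝ) ≤ ((n : ℝ) + 1 + 1) * (n + 1) := by
      nlinarith [(Nat.cast_nonneg n : (0 : ℝ) ≤ n)]
    push_cast
    rw [div_le_iff₀ (by positivity)]
    calc _ = (r : ℝ) ^ 2 * (Real.exp (-r) * r ^ n / n.factorial) * (1 * n.factorial) := by
          field_simp
      _ ≤ (r : ℝ) ^ 2 * (Real.exp (-r) * r ^ n / n.factorial) *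
          ((((n : ℝ) + 1 + 1) * (n + 1)) * n.factorial) := by gcongr
      _ = _ := by ring
  have h1 := lintegral_countable' (μ := poissonMeasure r) (fun _ => 1)
  simp only [lintegral_const, measure_univ, one_mul] at h1
  calc _ ≤ 0 + (0 + ∑' n : ℕ, (r : ℝ≥0∞) ^ 2 * poissonMeasure r {n}) := by
        refine add_le_add (by simp) (add_le_add (by simp) (ENNReal.tsum_le_tsum h))
    _ = _ := by rw [ENNReal.tsum_mul_left, ← h1]; simp

theorem prod_tsum_eq_tsum_prod {n : ℕ} (f : Fin n → ℕ → ℝ≥0∞) :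
    ∏ k, ∑' j, f k j = ∑' e : Fin n → ℕ, ∏ k, f k (e k) := by
  induction n with
  | zero => simp
  | succ n ih =>
    rw [Fin.prod_univ_succ, ih, ← (Fin.consEquiv (fun _ : Fin (n + 1) => ℕ)).tsum_eq,
      ENNReal.tsum_prod', ← ENNReal.tsum_mul_right]
    congr 1 with j
    rw [← ENNReal.tsum_mul_left]
    congr 1 with e
    simp [Fin.prod_univ_succ, Fin.consEquiv]

theorem two_le_count {Ω : Type*} {U : ℕ → Ω → ℝ} {i j : ℕ} (hij : i ≠ j) {A : Set ℝ}
    (hA : MeasurableSet A) {ω : Ω}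
    (hi : U i ω ∈ A) (hj : U j ω ∈ A) :
    2 ≤ Measure.sum (fun j => Measure.dirac (U j ω)) A := by
  rw [Measure.sum_apply _ hA]
  refine le_trans ?_ (ENNReal.sum_le_tsum {i, j})
  rw [Finset.sum_pair hij, Measure.dirac_apply' _ hA, Measure.dirac_apply' _ hA,
    indicator_of_mem hi, indicator_of_mem hj]
  norm_num

section Poisson

variable {Ω : Type*} [MeasurableSpace Ω] {P : Measure Ω} {ν : ℝ≥0} {U : ℕ → Ω → ℝ}

theorem measurable_count (hU : ∀ j, Measurable (U j)) {A : Set ℝ} (hA : MeasurableSet A) :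
    Measurable (fun ω => Measure.sum (fun j => Measure.dirac (U j ω)) A) := by
  simp_rw [Measure.sum_apply _ hA]
  exact Measurable.tsum fun j => (Measure.measurable_coe hA).comp
    (Measure.measurable_dirac.comp (hU j))

theorem IsPoissonProcess.lintegral_count (h : IsPoissonProcess P ν U) {A : Set ℝ}
    (hA : MeasurableSet A) (hfin : volume A ≠ ∞) :
    ∫⁻ ω, Measure.sum (fun j => Measure.dirac (U j ω)) A ∂P = ν * volume A := by
  have h1 := lintegral_map (μ := P) (f := fun x => x) measurable_id'
    (measurable_count h.measurable hA)
  rw [← h1, h.law A hA hfin, lintegral_map measurable_id' (by fun_prop),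
    lintegral_natCast_poissonMeasure, ENNReal.coe_mul, ENNReal.coe_toNNReal hfin]

theorem IsPoissonProcess.measure_two_le (h : IsPoissonProcess P ν U) {A : Set ℝ}
    (hA : MeasurableSet A) (hfin : volume A ≠ ∞) :
    P {ω | 2 ≤ Measure.sum (fun j => Measure.dirac (U j ω)) A} ≤ (ν * volume A) ^ 2 := by
  have h1 : P {ω | 2 ≤ Measure.sum (fun j => Measure.dirac (U j ω)) A} =
      P.map (fun ω => Measure.sum (fun j => Measure.dirac (U j ω)) A) (Ici 2) := by
    rw [Measure.map_apply (measurable_count h.measurable hA) measurableSet_Ici]; rfl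
  rw [h1, h.law A hA hfin, Measure.map_apply (by fun_prop) measurableSet_Ici]
  have h2 : (fun k : ℕ => (k : ℝ≥0∞)) ⁻¹' Ici 2 = {k | 2 ≤ k} := by
    ext k; simp
  rw [h2]
  refine (poissonMeasure_two_le _).trans_eq ?_
  rw [ENNReal.coe_mul, ENNReal.coe_toNNReal hfin]

/-- Cut a unit interval into `n + 1` equal cells. A coincidence puts two points in one cell, which
has probability at most (n + 1)(ν/(n + 1))², and this tends to zero. -/
theorem IsPoissonProcess.measure_eq_eq_zero (h : IsPoissonProcess P ν U) {i j : ℕ}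
    (hij : i ≠ j) : P {ω | U i ω = U j ω} = 0 := by
  have hcover : {ω | U i ω = U j ω} ⊆ ⋃ m : ℤ, {ω | U i ω = U j ω ∧ ⌊U i ω⌋ = m} := by
    intro ω hω
    simpa using hω
  refine measure_mono_null hcover (measure_iUnion_null fun m => ?_)
  have key : ∀ n : ℕ, P {ω | U i ω = U j ω ∧ ⌊U i ω⌋ = m} ≤ ((ν : ℝ≥0∞) ^ 2) / (n + 1 : ℕ) := by
    intro n
    let I : ℕ → Set ℝ := fun k => Ico (m + (k : ℝ) / (n + 1)) (m + ((k : ℝ) + 1) / (n + 1))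
    have hsub : {ω | U i ω = U j ω ∧ ⌊U i ω⌋ = m} ⊆ ⋃ k ∈ Finset.range (n + 1),
        {ω | 2 ≤ Measure.sum (fun j => Measure.dirac (U j ω)) (I k)} := by
      rintro ω ⟨h1, h2⟩
      have hn : (0 : ℝ) < n + 1 := by positivity
      obtain ⟨h3, h4⟩ := Int.floor_eq_iff.1 h2
      set y := (U i ω - m) * (n + 1) with hy
      have hy0 : 0 ≤ y := mul_nonneg (by linarith) hn.le
      have hmem : U i ω ∈ I ⌊y⌋₊ := by
        have h5 := Nat.floor_le hy0
        have h6 := Nat.lt_floor_add_one y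
        constructor
        · rw [← le_sub_iff_add_le', div_le_iff₀ hn]; exact h5
        · rw [← sub_lt_iff_lt_add', lt_div_iff₀ hn]; exact h6
      refine mem_biUnion (x := ⌊y⌋₊) ?_ ?_
      · simp only [Finset.coe_range, mem_Iio]
        rw [Nat.floor_lt hy0]
        push_cast
        nlinarith
      · exact two_le_count hij measurableSet_Ico hmem (h1 ▸ hmem)
    refine (measure_mono hsub).trans ((measure_biUnion_finset_le _ _).trans ?_)
    have hvol : ∀ k, volume (I k) = ENNReal.ofReal (1 / (n + 1)) := by
      intro k
      rw [Real.volume_Ico]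
      congr 1
      ring
    calc _ ≤ ∑ k ∈ Finset.range (n + 1), (ν * ENNReal.ofReal (1 / (n + 1))) ^ 2 := by
          refine Finset.sum_le_sum fun k _ => ?_
          rw [← hvol k]
          exact h.measure_two_le measurableSet_Ico (by rw [hvol]; simp)
      _ = _ := by
          rw [Finset.sum_const, Finset.card_range, nsmul_eq_mul, one_div,
            ENNReal.ofReal_inv_of_pos (by positivity)]
          have : ENNReal.ofReal ((n : ℝ) + 1) = ((n + 1 : ℕ) : ℝ≥0∞) := by
            rw [← ENNReal.ofReal_natCast]; simp
          rw [this, mul_pow, ENNReal.div_eq_inv_mul, pow_two (_⁻¹ : ℝ≥0∞), mul_left_comm,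
            ← mul_assoc ((n + 1 : ℕ) : ℝ≥0∞), ENNReal.mul_inv_cancel (by simp) (by simp), one_mul,
            mul_comm]
  have h0 := ENNReal.Tendsto.const_mul (a := (ν : ℝ≥0∞) ^ 2)
    ((ENNReal.tendsto_inv_nat_nhds_zero).comp (tendsto_add_atTop_nat 1))
    (Or.inr (by simp))
  rw [mul_zero] at h0
  refine le_antisymm (ge_of_tendsto' h0 fun n => ?_) zero_le
  simpa [div_eq_mul_inv] using key n

/-- Counts of disjoint sets are independent, so the mean of their product factorizes. Expanding that
product gives a sum over all index maps; the non-injective ones vanish, since one point cannot lie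
in two disjoint sets. -/
theorem IsPoissonProcess.tsum_measure_box (h : IsPoissonProcess P ν U) {n : ℕ}
    {A : Fin n → Set ℝ} (hA : ∀ k, MeasurableSet (A k)) (hfin : ∀ k, volume (A k) ≠ ∞)
    (hd : Pairwise fun i j => Disjoint (A i) (A j)) :
    ∑' e : Fin n ↪ ℕ, P {ω | ∀ k, U (e k) ω ∈ A k} = ∏ k, ν * volume (A k) := by
  have h1 : ∑' e : Fin n → ℕ, P {ω | ∀ k, U (e k) ω ∈ A k} = ∏ k, ν * volume (A k) := by
    simp_rw [← h.lintegral_count (hA _) (hfin _)]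
    rw [← lintegral_prod_eq_prod_lintegral_of_indepFun _ _ (h.indep n A hA hd)
      (fun k => measurable_count h.measurable (hA k))]
    simp_rw [Measure.sum_apply _ (hA _), prod_tsum_eq_tsum_prod]
    have hm : ∀ e : Fin n → ℕ, MeasurableSet {ω | ∀ k, U (e k) ω ∈ A k} := fun e => by
      rw [ofPred_forall]
      exact MeasurableSet.iInter fun k => h.measurable _ (hA k)
    have hind : ∀ (e : Fin n → ℕ) ω, ∏ k, Measure.dirac (U (e k) ω) (A k)
        = indicator {ω | ∀ k, U (e k) ω ∈ A k} 1 ω := by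
      intro e ω
      simp_rw [Measure.dirac_apply' _ (hA _)]
      by_cases hω : ∀ k, U (e k) ω ∈ A k
      · rw [indicator_of_mem (by exact hω)]
        exact Finset.prod_eq_one fun k _ => indicator_of_mem (hω k) _
      · rw [indicator_of_notMem (by exact hω)]
        obtain ⟨k, hk⟩ := not_forall.1 hω
        exact Finset.prod_eq_zero (Finset.mem_univ k) (indicator_of_notMem hk _)
    simp_rw [hind]
    rw [lintegral_tsum fun e => (measurable_one.indicator (hm e)).aemeasurable]
    congr 1 with e
    rw [lintegral_indicator_one (hm e)]
  rw [← h1]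
  refine Function.Injective.tsum_eq (f := fun e : Fin n → ℕ => P {ω | ∀ k, U (e k) ω ∈ A k})
    (g := fun e : Fin n ↪ ℕ => (e : Fin n → ℕ)) DFunLike.coe_injective ?_
  intro e he
  have hinj : Function.Injective e := by
    intro a b hab
    by_contra hne
    refine he ?_
    have : {ω | ∀ k, U (e k) ω ∈ A k} = ∅ := by
      ext ω
      simp only [mem_ofPred_eq, mem_empty_iff_false, iff_false]
      intro hω
      exact disjoint_left.1 (hd hne) (hω a) (hab ▸ hω b)
    simp [this]
  exact ⟨⟨e, hinj⟩, rfl⟩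

/-- The `n`-th factorial moment measure of a Poisson process is the product of its intensity. -/
theorem IsPoissonProcess.sum_map_embedding [IsProbabilityMeasure P]
    (h : IsPoissonProcess P ν U) (n : ℕ) :
    Measure.sum (fun e : Fin n ↪ ℕ => P.map (fun ω k => U (e k) ω))
      = Measure.pi (fun _ : Fin n => ν • (volume : Measure ℝ)) := by
  have hmeas : ∀ e : Fin n ↪ ℕ, Measurable (fun ω k => U (e k) ω) :=
    fun e => measurable_pi_lambda _ fun k => h.measurable _
  set L := Measure.sum (fun e : Fin n ↪ ℕ => P.map (fun ω k => U (e k) ω))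
  set R := Measure.pi (fun _ : Fin n => ν • (volume : Measure ℝ))
  let ι := {q : Fin n → ℚ × ℚ //
    Pairwise fun i j => Disjoint (Ioo ((q i).1 : ℝ) (q i).2) (Ioo ((q j).1 : ℝ) (q j).2)}
  let box : ι → Set (Fin n → ℝ) := fun q => univ.pi fun k => Ioo ((q.1 k).1 : ℝ) (q.1 k).2
  let D : Set (Fin n → ℝ) := {x | Function.Injective x}
  -- Points with distinct coordinates have a least gap ε, so rational intervals of radius below ε/2
  -- around the coordinates are disjoint. Countably many boxes thus cover the complement of the
  -- diagonals.
  have hcov : D ⊆ ⋃ q, box q := by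
    intro x hx
    obtain ⟨ε, hε, hsep⟩ : ∃ ε > 0, ∀ i j, i ≠ j → ε ≤ |x i - x j| := by
      by_cases hne : (Finset.univ.filter fun p : Fin n × Fin n => p.1 ≠ p.2).Nonempty
      · obtain ⟨p, hp, hmin⟩ := Finset.exists_min_image _
          (fun p : Fin n × Fin n => |x p.1 - x p.2|) hne
        refine ⟨|x p.1 - x p.2|, abs_pos.2 (sub_ne_zero.2 fun hh => ?_), fun i j hij => ?_⟩
        · exact (Finset.mem_filter.1 hp).2 (hx hh)
        · exact hmin (i, j) (by simpa using hij)
      · refine ⟨1, one_pos, fun i j hij => absurd ⟨(i, j), by simpa using hij⟩ hne⟩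
    have hq : ∀ k, ∃ q : ℚ × ℚ, (q.1 : ℝ) < x k ∧ x k < q.2 ∧ x k - ε / 2 < q.1 ∧
        (q.2 : ℝ) < x k + ε / 2 := by
      intro k
      obtain ⟨a, ha, ha'⟩ := exists_rat_btwn (show x k - ε / 2 < x k by linarith)
      obtain ⟨b, hb, hb'⟩ := exists_rat_btwn (show x k < x k + ε / 2 by linarith)
      exact ⟨(a, b), ha', hb, ha, hb'⟩
    choose q hq1 hq2 hq3 hq4 using hq
    refine mem_iUnion.2 ⟨⟨q, fun i j hij => ?_⟩, fun k _ => ⟨hq1 k, hq2 k⟩⟩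
    refine disjoint_left.2 ?_
    rintro y ⟨hy1, hy2⟩ ⟨hy3, hy4⟩
    have := hsep i j hij
    have h1 := hq3 i
    have h2 := hq3 j
    have h3 := hq4 i
    have h4 := hq4 j
    rcases abs_cases (x i - x j) with ⟨hc, _⟩ | ⟨hc, _⟩ <;> linarith
  have hdiag : Dᶜ ⊆ ⋃ p : {p : Fin n × Fin n // p.1 ≠ p.2}, {x | x p.1.1 = x p.1.2} := by
    intro x hx
    simp only [D, mem_compl_iff, mem_ofPred_eq, Function.Injective, not_forall] at hx
    obtain ⟨i, j, hij, hne⟩ := hx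
    exact mem_iUnion.2 ⟨⟨(i, j), hne⟩, hij⟩
  -- Outside the boxes two coordinates agree: this is null for `L` because immigrants do not
  -- coincide, and null for `R` because a diagonal is a proper subspace.
  have hL0 : L (⋃ q, box q)ᶜ = 0 := by
    refine measure_mono_null (compl_subset_compl.2 hcov) (measure_mono_null hdiag
      (measure_iUnion_null fun p => ?_))
    have hm : MeasurableSet {x : Fin n → ℝ | x p.1.1 = x p.1.2} :=
      measurableSet_eq_fun (measurable_pi_apply _) (measurable_pi_apply _)
    rw [Measure.sum_apply _ hm, ENNReal.tsum_eq_zero]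
    intro e
    rw [Measure.map_apply (hmeas e) hm]
    exact h.measure_eq_eq_zero (fun hh => p.2 (e.injective hh))
  have hR0 : R (⋃ q, box q)ᶜ = 0 := by
    refine measure_mono_null (compl_subset_compl.2 hcov) (measure_mono_null hdiag
      (measure_iUnion_null fun p => ?_))
    have hRv : R = (∏ _k : Fin n, (ν : ℝ≥0∞)) • (volume : Measure (Fin n → ℝ)) := by
      refine Measure.pi_eq fun s _ => ?_
      simp only [Measure.smul_apply, volume_pi_pi, Finset.prod_mul_distrib, ENNReal.smul_def,
        smul_eq_mul]
    rw [hRv, Measure.smul_apply]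
    have hz : volume {x : Fin n → ℝ | x p.1.1 = x p.1.2} = 0 := by
      let ℓ : (Fin n → ℝ) →ₗ[ℝ] ℝ := (LinearMap.proj p.1.1 : (Fin n → ℝ) →ₗ[ℝ] ℝ) -
        (LinearMap.proj p.1.2 : (Fin n → ℝ) →ₗ[ℝ] ℝ)
      have hs : {x : Fin n → ℝ | x p.1.1 = x p.1.2} = (LinearMap.ker ℓ : Set (Fin n → ℝ)) := by
        ext x; simp [ℓ, sub_eq_zero]
      rw [hs]
      refine Measure.addHaar_submodule _ _ fun htop => ?_
      have : Pi.single p.1.1 (1 : ℝ) ∈ LinearMap.ker ℓ := htop ▸ Submodule.mem_top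
      simp [ℓ, Pi.single_eq_of_ne p.2.symm] at this
    simp [hz]
  -- The sides of a box are disjoint, and so are the sides of any product set inside it; the formula
  -- for disjoint sets therefore determines the restriction of `L`.
  have hbox : ∀ q, L.restrict (box q) = R.restrict (box q) := by
    intro q
    have hR1 : R.restrict (box q) = Measure.pi (fun k =>
        (ν • (volume : Measure ℝ)).restrict (Ioo ((q.1 k).1 : ℝ) (q.1 k).2)) := by
      rw [Measure.restrict_pi_pi]
    rw [hR1]
    refine (Measure.pi_eq fun s hs => ?_).symm
    rw [Measure.restrict_apply (MeasurableSet.univ_pi hs), ← pi_inter_distrib,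
      Measure.sum_apply _ (MeasurableSet.univ_pi fun k => (hs k).inter measurableSet_Ioo)]
    simp_rw [Measure.restrict_apply (hs _)]
    have hb := h.tsum_measure_box (A := fun k => s k ∩ Ioo ((q.1 k).1 : ℝ) (q.1 k).2)
      (fun k => (hs k).inter measurableSet_Ioo)
      (fun k => ((measure_mono inter_subset_right).trans_lt (by simp)).ne)
      (fun i j hij => (q.2 hij).mono inter_subset_right inter_subset_right)
    simp only [Measure.smul_apply, ENNReal.smul_def, smul_eq_mul]
    rw [← hb]
    congr 1 with e
    rw [Measure.map_apply (hmeas e)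
      (MeasurableSet.univ_pi fun k => (hs k).inter measurableSet_Ioo)]
    congr 1
    ext ω
    simp
  have hU := Measure.restrict_iUnion_congr.2 hbox
  rwa [Measure.restrict_eq_self_of_ae_mem (s := ⋃ q, box q) (mem_ae_iff.2 hL0),
    Measure.restrict_eq_self_of_ae_mem (s := ⋃ q, box q) (mem_ae_iff.2 hR0)] at hU

end Poisson

/-! ### The marked Poisson process of immigrants, clusters and signs -/

/-- The law of a sign with mean `θ`. -/
def signLaw (θ : ℝ) : Measure ℝ :=
  ENNReal.ofReal ((1 + θ) / 2) • Measure.dirac 1 + ENNReal.ofReal ((1 - θ) / 2) • Measure.dirac (-1)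

instance (θ : ℝ) : IsFiniteMeasure (signLaw θ) := by
  constructor
  simp [signLaw]

/-- The intensity of the marked process of immigrants, clusters and signs. -/
def markLaw (ν : ℝ≥0) (Q : Measure (Measure ℝ)) (θ : ℝ) : Measure (ℝ × Measure ℝ × ℝ) :=
  (ν • (volume : Measure ℝ)).prod (Q.prod (signLaw θ))

/-- Regroups an `n`-tuple of positions, one of clusters and one of signs into an `n`-tuple of marks.
-/
theorem measurePreserving_zip {n : ℕ} {α β γ : Type*} [MeasurableSpace α] [MeasurableSpace β]
    [MeasurableSpace γ] (μ : Measure α) (ν : Measure β) (τ : Measure γ) [SigmaFinite μ]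
    [SigmaFinite ν] [SigmaFinite τ] :
    MeasurePreserving
      (fun (p : (Fin n → α) × (Fin n → β) × (Fin n → γ)) k => (p.1 k, p.2.1 k, p.2.2 k))
      ((Measure.pi fun _ => μ).prod ((Measure.pi fun _ => ν).prod (Measure.pi fun _ => τ)))
      (Measure.pi fun _ => μ.prod (ν.prod τ)) := by
  have h1 := (measurePreserving_arrowProdEquivProdArrow β γ (Fin n) (fun _ => ν)
    (fun _ => τ)).symm
  have h2 := (measurePreserving_arrowProdEquivProdArrow α (β × γ) (Fin n) (fun _ => μ)
    (fun _ => ν.prod τ)).symm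
  exact h2.comp ((MeasurePreserving.id (Measure.pi fun _ : Fin n => μ)).prod h1)

section Marked

variable {Ω : Type*} [MeasurableSpace Ω] {P : Measure Ω} {ν : ℝ≥0}
  {Q : Measure (Measure ℝ)} {U : ℕ → Ω → ℝ} {C : ℕ → Ω → Measure ℝ} {S : ℝ → ℕ → Ω → ℝ} {θ : ℝ}

theorem IsSignSymmetrizedFamily.map_sign [IsProbabilityMeasure P]
    (h : IsSignSymmetrizedFamily P ν Q U C S)
    (hθ : θ ∈ Icc (-1 : ℝ) 1) (j : ℕ) : P.map (S θ j) = signLaw θ := by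
  have hm := h.measurable_sign θ hθ j
  have hp : P.map (S θ j) {1} = ENNReal.ofReal ((1 + θ) / 2) := by
    rw [Measure.map_apply hm (measurableSet_singleton _)]; exact h.sign_pos θ hθ j
  have hn : P.map (S θ j) {-1} = ENNReal.ofReal ((1 - θ) / 2) := by
    rw [Measure.map_apply hm (measurableSet_singleton _)]; exact h.sign_neg θ hθ j
  have : IsProbabilityMeasure (P.map (S θ j)) := Measure.isProbabilityMeasure_map hm.aemeasurable
  have hdisj : Disjoint ({1} : Set ℝ) {-1} := by
    rw [disjoint_singleton]; norm_num
  have htot : P.map (S θ j) ({1} ∪ {-1})ᶜ = 0 := by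
    rw [prob_compl_eq_zero_iff ((measurableSet_singleton _).union (measurableSet_singleton _)),
      measure_union hdisj (measurableSet_singleton _), hp, hn,
      ← ENNReal.ofReal_add (by linarith [hθ.1]) (by linarith [hθ.2])]
    rw [show (1 + θ) / 2 + (1 - θ) / 2 = 1 by ring, ENNReal.ofReal_one]
  rw [← Measure.restrict_eq_self_of_ae_mem (s := {1} ∪ {-1}) (mem_ae_iff.2 htot),
    Measure.restrict_union hdisj (measurableSet_singleton _), Measure.restrict_singleton,
    Measure.restrict_singleton, hp, hn, signLaw]

theorem IsSignSymmetrizedFamily.measurable_mark (h : IsSignSymmetrizedFamily P ν Q U C S)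
    (hθ : θ ∈ Icc (-1 : ℝ) 1) (j : ℕ) : Measurable fun ω => (U j ω, C j ω, S θ j ω) :=
  (h.poisson.measurable j).prodMk ((h.measurable_cluster j).prodMk (h.measurable_sign θ hθ j))

/-- Injectivity of `e` makes the selected clusters and signs i.i.d. The joint law of the positions
is left unfactored: only its sum over all `e` is a product. -/
theorem IsSignSymmetrizedFamily.map_marks [IsProbabilityMeasure P]
    (h : IsSignSymmetrizedFamily P ν Q U C S)
    (hθ : θ ∈ Icc (-1 : ℝ) 1) {n : ℕ} (e : Fin n ↪ ℕ) :
    P.map (fun ω => ((fun k => U (e k) ω), (fun k => C (e k) ω), fun k => S θ (e k) ω)) =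
      (P.map fun ω k => U (e k) ω).prod
        ((Measure.pi fun _ : Fin n => Q).prod (Measure.pi fun _ : Fin n => signLaw θ)) := by
  have hu : Measurable fun ω k => U (e k) ω :=
    measurable_pi_lambda _ fun k => h.poisson.measurable _
  have hc : Measurable fun ω k => C (e k) ω :=
    measurable_pi_lambda _ fun k => h.measurable_cluster _
  have hs : Measurable fun ω k => S θ (e k) ω :=
    measurable_pi_lambda _ fun k => h.measurable_sign θ hθ _
  have hpr : ∀ {α : Type _} [MeasurableSpace α],
      Measurable fun (x : ℕ → α) (k : Fin n) => x (e k) :=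
    fun {α} _ => measurable_pi_lambda _ fun k => measurable_pi_apply _
  have huc : IndepFun (fun ω k => U (e k) ω) (fun ω k => C (e k) ω) P :=
    h.indep_immigrants_clusters.comp hpr hpr
  have hucs : IndepFun (fun ω => ((fun k => U (e k) ω), fun k => C (e k) ω))
      (fun ω k => S θ (e k) ω) P :=
    (h.indep_signs_rest θ hθ).symm.comp
      (φ := fun p : (ℕ → ℝ) × (ℕ → Measure ℝ) => ((fun k : Fin n => p.1 (e k)),
        fun k : Fin n => p.2 (e k)))
      ((hpr.comp measurable_fst).prodMk (hpr.comp measurable_snd)) hpr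
  have hQ : P.map (fun ω k => C (e k) ω) = Measure.pi fun _ : Fin n => Q := by
    rw [(iIndepFun_iff_map_fun_eq_pi_map fun k => (h.measurable_cluster _).aemeasurable).1
      (h.indep_clusters.precomp e.injective)]
    simp_rw [h.law_cluster]
  have hS : P.map (fun ω k => S θ (e k) ω) = Measure.pi fun _ : Fin n => signLaw θ := by
    rw [(iIndepFun_iff_map_fun_eq_pi_map fun k => (h.measurable_sign θ hθ _).aemeasurable).1
      ((h.indep_signs θ hθ).precomp e.injective)]
    simp_rw [h.map_sign hθ]
  have h1 := (indepFun_iff_map_prod_eq_prod_map_map (hu.prodMk hc).aemeasurable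
    hs.aemeasurable).1 hucs
  rw [(indepFun_iff_map_prod_eq_prod_map_map hu.aemeasurable hc.aemeasurable).1 huc, hQ, hS] at h1
  have := h.clusterLaw.isProbability
  have : IsFiniteMeasure (P.map fun ω k => U (e k) ω) := inferInstance
  have h2 := congrArg (Measure.map MeasurableEquiv.prodAssoc) h1
  rw [Measure.map_map MeasurableEquiv.prodAssoc.measurable ((hu.prodMk hc).prodMk hs)] at h2
  rw [Measure.prodAssoc_prod] at h2
  exact h2

/-- The `n`-th factorial moment measure of the marked immigrants is the product of the intensity
of the marked process. -/
theorem IsSignSymmetrizedFamily.sum_map_embedding [IsProbabilityMeasure P]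
    (h : IsSignSymmetrizedFamily P ν Q U C S)
    (hθ : θ ∈ Icc (-1 : ℝ) 1) (n : ℕ) :
    Measure.sum (fun e : Fin n ↪ ℕ =>
      P.map fun ω k => (U (e k) ω, C (e k) ω, S θ (e k) ω)) =
      Measure.pi fun _ : Fin n => markLaw ν Q θ := by
  have := h.clusterLaw.isProbability
  have hzip := measurePreserving_zip (n := n) (ν • (volume : Measure ℝ)) Q (signLaw θ)
  have hu : ∀ e : Fin n ↪ ℕ, Measurable fun ω k => U (e k) ω := fun e =>
    measurable_pi_lambda _ fun k => h.poisson.measurable _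
  have hc : ∀ e : Fin n ↪ ℕ, Measurable fun ω k => C (e k) ω := fun e =>
    measurable_pi_lambda _ fun k => h.measurable_cluster _
  have hs : ∀ e : Fin n ↪ ℕ, Measurable fun ω k => S θ (e k) ω := fun e =>
    measurable_pi_lambda _ fun k => h.measurable_sign θ hθ _
  have hmap : ∀ e : Fin n ↪ ℕ, P.map (fun ω k => (U (e k) ω, C (e k) ω, S θ (e k) ω)) =
      ((P.map fun ω k => U (e k) ω).prod
        ((Measure.pi fun _ : Fin n => Q).prod (Measure.pi fun _ : Fin n => signLaw θ))).map
        (fun (p : (Fin n → ℝ) × (Fin n → Measure ℝ) × (Fin n → ℝ)) k =>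
          (p.1 k, p.2.1 k, p.2.2 k)) := by
    intro e
    rw [← h.map_marks hθ e, Measure.map_map hzip.measurable
      ((hu e).prodMk ((hc e).prodMk (hs e)))]
    rfl
  simp_rw [hmap]
  -- The cluster and sign factor does not depend on `e`, so the sum acts on the position factor
  -- alone.
  rw [← Measure.map_sum hzip.measurable.aemeasurable, ← Measure.prod_sum_left,
    h.poisson.sum_map_embedding n, hzip.map_eq]
  rfl

end Marked

/-! ### Sums over tuples of distinct indices -/

theorem tsum_embedding {α M : Type*} [AddCommMonoid M] [TopologicalSpace M] {n : ℕ}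
    (F : (Fin n → α) → M) :
    ∑' e : Fin n ↪ α, F e = ∑' y, indicator {y | Function.Injective y} F y := by
  rw [← tsum_subtype, ← (Equiv.subtypeInjectiveEquivEmbedding (Fin n) α).tsum_eq]
  rfl

theorem tsum_fin_succ {α : Type*} {n : ℕ} (F : (Fin (n + 1) → α) → ℝ≥0∞) :
    ∑' y, F y = ∑' a, ∑' y, F (Fin.cons a y) := by
  rw [← (Fin.consEquiv (fun _ : Fin (n + 1) => α)).tsum_eq, ENNReal.tsum_prod']
  rfl

theorem tsum_fin_zero {α : Type*} (F : (Fin 0 → α) → ℝ≥0∞) : ∑' y, F y = F ![] := by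
  rw [tsum_eq_single ![] fun b hb => absurd (Subsingleton.elim _ _) hb]

theorem tsum_embedding_one {α : Type*} (F : (Fin 1 → α) → ℝ≥0∞) :
    ∑' e : Fin 1 ↪ α, F e = ∑' a, F ![a] := by
  rw [tsum_embedding, tsum_fin_succ]
  congr 1 with a
  rw [tsum_fin_zero, indicator_of_mem (by exact Function.injective_of_subsingleton _)]
  rfl

theorem injective_vec_two {α : Type*} {a b : α} : Function.Injective ![a, b] ↔ a ≠ b := by
  simp [Function.Injective, Fin.forall_fin_two, eq_comm]

theorem injective_vec_three {α : Type*} {a b c : α} :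
    Function.Injective ![a, b, c] ↔ a ≠ b ∧ a ≠ c ∧ b ≠ c := by
  simp [Function.Injective, Fin.forall_fin_succ, eq_comm]
  tauto

open Classical in
theorem tsum_embedding_two {α : Type*} (F : (Fin 2 → α) → ℝ≥0∞) :
    ∑' e : Fin 2 ↪ α, F e = ∑' a, ∑' b, if a ≠ b then F ![a, b] else 0 := by
  rw [tsum_embedding, tsum_fin_succ]
  congr 1 with a
  rw [tsum_fin_succ]
  congr 1 with b
  rw [tsum_fin_zero]
  split_ifs with h
  · exact indicator_of_mem (s := {y | Function.Injective y}) (injective_vec_two.2 h) F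
  · exact indicator_of_notMem (s := {y | Function.Injective y})
      (fun h' => h (injective_vec_two.1 h')) F

open Classical in
theorem tsum_embedding_three {α : Type*} (F : (Fin 3 → α) → ℝ≥0∞) :
    ∑' e : Fin 3 ↪ α, F e =
      ∑' a, ∑' b, ∑' c, if a ≠ b ∧ a ≠ c ∧ b ≠ c then F ![a, b, c] else 0 := by
  rw [tsum_embedding, tsum_fin_succ]
  congr 1 with a
  rw [tsum_fin_succ]
  congr 1 with b
  rw [tsum_fin_succ]
  congr 1 with c
  rw [tsum_fin_zero]
  split_ifs with h
  · exact indicator_of_mem (s := {y | Function.Injective y}) (injective_vec_three.2 h) F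
  · exact indicator_of_notMem (s := {y | Function.Injective y})
      (fun h' => h (injective_vec_three.1 h')) F

theorem tsum_tsum_split {α : Type*} (f : α → α → ℝ≥0∞) :
    ∑' a, ∑' b, f a b = ∑' a, f a a + ∑' e : Fin 2 ↪ α, f (e 0) (e 1) := by
  classical
  rw [tsum_embedding_two fun e => f (e 0) (e 1), ← ENNReal.tsum_add]
  congr 1 with a
  rw [← tsum_ite_eq a (fun b => f a b), ← ENNReal.tsum_add]
  congr 1 with b
  by_cases h : a = b
  · simp [h]
  · simp [h, Ne.symm h]

/-- The five terms are the five set partitions of three indices. Each is rewritten as a full triple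
sum with a condition on the indices, after which the identity is checked term by term. -/
theorem tsum_tsum_tsum_split {α : Type*} (f : α → α → α → ℝ≥0∞) :
    ∑' a, ∑' b, ∑' c, f a b c = ∑' a, f a a a
      + ∑' e : Fin 2 ↪ α, (f (e 0) (e 0) (e 1) + f (e 0) (e 1) (e 0) + f (e 1) (e 0) (e 0))
      + ∑' e : Fin 3 ↪ α, f (e 0) (e 1) (e 2) := by
  classical
  rw [tsum_embedding_two fun e =>
    (f (e 0) (e 0) (e 1) + f (e 0) (e 1) (e 0) + f (e 1) (e 0) (e 0)),
    tsum_embedding_three fun e => f (e 0) (e 1) (e 2)]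
  have h1 : ∑' a, f a a a =
      ∑' a, ∑' b, ∑' c, if b = a then (if c = a then f a b c else 0) else 0 := by
    congr 1 with a
    rw [← tsum_ite_eq a (fun b => f a b b)]
    congr 1 with b
    by_cases h : b = a
    · subst h; simp
    · simp [h]
  have h2 : ∑' a, ∑' b, (if a ≠ b then f a a b else 0)
      = ∑' a, ∑' b, ∑' c, if b = a then (if a ≠ c then f a b c else 0) else 0 := by
    congr 1 with a
    rw [tsum_eq_single (f := fun b => ∑' c, if b = a then (if a ≠ c then f a b c else 0) else 0) a
      (fun b hb => by simp [hb])]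
    simp
  have h3 : ∑' a, ∑' b, (if a ≠ b then f a b a else 0)
      = ∑' a, ∑' b, ∑' c, if c = a then (if a ≠ b then f a b c else 0) else 0 := by
    congr 1 with a
    congr 1 with b
    rw [tsum_ite_eq]
  have h4 : ∑' a, ∑' b, (if a ≠ b then f b a a else 0)
      = ∑' a, ∑' b, ∑' c, if c = b then (if a ≠ b then f a b c else 0) else 0 := by
    rw [ENNReal.tsum_comm]
    congr 1 with a
    congr 1 with b
    rw [tsum_ite_eq]
    simp [eq_comm]
  have hite : ∀ (a b : α), (if a ≠ b then f a a b + f a b a + f b a a else 0)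
      = (if a ≠ b then f a a b else 0) + (if a ≠ b then f a b a else 0) +
        (if a ≠ b then f b a a else 0) := by
    intro a b; split_ifs <;> simp
  simp only [Fin.isValue, Matrix.cons_val_zero, Matrix.cons_val_one, Matrix.cons_val]
  simp_rw [hite, ENNReal.tsum_add]
  rw [h1, h2, h3, h4]
  simp_rw [← ENNReal.tsum_add]
  congr 1 with a
  congr 1 with b
  congr 1 with c
  by_cases hab : a = b
  · subst hab
    by_cases hac : a = c
    · subst hac; simp
    · simp [hac, Ne.symm hac]
  · by_cases hac : a = c
    · subst hac; simp [hab, Ne.symm hab]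
    · by_cases hbc : b = c
      · subst hbc; simp [hab, Ne.symm hab]
      · simp [hab, hac, hbc, Ne.symm hab, Ne.symm hac, Ne.symm hbc]

/-! ### Factorial moments of a Poisson cluster process -/

/-- Pairs of distinct points. -/
def offDiag2 : Set (ℝ × ℝ) := {p | p.1 ≠ p.2}

/-- Triples of pairwise distinct points. -/
def offDiag3 : Set (ℝ × ℝ × ℝ) := {p | p.1 ≠ p.2.1 ∧ p.1 ≠ p.2.2 ∧ p.2.1 ≠ p.2.2}

theorem measurableSet_offDiag2 : MeasurableSet offDiag2 :=
  (measurableSet_eq_fun measurable_fst measurable_snd).compl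

theorem measurableSet_offDiag3 : MeasurableSet offDiag3 :=
  ((measurableSet_eq_fun (by fun_prop) (by fun_prop)).compl).inter
    (((measurableSet_eq_fun (by fun_prop) (by fun_prop)).compl).inter
      ((measurableSet_eq_fun (by fun_prop) (by fun_prop)).compl))

theorem lintegral_pi_succ {X : Type*} [MeasurableSpace X] (ρ : Measure X) [SigmaFinite ρ] {n : ℕ}
    {H : (Fin (n + 1) → X) → ℝ≥0∞} (hH : Measurable H) :
    ∫⁻ y, H y ∂Measure.pi (fun _ => ρ) =
      ∫⁻ a, ∫⁻ y, H (Fin.cons a y) ∂Measure.pi (fun _ => ρ) ∂ρ := by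
  have h := (measurePreserving_piFinSuccAbove (fun _ : Fin (n + 1) => ρ) 0).symm
  rw [← h.lintegral_comp hH, lintegral_prod]
  · congr 1 with a
    congr 1 with y
    simp [MeasurableEquiv.piFinSuccAbove, Fin.insertNthEquiv]
  · exact (hH.comp h.measurable).aemeasurable

theorem lintegral_pi_one {X : Type*} [MeasurableSpace X] (ρ : Measure X) [SigmaFinite ρ]
    {H : (Fin 1 → X) → ℝ≥0∞} (hH : Measurable H) :
    ∫⁻ y, H y ∂Measure.pi (fun _ => ρ) = ∫⁻ a, H ![a] ∂ρ := by
  rw [lintegral_pi_succ ρ hH]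
  congr 1 with a
  rw [lintegral_unique, Measure.pi_univ]
  simp only [Finset.univ_eq_empty, Finset.prod_empty, mul_one]
  congr

theorem measurable_vecCons {X : Type*} [MeasurableSpace X] {n : ℕ} (a : X) :
    Measurable fun y : Fin n → X => (Fin.cons a y : Fin (n + 1) → X) :=
  measurable_pi_lambda _ fun k => by
    refine Fin.cases ?_ (fun k => ?_) k
    · simp
    · simpa using measurable_pi_apply k

theorem lintegral_pi_two {X : Type*} [MeasurableSpace X] (ρ : Measure X) [SigmaFinite ρ]
    {H : (Fin 2 → X) → ℝ≥0∞} (hH : Measurable H) :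
    ∫⁻ y, H y ∂Measure.pi (fun _ => ρ) = ∫⁻ a, ∫⁻ b, H ![a, b] ∂ρ ∂ρ := by
  rw [lintegral_pi_succ ρ hH]
  congr 1 with a
  exact lintegral_pi_one ρ (hH.comp (measurable_vecCons a))

theorem lintegral_pi_three {X : Type*} [MeasurableSpace X] (ρ : Measure X) [SigmaFinite ρ]
    {H : (Fin 3 → X) → ℝ≥0∞} (hH : Measurable H) :
    ∫⁻ y, H y ∂Measure.pi (fun _ => ρ) = ∫⁻ a, ∫⁻ b, ∫⁻ c, H ![a, b, c] ∂ρ ∂ρ ∂ρ := by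
  rw [lintegral_pi_succ ρ hH]
  congr 1 with a
  exact lintegral_pi_two ρ (hH.comp (measurable_vecCons a))

/-! ### Fubini for products of averaged kernels. -/

section Fubini

variable {X A B : Type*} [MeasurableSpace X] [MeasurableSpace A] [MeasurableSpace B]
  (ρ : Measure X)

theorem lintegral_prod_bind_left (κ : Kernel X A) [IsSFiniteKernel κ] (m : Measure B) [SFinite m]
    {F : A × B → ℝ≥0∞} (hF : Measurable F) :
    ∫⁻ z, ∫⁻ q, F q ∂(κ z).prod m ∂ρ = ∫⁻ q, F q ∂(ρ.bind κ).prod m := by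
  rw [lintegral_prod _ hF.aemeasurable, Measure.lintegral_bind κ.measurable.aemeasurable
    hF.lintegral_prod_right'.aemeasurable]
  congr 1 with z
  rw [lintegral_prod _ hF.aemeasurable]

theorem lintegral_prod_bind_right [SFinite ρ] (m : Measure A) [SFinite m] (κ : Kernel X B)
    [IsSFiniteKernel κ]
    {F : A × B → ℝ≥0∞} (hF : Measurable F) :
    ∫⁻ z, ∫⁻ q, F q ∂m.prod (κ z) ∂ρ = ∫⁻ q, F q ∂m.prod (ρ.bind κ) := by
  rw [← lintegral_prod_swap, ← lintegral_prod_bind_left ρ κ m (F := fun q => F q.swap)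
    (hF.comp measurable_swap)]
  congr 1 with z
  rw [← lintegral_prod_swap]

/-- A diffuse coordinate almost surely avoids any value determined by the other one. This removes
off-diagonal conditions between points of different clusters. -/
theorem ae_prod_snd_ne (m : Measure A) [SFinite m] {κ : Measure ℝ} [SFinite κ]
    [NullSingletonClass κ]
    {f : A → ℝ} (hf : Measurable f) : ∀ᵐ q ∂m.prod κ, f q.1 ≠ q.2 := by
  refine (Measure.ae_prod_iff_ae_ae ?_).2 (Eventually.of_forall fun a => ?_)
  · exact (measurableSet_eq_fun (by fun_prop) (by fun_prop)).compl
  · filter_upwards [compl_mem_ae_iff.2 (measure_singleton (μ := κ) (f a))] with w hw h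
    exact hw h.symm

end Fubini

/-! ### Cumulant and moment measures of a Poisson cluster process. -/

section Cluster

variable {X : Type*} [MeasurableSpace X] (ρ : Measure X) (η : Kernel X ℝ)

/-- The second factorial cumulant measure of the Poisson cluster process with mark intensity `ρ`
and clusters `η`. -/
def clusterCumulant2 : Measure (ℝ × ℝ) := (ρ.bind (η ×ₖ η)).restrict offDiag2

/-- The third factorial cumulant measure of the Poisson cluster process with mark intensity `ρ`
and clusters `η`. -/
def clusterCumulant3 : Measure (ℝ × ℝ × ℝ) := (ρ.bind (η ×ₖ (η ×ₖ η))).restrict offDiag3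

variable [IsSFiniteKernel η]

instance [SFinite ρ] : SFinite (clusterCumulant2 ρ η) := by
  unfold clusterCumulant2
  infer_instance

theorem lintegral_clusterCumulant2 {F : ℝ × ℝ → ℝ≥0∞} (hF : Measurable F) :
    ∫⁻ p, F p ∂clusterCumulant2 ρ η =
      ∫⁻ z, ∫⁻ p, offDiag2.indicator F p ∂(η z).prod (η z) ∂ρ := by
  rw [clusterCumulant2, ← lintegral_indicator measurableSet_offDiag2,
    Measure.lintegral_bind (Kernel.measurable _).aemeasurable
      (hF.indicator measurableSet_offDiag2).aemeasurable]
  simp_rw [Kernel.prod_apply]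

theorem lintegral_clusterCumulant3 {F : ℝ × ℝ × ℝ → ℝ≥0∞} (hF : Measurable F) :
    ∫⁻ p, F p ∂clusterCumulant3 ρ η =
      ∫⁻ z, ∫⁻ p, offDiag3.indicator F p ∂(η z).prod ((η z).prod (η z)) ∂ρ := by
  rw [clusterCumulant3, ← lintegral_indicator measurableSet_offDiag3,
    Measure.lintegral_bind (Kernel.measurable _).aemeasurable
      (hF.indicator measurableSet_offDiag3).aemeasurable]
  simp_rw [Kernel.prod_apply]

/-- The second factorial moment measure of the Poisson cluster process. -/
def clusterMoment2 : Measure (ℝ × ℝ) :=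
  clusterCumulant2 ρ η + (ρ.bind η).prod (ρ.bind η)

/-- The part of the third factorial moment measure of the Poisson cluster process which comes from
triples that do not belong to a single cluster. -/
def clusterMixed3 : Measure (ℝ × ℝ × ℝ) :=
  ((clusterCumulant2 ρ η).prod (ρ.bind η)).map (fun q => (q.1.1, q.1.2, q.2))
    + ((clusterCumulant2 ρ η).prod (ρ.bind η)).map (fun q => (q.1.1, q.2, q.1.2))
    + ((clusterCumulant2 ρ η).prod (ρ.bind η)).map (fun q => (q.2, q.1.1, q.1.2))
    + (ρ.bind η).prod ((ρ.bind η).prod (ρ.bind η))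

/-- The third factorial moment measure of the Poisson cluster process. -/
def clusterMoment3 : Measure (ℝ × ℝ × ℝ) := clusterCumulant3 ρ η + clusterMixed3 ρ η

variable [SFinite ρ]

theorem lintegral_pair_single {G : (ℝ × ℝ) × ℝ → ℝ≥0∞} (hG : Measurable G) :
    ∫⁻ z, ∫⁻ z', ∫⁻ q, G q ∂((η z).prod (η z)).prod (η z') ∂ρ ∂ρ =
      ∫⁻ q, G q ∂(ρ.bind (η ×ₖ η)).prod (ρ.bind η) := by
  rw [← lintegral_prod_bind_left ρ (η ×ₖ η) (ρ.bind η) hG]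
  congr 1 with z
  rw [lintegral_prod_bind_right ρ _ η hG, Kernel.prod_apply]

theorem lintegral_three_singles {F : ℝ × ℝ × ℝ → ℝ≥0∞} (hF : Measurable F) :
    ∫⁻ z, ∫⁻ z', ∫⁻ z'', ∫⁻ q, F q ∂(η z).prod ((η z').prod (η z'')) ∂ρ ∂ρ ∂ρ =
      ∫⁻ q, F q ∂(ρ.bind η).prod ((ρ.bind η).prod (ρ.bind η)) := by
  rw [← lintegral_prod_bind_left ρ η _ hF]
  congr 1 with z
  have h1 : ∀ z', ∫⁻ z'', ∫⁻ q, F q ∂(η z).prod ((η z').prod (η z'')) ∂ρ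
      = ∫⁻ q, F (q.1.1, q.1.2, q.2) ∂((η z).prod (η z')).prod (ρ.bind η) := by
    intro z'
    rw [← lintegral_prod_bind_right ρ _ η (F := fun q : (ℝ × ℝ) × ℝ => F (q.1.1, q.1.2, q.2))
      (by fun_prop)]
    congr 1 with z''
    rw [← Measure.prodAssoc_prod, lintegral_map hF (by fun_prop)]
    rfl
  simp_rw [h1]
  have h2 : ∀ z', ∫⁻ q, F (q.1.1, q.1.2, q.2) ∂((η z).prod (η z')).prod (ρ.bind η)
      = ∫⁻ q, ∫⁻ w, F (q.1, q.2, w) ∂ρ.bind η ∂(η z).prod (η z') := by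
    intro z'
    rw [lintegral_prod _ (by fun_prop)]
  simp_rw [h2]
  rw [lintegral_prod_bind_right ρ _ η (F := fun q => ∫⁻ w, F (q.1, q.2, w) ∂ρ.bind η)
    (Measurable.lintegral_prod_right' (f := fun r : (ℝ × ℝ) × ℝ => F (r.1.1, r.1.2, r.2))
      (by fun_prop)), ← Measure.prodAssoc_prod, lintegral_map hF (by fun_prop)]
  exact (lintegral_prod (fun a => F (MeasurableEquiv.prodAssoc a)) (by fun_prop)).symm

theorem prod_restrict_offDiag2 [NullSingletonClass (ρ.bind η)] :
    ((ρ.bind η).prod (ρ.bind η)).restrict offDiag2 = (ρ.bind η).prod (ρ.bind η) :=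
  Measure.restrict_eq_self_of_ae_mem (ae_prod_snd_ne _ measurable_id)

theorem prod_prod_restrict_offDiag3 [NullSingletonClass (ρ.bind η)] :
    ((ρ.bind η).prod ((ρ.bind η).prod (ρ.bind η))).restrict offDiag3
      = (ρ.bind η).prod ((ρ.bind η).prod (ρ.bind η)) := by
  refine Measure.restrict_eq_self_of_ae_mem ?_
  refine (Measure.ae_prod_iff_ae_ae measurableSet_offDiag3).2 (Eventually.of_forall fun x => ?_)
  refine (Measure.ae_prod_iff_ae_ae (measurableSet_offDiag3.preimage measurable_prodMk_left)).2 ?_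
  filter_upwards [compl_mem_ae_iff.2 (measure_singleton (μ := ρ.bind η) x)] with y hy
  filter_upwards [compl_mem_ae_iff.2 (measure_singleton (μ := ρ.bind η) x),
    compl_mem_ae_iff.2 (measure_singleton (μ := ρ.bind η) y)] with w hw hw'
  exact ⟨fun h => hy h.symm, fun h => hw h.symm, fun h => hw' h.symm⟩

/-- The map `e` says which of the three slots belongs to the separate cluster. The point of that
cluster has diffuse averaged law and misses the other two, so only the off-diagonal condition inside
the pair survives. -/
theorem lintegral_pair_single_offDiag [NullSingletonClass (ρ.bind η)] {F : ℝ × ℝ × ℝ → ℝ≥0∞}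
    (hF : Measurable F) {e : (ℝ × ℝ) × ℝ → ℝ × ℝ × ℝ} (he : Measurable e)
    (hoff : ∀ q, e q ∈ offDiag3 ↔ q.1.1 ≠ q.1.2 ∧ q.1.1 ≠ q.2 ∧ q.1.2 ≠ q.2) :
    ∫⁻ z, ∫⁻ z', ∫⁻ q, offDiag3.indicator F (e q) ∂((η z).prod (η z)).prod (η z') ∂ρ ∂ρ =
      ∫⁻ q, F q ∂((clusterCumulant2 ρ η).prod (ρ.bind η)).map e := by
  have hm : Measurable fun q => offDiag3.indicator F (e q) :=
    (hF.indicator measurableSet_offDiag3).comp he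
  rw [lintegral_pair_single ρ η hm, lintegral_map hF he, clusterCumulant2]
  have hr : ((ρ.bind (η ×ₖ η)).restrict offDiag2).prod (ρ.bind η) =
      ((ρ.bind (η ×ₖ η)).prod (ρ.bind η)).restrict (offDiag2 ×ˢ univ) := by
    rw [← Measure.prod_restrict, Measure.restrict_univ]
  rw [hr, ← lintegral_indicator (measurableSet_offDiag2.prod MeasurableSet.univ)]
  refine lintegral_congr_ae ?_
  filter_upwards [ae_prod_snd_ne (ρ.bind (η ×ₖ η)) (κ := ρ.bind η) measurable_fst,
    ae_prod_snd_ne (ρ.bind (η ×ₖ η)) (κ := ρ.bind η) measurable_snd] with q h1 h2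
  by_cases h : q.1.1 = q.1.2
  · rw [indicator_of_notMem (fun h' => ((hoff q).1 h').1 h),
      indicator_of_notMem (fun h' => h'.1 h)]
  · rw [indicator_of_mem ((hoff q).2 ⟨h, h1, h2⟩),
      indicator_of_mem (show q ∈ offDiag2 ×ˢ univ from ⟨h, mem_univ _⟩)]

end Cluster

/-! ### Campbell formulas and the expansion of factorial moments by clusters. -/

section Moments

variable {Ω X : Type*} [MeasurableSpace Ω] [MeasurableSpace X] {P : Measure Ω} {Z : ℕ → Ω → X}
  {ρ : Measure X} {η : Kernel X ℝ}

instance {n : ℕ} : Countable (Fin n ↪ ℕ) :=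
  (DFunLike.coe_injective (F := Fin n ↪ ℕ)).countable

/-- Campbell's formula for tuples of distinct marks. -/
theorem tsum_lintegral_embedding (hZ : ∀ j, Measurable (Z j)) {n : ℕ}
    (hmom : Measure.sum (fun e : Fin n ↪ ℕ => P.map fun ω k => Z (e k) ω) =
      Measure.pi fun _ => ρ) {H : (Fin n → X) → ℝ≥0∞} (hH : Measurable H) :
    ∫⁻ ω, ∑' e : Fin n ↪ ℕ, H (fun k => Z (e k) ω) ∂P = ∫⁻ y, H y ∂Measure.pi fun _ => ρ := by
  have hm : ∀ e : Fin n ↪ ℕ, Measurable fun ω k => Z (e k) ω := fun e =>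
    measurable_pi_lambda _ fun k => hZ _
  rw [← hmom, lintegral_sum_measure, lintegral_tsum fun e => by exact (hH.comp (hm e)).aemeasurable]
  congr 1 with e
  rw [lintegral_map hH (hm e)]

theorem measurable_lintegral_sum1 (hZ : ∀ j, Measurable (Z j)) {F : ℝ → ℝ≥0∞}
    (hF : Measurable F) :
    Measurable fun ω => ∫⁻ p, F p ∂Measure.sum (fun j => η (Z j ω)) := by
  simp_rw [lintegral_sum_measure]
  exact Measurable.tsum fun i => hF.lintegral_kernel.comp (hZ i)

variable [SigmaFinite ρ]

theorem lintegral_lintegral_add_add {a b c : X × X → ℝ≥0∞} (ha : Measurable a) (hb : Measurable b)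
    (hc : Measurable c) :
    ∫⁻ z, ∫⁻ z', (a (z, z') + b (z, z') + c (z, z')) ∂ρ ∂ρ =
      ∫⁻ z, ∫⁻ z', a (z, z') ∂ρ ∂ρ + ∫⁻ z, ∫⁻ z', b (z, z') ∂ρ ∂ρ
        + ∫⁻ z, ∫⁻ z', c (z, z') ∂ρ ∂ρ := by
  rw [← lintegral_prod _ ha.aemeasurable, ← lintegral_prod _ hb.aemeasurable,
    ← lintegral_prod _ hc.aemeasurable, ← lintegral_add_left ha,
    ← lintegral_add_left (f := fun z => a z + b z)
      (ha.add hb)]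
  exact (lintegral_prod _ ((ha.add hb).add hc).aemeasurable).symm

theorem lintegral_cluster1 (hZ : ∀ j, Measurable (Z j))
    (hmom : ∀ n : ℕ, Measure.sum (fun e : Fin n ↪ ℕ => P.map fun ω k => Z (e k) ω) =
      Measure.pi fun _ => ρ) {h : X → ℝ≥0∞} (hh : Measurable h) :
    ∫⁻ ω, ∑' j, h (Z j ω) ∂P = ∫⁻ z, h z ∂ρ := by
  have h1 := tsum_lintegral_embedding hZ (hmom 1) (H := fun y => h (y 0)) (by fun_prop)
  rw [lintegral_pi_one ρ (by fun_prop)] at h1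
  rw [show ∫⁻ z, h z ∂ρ = ∫⁻ a, h (![a] 0) ∂ρ from rfl, ← h1]
  congr 1 with ω
  exact (tsum_embedding_one fun y : Fin 1 → ℕ => h (Z (y 0) ω)).symm

theorem lintegral_cluster2 (hZ : ∀ j, Measurable (Z j))
    (hmom : ∀ n : ℕ, Measure.sum (fun e : Fin n ↪ ℕ => P.map fun ω k => Z (e k) ω) =
      Measure.pi fun _ => ρ) {h : X × X → ℝ≥0∞} (hh : Measurable h) :
    ∫⁻ ω, ∑' e : Fin 2 ↪ ℕ, h (Z (e 0) ω, Z (e 1) ω) ∂P = ∫⁻ z, ∫⁻ z', h (z, z') ∂ρ ∂ρ := by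
  have h1 := tsum_lintegral_embedding hZ (hmom 2) (H := fun y => h (y 0, y 1)) (by fun_prop)
  rw [lintegral_pi_two ρ (by fun_prop)] at h1
  exact h1

theorem lintegral_cluster3 (hZ : ∀ j, Measurable (Z j))
    (hmom : ∀ n : ℕ, Measure.sum (fun e : Fin n ↪ ℕ => P.map fun ω k => Z (e k) ω) =
      Measure.pi fun _ => ρ) {h : X × X × X → ℝ≥0∞} (hh : Measurable h) :
    ∫⁻ ω, ∑' e : Fin 3 ↪ ℕ, h (Z (e 0) ω, Z (e 1) ω, Z (e 2) ω) ∂P =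
      ∫⁻ z, ∫⁻ z', ∫⁻ z'', h (z, z', z'') ∂ρ ∂ρ ∂ρ := by
  have h1 := tsum_lintegral_embedding hZ (hmom 3) (H := fun y => h (y 0, y 1, y 2)) (by fun_prop)
  rw [lintegral_pi_three ρ (by fun_prop)] at h1
  exact h1

theorem lintegral_moment1 (hZ : ∀ j, Measurable (Z j))
    (hmom : ∀ n : ℕ, Measure.sum (fun e : Fin n ↪ ℕ => P.map fun ω k => Z (e k) ω) =
      Measure.pi fun _ => ρ) {F : ℝ → ℝ≥0∞} (hF : Measurable F) :
    ∫⁻ ω, ∫⁻ x, F x ∂Measure.sum (fun j => η (Z j ω)) ∂P = ∫⁻ x, F x ∂ρ.bind η := by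
  simp_rw [lintegral_sum_measure]
  rw [lintegral_cluster1 hZ hmom (h := fun z => ∫⁻ x, F x ∂η z) hF.lintegral_kernel,
    Measure.lintegral_bind η.measurable.aemeasurable hF.aemeasurable]

variable [IsSFiniteKernel η]

theorem measurable_lintegral_prod2 {Y : Type*} [MeasurableSpace Y] {a b : Y → X}
    (ha : Measurable a) (hb : Measurable b) {F : ℝ × ℝ → ℝ≥0∞} (hF : Measurable F) :
    Measurable fun y => ∫⁻ p, F p ∂(η (a y)).prod (η (b y)) := by
  have := hF.lintegral_kernel (κ := (η.comap a ha) ×ₖ (η.comap b hb))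
  simpa only [Kernel.prod_apply, Kernel.comap_apply] using this

theorem measurable_lintegral_prod3 {Y : Type*} [MeasurableSpace Y] {a b c : Y → X}
    (ha : Measurable a) (hb : Measurable b) (hc : Measurable c) {F : ℝ × ℝ × ℝ → ℝ≥0∞}
    (hF : Measurable F) :
    Measurable fun y => ∫⁻ p, F p ∂(η (a y)).prod ((η (b y)).prod (η (c y))) := by
  have := hF.lintegral_kernel (κ := (η.comap a ha) ×ₖ ((η.comap b hb) ×ₖ (η.comap c hc)))
  simpa only [Kernel.prod_apply, Kernel.comap_apply] using this

theorem lintegral_sum_prod2 (m : ℕ → Measure ℝ) [∀ i, SFinite (m i)] (F : ℝ × ℝ → ℝ≥0∞) :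
    ∫⁻ p, F p ∂(Measure.sum m).prod (Measure.sum m)
      = ∑' i, ∑' j, ∫⁻ p, F p ∂(m i).prod (m j) := by
  rw [Measure.prod_sum, lintegral_sum_measure, ENNReal.tsum_prod']

theorem lintegral_sum_prod3 (m : ℕ → Measure ℝ) [∀ i, SFinite (m i)] (F : ℝ × ℝ × ℝ → ℝ≥0∞) :
    ∫⁻ p, F p ∂(Measure.sum m).prod ((Measure.sum m).prod (Measure.sum m))
      = ∑' i, ∑' j, ∑' k, ∫⁻ p, F p ∂(m i).prod ((m j).prod (m k)) := by
  rw [Measure.prod_sum m m, Measure.prod_sum, lintegral_sum_measure, ENNReal.tsum_prod']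
  simp_rw [ENNReal.tsum_prod']

theorem measurable_lintegral_sum2 (hZ : ∀ j, Measurable (Z j)) {F : ℝ × ℝ → ℝ≥0∞}
    (hF : Measurable F) :
    Measurable fun ω => ∫⁻ p, F p ∂(Measure.sum (fun j => η (Z j ω))).prod
      (Measure.sum (fun j => η (Z j ω))) := by
  simp_rw [lintegral_sum_prod2]
  exact Measurable.tsum fun i => Measurable.tsum fun j =>
    measurable_lintegral_prod2 (hZ i) (hZ j) hF

theorem measurable_lintegral_sum3 (hZ : ∀ j, Measurable (Z j)) {F : ℝ × ℝ × ℝ → ℝ≥0∞}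
    (hF : Measurable F) :
    Measurable fun ω => ∫⁻ p, F p ∂(Measure.sum (fun j => η (Z j ω))).prod
      ((Measure.sum (fun j => η (Z j ω))).prod (Measure.sum (fun j => η (Z j ω)))) := by
  simp_rw [lintegral_sum_prod3]
  exact Measurable.tsum fun i => Measurable.tsum fun j => Measurable.tsum fun k =>
    measurable_lintegral_prod3 (hZ i) (hZ j) (hZ k) hF

/-- A pair of points comes either from one cluster, which gives the cumulant, or from two, which
gives the product of intensities; in the second case the diagonal is null. -/
theorem lintegral_moment2 [NullSingletonClass (ρ.bind η)] (hZ : ∀ j, Measurable (Z j))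
    (hmom : ∀ n : ℕ, Measure.sum (fun e : Fin n ↪ ℕ => P.map fun ω k => Z (e k) ω) =
      Measure.pi fun _ => ρ) {F : ℝ × ℝ → ℝ≥0∞} (hF : Measurable F) :
    ∫⁻ ω, ∫⁻ p, offDiag2.indicator F p ∂(Measure.sum (fun j => η (Z j ω))).prod
      (Measure.sum (fun j => η (Z j ω))) ∂P = ∫⁻ p, F p ∂clusterMoment2 ρ η := by
  have hG := hF.indicator measurableSet_offDiag2
  simp_rw [lintegral_sum_prod2, tsum_tsum_split]
  rw [lintegral_add_left (Measurable.tsum fun i =>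
      measurable_lintegral_prod2 (hZ i) (hZ i) hG),
    lintegral_cluster1 hZ hmom (h := fun z => ∫⁻ p, offDiag2.indicator F p ∂(η z).prod (η z))
      (measurable_lintegral_prod2 measurable_id measurable_id hG),
    lintegral_cluster2 hZ hmom (h := fun z => ∫⁻ p, offDiag2.indicator F p ∂(η z.1).prod (η z.2))
      (measurable_lintegral_prod2 measurable_fst measurable_snd hG),
    clusterMoment2, lintegral_add_measure, lintegral_clusterCumulant2 ρ η hF]
  congr 1
  rw [← prod_restrict_offDiag2, ← lintegral_indicator measurableSet_offDiag2,
    ← lintegral_prod_bind_left ρ η _ hG]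
  congr 1 with z
  rw [← lintegral_prod_bind_right ρ _ η hG]

/-- The three points come from one, two or three clusters. The two-cluster case splits into three
terms according to which slot is isolated. -/
theorem lintegral_moment3 [NullSingletonClass (ρ.bind η)] (hZ : ∀ j, Measurable (Z j))
    (hmom : ∀ n : ℕ, Measure.sum (fun e : Fin n ↪ ℕ => P.map fun ω k => Z (e k) ω) =
      Measure.pi fun _ => ρ) {F : ℝ × ℝ × ℝ → ℝ≥0∞} (hF : Measurable F) :
    ∫⁻ ω, ∫⁻ p, offDiag3.indicator F p ∂(Measure.sum (fun j => η (Z j ω))).prod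
      ((Measure.sum (fun j => η (Z j ω))).prod (Measure.sum (fun j => η (Z j ω)))) ∂P =
        ∫⁻ p, F p ∂clusterMoment3 ρ η := by
  have hG := hF.indicator measurableSet_offDiag3
  set G := offDiag3.indicator F with hGdef
  have hGself : ∫⁻ p, F p ∂((ρ.bind η).prod ((ρ.bind η).prod (ρ.bind η))).restrict offDiag3 =
      ∫⁻ p, G p ∂((ρ.bind η).prod ((ρ.bind η).prod (ρ.bind η))).restrict offDiag3 := by
    rw [hGdef, lintegral_indicator measurableSet_offDiag3,
      Measure.restrict_restrict measurableSet_offDiag3,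
      inter_self]
  simp_rw [lintegral_sum_prod3, tsum_tsum_tsum_split]
  have m1 : Measurable fun z => ∫⁻ p, G p ∂(η z).prod ((η z).prod (η z)) :=
    measurable_lintegral_prod3 measurable_id measurable_id measurable_id hG
  have m2 : Measurable fun z : X × X => ∫⁻ p, G p ∂(η z.1).prod ((η z.1).prod (η z.2)) :=
    measurable_lintegral_prod3 measurable_fst measurable_fst measurable_snd hG
  have m3 : Measurable fun z : X × X => ∫⁻ p, G p ∂(η z.1).prod ((η z.2).prod (η z.1)) :=
    measurable_lintegral_prod3 measurable_fst measurable_snd measurable_fst hG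
  have m4 : Measurable fun z : X × X => ∫⁻ p, G p ∂(η z.2).prod ((η z.1).prod (η z.1)) :=
    measurable_lintegral_prod3 measurable_snd measurable_fst measurable_fst hG
  have m5 : Measurable fun z : X × X × X =>
      ∫⁻ p, G p ∂(η z.1).prod ((η z.2.1).prod (η z.2.2)) :=
    measurable_lintegral_prod3 measurable_fst (by fun_prop) (by fun_prop) hG
  have hpair : ∀ e : Fin 2 ↪ ℕ, Measurable fun ω => (Z (e 0) ω, Z (e 1) ω) := fun e =>
    (hZ _).prodMk (hZ _)
  rw [lintegral_add_left (by
      exact (Measurable.tsum fun i => m1.comp (hZ i)).add (Measurable.tsum fun e =>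
        ((m2.comp (hpair e)).add (m3.comp (hpair e))).add (m4.comp (hpair e)))),
    lintegral_add_left (by exact Measurable.tsum fun i => m1.comp (hZ i)),
    lintegral_cluster1 hZ hmom m1,
    lintegral_cluster2 hZ hmom (h := fun z => _ + _ + _) ((m2.add m3).add m4),
    lintegral_cluster3 hZ hmom m5,
    clusterMoment3, lintegral_add_measure, lintegral_clusterCumulant3 ρ η hF, add_assoc]
  congr 1
  rw [clusterMixed3, lintegral_add_measure, lintegral_three_singles ρ η hG,
    show ∫⁻ p, F p ∂(ρ.bind η).prod ((ρ.bind η).prod (ρ.bind η)) = _ by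
      rw [← prod_prod_restrict_offDiag3 ρ η, hGself, prod_prod_restrict_offDiag3]]
  rw [lintegral_lintegral_add_add m2 m3 m4, lintegral_add_measure, lintegral_add_measure,
    ← lintegral_pair_single_offDiag ρ η hF (e := fun q => (q.1.1, q.1.2, q.2)) (by fun_prop)
      (fun q => Iff.rfl),
    ← lintegral_pair_single_offDiag ρ η hF (e := fun q => (q.1.1, q.2, q.1.2)) (by fun_prop)
      (fun q => by simp only [offDiag3, mem_ofPred_eq]; tauto),
    ← lintegral_pair_single_offDiag ρ η hF (e := fun q => (q.2, q.1.1, q.1.2)) (by fun_prop)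
      (fun q => by simp only [offDiag3, mem_ofPred_eq]; tauto)]
  -- The three placements of the isolated point are brought to a common form, the pair from `z`
  -- first and the single point from `z'` last, by permuting coordinates.
  have a2 : ∀ z z', ∫⁻ p, G p ∂(η z).prod ((η z).prod (η z')) =
      ∫⁻ q, G (q.1.1, q.1.2, q.2) ∂((η z).prod (η z)).prod (η z') := by
    intro z z'
    rw [← Measure.prodAssoc_prod, lintegral_map hG (by fun_prop)]
    rfl
  have a3 : ∀ z z', ∫⁻ p, G p ∂(η z).prod ((η z').prod (η z)) =
      ∫⁻ q, G (q.1.1, q.2, q.1.2) ∂((η z).prod (η z)).prod (η z') := by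
    intro z z'
    have : ∫⁻ p, G p ∂(η z).prod ((η z').prod (η z)) =
        ∫⁻ p, G (p.1, p.2.2, p.2.1) ∂(η z).prod ((η z).prod (η z')) := by
      rw [lintegral_prod _ hG.aemeasurable, lintegral_prod _ (by fun_prop)]
      congr 1 with x
      rw [← lintegral_prod_swap]
      rfl
    rw [this, ← Measure.prodAssoc_prod, lintegral_map (by fun_prop) (by fun_prop)]
    rfl
  have a4 : ∀ z z', ∫⁻ p, G p ∂(η z').prod ((η z).prod (η z)) =
      ∫⁻ q, G (q.2, q.1.1, q.1.2) ∂((η z).prod (η z)).prod (η z') := by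
    intro z z'
    rw [← lintegral_prod_swap]
    rfl
  simp only [a2, a3, a4]
  rfl

end Moments

/-! ### Simple counting measures and sums over distinct points -/

/-- A measure on the line which is a countable sum of unit masses at distinct points. -/
structure IsSimpleAtomic (N : Measure ℝ) : Prop where
  countable : (points N).Countable
  compl_null : N (points N)ᶜ = 0
  mass : ∀ x ∈ points N, N {x} = 1

theorem IsSimpleAtomic.lintegral_eq {N : Measure ℝ} (h : IsSimpleAtomic N) (f : ℝ → ℝ≥0∞) :
    ∫⁻ x, f x ∂N = ∑' a : points N, f a := by
  rw [← Measure.restrict_eq_self_of_ae_mem (s := points N) (mem_ae_iff.2 h.compl_null),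
    lintegral_countable f h.countable]
  rw [Measure.restrict_eq_self_of_ae_mem (s := points N) (mem_ae_iff.2 h.compl_null)]
  congr 1 with a
  rw [h.mass a a.2, mul_one]

/-- Since all atoms have mass one, the product measure off the diagonal counts each ordered pair of
distinct points exactly once. -/
theorem IsSimpleAtomic.lintegral_offDiag2 {N : Measure ℝ} [SFinite N] (h : IsSimpleAtomic N)
    {F : ℝ × ℝ → ℝ≥0∞} (hF : Measurable F) :
    ∫⁻ p, offDiag2.indicator F p ∂N.prod N = ∑' e : Fin 2 ↪ points N, F (e 0, e 1) := by
  classical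
  rw [lintegral_prod _ (hF.indicator measurableSet_offDiag2).aemeasurable, h.lintegral_eq]
  simp_rw [h.lintegral_eq]
  rw [tsum_embedding_two fun e : Fin 2 → points N => F (e 0, e 1)]
  congr 1 with a
  congr 1 with b
  by_cases hab : a = b
  · rw [if_neg (by simpa using hab), indicator_of_notMem]
    exact fun h' => h' (congrArg Subtype.val hab)
  · rw [if_pos hab, indicator_of_mem]
    · rfl
    · exact fun h' => hab (Subtype.ext h')

theorem IsSimpleAtomic.lintegral_offDiag3 {N : Measure ℝ} [SFinite N] (h : IsSimpleAtomic N)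
    {F : ℝ × ℝ × ℝ → ℝ≥0∞} (hF : Measurable F) :
    ∫⁻ p, offDiag3.indicator F p ∂N.prod (N.prod N) =
      ∑' e : Fin 3 ↪ points N, F (e 0, e 1, e 2) := by
  classical
  have hG := hF.indicator measurableSet_offDiag3
  rw [lintegral_prod _ hG.aemeasurable, h.lintegral_eq]
  have h1 : ∀ a : ℝ, ∫⁻ q, offDiag3.indicator F (a, q) ∂N.prod N =
      ∑' b : points N, ∑' c : points N, offDiag3.indicator F (a, b, c) := by
    intro a
    rw [lintegral_prod (fun q => offDiag3.indicator F (a, q))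
      (hG.comp measurable_prodMk_left).aemeasurable, h.lintegral_eq]
    simp_rw [h.lintegral_eq]
  simp_rw [h1]
  rw [tsum_embedding_three fun e : Fin 3 → points N => F (e 0, e 1, e 2)]
  congr 1 with a
  congr 1 with b
  congr 1 with c
  by_cases hab : a ≠ b ∧ a ≠ c ∧ b ≠ c
  · rw [if_pos hab, indicator_of_mem]
    · rfl
    · exact ⟨fun h' => hab.1 (Subtype.ext h'), fun h' => hab.2.1 (Subtype.ext h'),
        fun h' => hab.2.2 (Subtype.ext h')⟩
  · rw [if_neg hab, indicator_of_notMem]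
    exact fun h' => hab ⟨fun h'' => h'.1 (congrArg Subtype.val h''),
      fun h'' => h'.2.1 (congrArg Subtype.val h''),
      fun h'' => h'.2.2 (congrArg Subtype.val h'')⟩

/-- Moves the observation window from the index set into the summand, where the moment formulas can
see it. -/
theorem sumDistinct_inter {n : ℕ} (A W : Set ℝ) (F : (Fin n → ℝ) → ℝ) :
    sumDistinct (A ∩ W) F = sumDistinct A (indicator {x | ∀ i, x i ∈ W} F) := by
  classical
  let Φ : {e : Fin n ↪ A // ∀ i, (e i : ℝ) ∈ W} ≃ (Fin n ↪ (A ∩ W : Set ℝ)) :=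
    { toFun := fun e => ⟨fun i => ⟨e.1 i, (e.1 i).2, e.2 i⟩, fun i j hij =>
        e.1.injective (Subtype.ext (congrArg (fun x : (A ∩ W : Set ℝ) => (x : ℝ)) hij))⟩
      invFun := fun e => ⟨⟨fun i => ⟨e i, (e i).2.1⟩, fun i j hij =>
        e.injective (Subtype.ext (congrArg (fun x : A => (x : ℝ)) hij))⟩, fun i => (e i).2.2⟩
      left_inv := fun e => rfl
      right_inv := fun e => rfl }
  rw [sumDistinct, sumDistinct, ← Φ.tsum_eq]
  have h1 := tsum_subtype {e : Fin n ↪ A | ∀ i, (e i : ℝ) ∈ W} (fun e => F fun i => (e i : ℝ))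
  refine Eq.trans ?_ (h1.trans ?_)
  · rfl
  · rfl

theorem tsum_eq_toReal_sub_toReal {ι : Type*} {f : ι → ℝ}
    (hf : ∑' i, ENNReal.ofReal |f i| ≠ ∞) :
    ∑' i, f i = (∑' i, ENNReal.ofReal (f i)).toReal - (∑' i, ENNReal.ofReal (-f i)).toReal := by
  have h1 : ∑' i, ENNReal.ofReal (f i) ≠ ∞ := ne_top_of_le_ne_top hf
    (ENNReal.tsum_le_tsum fun i => ENNReal.ofReal_le_ofReal (le_abs_self _))
  have h2 : ∑' i, ENNReal.ofReal (-f i) ≠ ∞ := ne_top_of_le_ne_top hf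
    (ENNReal.tsum_le_tsum fun i => ENNReal.ofReal_le_ofReal (neg_le_abs _))
  rw [ENNReal.tsum_toReal_eq fun i => ENNReal.ofReal_ne_top,
    ENNReal.tsum_toReal_eq fun i => ENNReal.ofReal_ne_top,
    ← (ENNReal.summable_toReal h1).tsum_sub (ENNReal.summable_toReal h2)]
  congr 1 with i
  rw [ENNReal.toReal_ofReal', ENNReal.toReal_ofReal']
  rcases le_total 0 (f i) with h | h
  · rw [max_eq_left h, max_eq_right (by linarith), sub_zero]
  · rw [max_eq_right h, max_eq_left (by linarith)]; ring

/-- Passes from nonnegative functions to signed ones by positive and negative parts. The real `tsum`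
takes the default value 0 where the sum diverges; finiteness of the mean absolute sum confines this
to a null set. -/
theorem integrable_sumDistinct {Ω : Type*} [MeasurableSpace Ω] {P : Measure Ω} {n : ℕ}
    {A : Ω → Set ℝ} {M : Measure (Fin n → ℝ)}
    (hA : ∀ F : (Fin n → ℝ) → ℝ≥0∞, Measurable F →
      AEMeasurable (fun ω => ∑' e : Fin n ↪ A ω, F fun i => e i) P ∧
      ∫⁻ ω, ∑' e : Fin n ↪ A ω, F (fun i => e i) ∂P = ∫⁻ x, F x ∂M)
    {f : (Fin n → ℝ) → ℝ} (hfm : Measurable f) (hf : Integrable f M) :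
    Integrable (fun ω => sumDistinct (A ω) f) P ∧
      ∫ ω, sumDistinct (A ω) f ∂P = ∫ x, f x ∂M := by
  obtain ⟨p1, p2⟩ := hA (fun x => ENNReal.ofReal (f x)) (by fun_prop)
  obtain ⟨n1, n2⟩ := hA (fun x => ENNReal.ofReal (-f x)) (by fun_prop)
  obtain ⟨a1, a2⟩ := hA (fun x => ENNReal.ofReal |f x|) (by fun_prop)
  have hfin : ∫⁻ x, ENNReal.ofReal |f x| ∂M ≠ ∞ := by
    have := hf.hasFiniteIntegral
    simp only [HasFiniteIntegral, ← ofReal_norm, Real.norm_eq_abs] at this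
    exact this.ne
  have hae := ae_lt_top' a1 (by rw [a2]; exact hfin)
  have hp : ∫⁻ x, ENNReal.ofReal (f x) ∂M ≠ ∞ := ne_top_of_le_ne_top hfin
    (lintegral_mono fun i => ENNReal.ofReal_le_ofReal (le_abs_self _))
  have hn : ∫⁻ x, ENNReal.ofReal (-f x) ∂M ≠ ∞ := ne_top_of_le_ne_top hfin
    (lintegral_mono fun i => ENNReal.ofReal_le_ofReal (neg_le_abs _))
  have heq : (fun ω => (∑' e : Fin n ↪ A ω, ENNReal.ofReal (f fun i => e i)).toReal -
      (∑' e : Fin n ↪ A ω, ENNReal.ofReal (-f fun i => e i)).toReal)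
      =ᵐ[P] fun ω => sumDistinct (A ω) f := by
    filter_upwards [hae] with ω hω
    exact (tsum_eq_toReal_sub_toReal hω.ne).symm
  have ip := integrable_toReal_of_lintegral_ne_top p1 (by rw [p2]; exact hp)
  have ineg := integrable_toReal_of_lintegral_ne_top n1 (by rw [n2]; exact hn)
  refine ⟨(ip.sub ineg).congr heq, ?_⟩
  rw [← integral_congr_ae heq, integral_sub ip ineg,
    integral_toReal p1 (ae_lt_top' p1 (by rw [p2]; exact hp)),
    integral_toReal n1 (ae_lt_top' n1 (by rw [n2]; exact hn)), p2, n2,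
    integral_eq_lintegral_pos_part_sub_lintegral_neg_part hf]

/-! ### The kernel of signed clusters -/

/-- The identity kernel on measures, set to zero on infinite measures. -/
def truncKernel : Kernel (Measure ℝ) ℝ where
  toFun μ := if μ univ < ∞ then μ else 0
  measurable' := Measurable.ite
    (measurableSet_lt (Measure.measurable_coe MeasurableSet.univ) measurable_const)
    measurable_id measurable_const

theorem truncKernel_apply (μ : Measure ℝ) : truncKernel μ = if μ univ < ∞ then μ else 0 := rfl

theorem truncKernel_of_finite (μ : Measure ℝ) (h : μ univ < ∞) : truncKernel μ = μ := if_pos h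

/-- An arbitrary measure need not be s-finite, hence the truncation. Slicing by the integer part of
the total mass writes the truncated kernel as a sum of finite kernels. -/
instance : IsSFiniteKernel truncKernel := by
  let B : ℕ → Set (Measure ℝ) := fun n => {μ | (n : ℝ≥0∞) ≤ μ univ ∧ μ univ < (n + 1 : ℕ)}
  have hmu : Measurable fun μ : Measure ℝ => μ univ := Measure.measurable_coe MeasurableSet.univ
  have hB : ∀ n, MeasurableSet (B n) := fun n =>
    (measurableSet_le measurable_const hmu).inter (measurableSet_lt hmu measurable_const)
  classical
  let κ : ℕ → Kernel (Measure ℝ) ℝ := fun n => Kernel.piecewise (hB n) truncKernel 0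
  have hκ : ∀ n, IsFiniteKernel (κ n) := by
    intro n
    refine ⟨(n + 1 : ℕ), ENNReal.natCast_lt_top _, fun μ => ?_⟩
    rw [Kernel.piecewise_apply]
    split_ifs with h
    · rw [truncKernel_of_finite μ (h.2.trans (ENNReal.natCast_lt_top _))]
      exact h.2.le
    · simp
  refine ⟨κ, hκ, ?_⟩
  ext μ s hs
  rw [Kernel.sum_apply, Measure.sum_apply _ hs]
  by_cases hμ : μ univ < ∞
  · have hfl := Nat.floor_le (ENNReal.toReal_nonneg (a := μ univ))
    have hlt := Nat.lt_floor_add_one (μ univ).toReal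
    rw [tsum_eq_single ⌊(μ univ).toReal⌋₊]
    · rw [Kernel.piecewise_apply, if_pos]
      refine ⟨?_, ?_⟩
      · rw [← ENNReal.ofReal_toReal hμ.ne, ← ENNReal.ofReal_natCast]
        exact ENNReal.ofReal_le_ofReal (by simpa using hfl)
      · rw [← ENNReal.ofReal_toReal hμ.ne, ← ENNReal.ofReal_natCast]
        refine (ENNReal.ofReal_lt_ofReal_iff (by positivity)).2 ?_
        push_cast
        simpa using hlt
    · intro n hn
      rw [Kernel.piecewise_apply, if_neg]
      · simp
      · rintro ⟨h1, h2⟩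
        refine hn ?_
        symm
        rw [Nat.floor_eq_iff ENNReal.toReal_nonneg]
        rw [← ENNReal.ofReal_toReal hμ.ne, ← ENNReal.ofReal_natCast] at h1 h2
        refine ⟨(ENNReal.ofReal_le_ofReal_iff ENNReal.toReal_nonneg).1 h1, ?_⟩
        have := (ENNReal.ofReal_lt_ofReal_iff (by positivity)).1 h2
        push_cast at this
        exact this
  · have h0 : truncKernel μ = 0 := if_neg hμ
    simp [κ, Kernel.piecewise_apply, h0]

/-- The cluster `s • μ` translated by `u`, as a kernel in the mark `(u, μ, s)`. -/
def clusterKernel : Kernel (ℝ × Measure ℝ × ℝ) ℝ :=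
  (Kernel.id ×ₖ (truncKernel.comap (fun z : ℝ × Measure ℝ × ℝ => z.2.1) (by fun_prop))).map
    fun q : (ℝ × Measure ℝ × ℝ) × ℝ => q.1.2.2 * q.2 + q.1.1

instance : IsSFiniteKernel clusterKernel := by
  unfold clusterKernel
  infer_instance

theorem clusterKernel_apply (z : ℝ × Measure ℝ × ℝ) :
    clusterKernel z = (truncKernel z.2.1).map fun x => z.2.2 * x + z.1 := by
  rw [clusterKernel, Kernel.map_apply _ (by fun_prop), Kernel.prod_apply, Kernel.id_apply,
    Kernel.comap_apply, Measure.dirac_prod, Measure.map_map (by fun_prop) (by fun_prop)]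
  rfl

/-! ### Simplicity of the cluster process -/

theorem isSimpleAtomic_finset_sum_dirac (t : Finset ℝ) :
    IsSimpleAtomic (∑ x ∈ t, Measure.dirac x) := by
  have h1 : ∀ x, (∑ x ∈ t, Measure.dirac x : Measure ℝ) {x} = if x ∈ t then 1 else 0 := by
    intro x
    rw [Measure.finsetSum_apply]
    simp_rw [Measure.dirac_apply' _ (measurableSet_singleton x)]
    simp [indicator]
  have hp : points (∑ x ∈ t, Measure.dirac x) = (t : Set ℝ) := by
    ext x
    simp only [points, mem_ofPred_eq, h1]
    by_cases hx : x ∈ t <;> simp [hx]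
  refine ⟨hp ▸ t.countable_toSet, ?_, fun x hx => ?_⟩
  · rw [hp, Measure.finsetSum_apply]
    refine Finset.sum_eq_zero fun x hx => ?_
    rw [Measure.dirac_apply' _ t.measurableSet.compl]
    simp [hx]
  · rw [hp] at hx
    rw [h1, if_pos (by exact hx)]

theorem isSimpleAtomic_clusterKernel {z : ℝ × Measure ℝ × ℝ} (hμ : IsFiniteSimpleCounting z.2.1)
    (hs : z.2.2 ≠ 0) : IsSimpleAtomic (clusterKernel z) := by
  obtain ⟨t, ht⟩ := hμ
  have hfin : z.2.1 univ < ∞ := by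
    rw [ht, Measure.finsetSum_apply]
    simp
  have hinj : Function.Injective fun x => z.2.2 * x + z.1 := fun x y hxy => by
    simpa [hs] using hxy
  classical
  rw [clusterKernel_apply, truncKernel_of_finite _ hfin, ht,
    Measure.map_finset_sum (by fun_prop)]
  simp_rw [Measure.map_dirac' (show Measurable fun x => z.2.2 * x + z.1 by fun_prop)]
  rw [← Finset.sum_image (f := fun y => Measure.dirac y) (g := fun x => z.2.2 * x + z.1)
    hinj.injOn]
  exact isSimpleAtomic_finset_sum_dirac _

theorem isSimpleAtomic_sum {m : ℕ → Measure ℝ} (h : ∀ i, IsSimpleAtomic (m i))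
    (hd : ∀ i j, i ≠ j → ∀ x, m i {x} = 0 ∨ m j {x} = 0) : IsSimpleAtomic (Measure.sum m) := by
  have h1 : ∀ x, Measure.sum m {x} = ∑' i, m i {x} := fun x =>
    Measure.sum_apply _ (measurableSet_singleton x)
  have hp : points (Measure.sum m) = ⋃ i, points (m i) := by
    ext x
    simp only [points, mem_ofPred_eq, h1, mem_iUnion, ne_eq, ENNReal.tsum_eq_zero, not_forall]
  have hc : (points (Measure.sum m)).Countable := hp ▸ countable_iUnion fun i => (h i).countable
  refine ⟨hc, ?_, fun x hx => ?_⟩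
  · rw [Measure.sum_apply _ hc.measurableSet.compl, ENNReal.tsum_eq_zero]
    exact fun i => measure_mono_null
      (compl_subset_compl.2 (hp ▸ subset_iUnion (fun i => points (m i)) i))
      (h i).compl_null
  · rw [hp] at hx
    obtain ⟨i, hi⟩ := mem_iUnion.1 hx
    rw [h1, tsum_eq_single i, (h i).mass x hi]
    intro j hj
    exact (hd j i hj x).resolve_right hi

/-! ### The intensity of the cluster process -/

section Intensity

variable (ν : ℝ≥0) (Q : Measure (Measure ℝ)) [IsProbabilityMeasure Q] (θ : ℝ)

instance : SigmaFinite (markLaw ν Q θ) := by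
  unfold markLaw
  infer_instance

theorem lintegral_markLaw {h : ℝ × Measure ℝ × ℝ → ℝ≥0∞} (hh : Measurable h) :
    ∫⁻ z, h z ∂markLaw ν Q θ =
      ∫⁻ q, ν * (∫⁻ u, h (u, q)) ∂Q.prod (signLaw θ) := by
  rw [markLaw, lintegral_prod_symm _ hh.aemeasurable]
  simp_rw [lintegral_smul_measure, ENNReal.smul_def, smul_eq_mul]

/-- The intensity of the cluster process with respect to Lebesgue measure. -/
def clusterRate : ℝ≥0∞ := ∫⁻ q, ν * truncKernel q.1 univ ∂Q.prod (signLaw θ)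

/-- Integrating the immigrant position against Lebesgue measure erases the displacement `s * x` by
translation invariance; only the mean cluster mass remains. -/
theorem bind_clusterKernel :
    (markLaw ν Q θ).bind clusterKernel = clusterRate ν Q θ • volume := by
  refine Measure.ext_of_lintegral _ fun F hF => ?_
  rw [Measure.lintegral_bind clusterKernel.measurable.aemeasurable hF.aemeasurable,
    lintegral_markLaw ν Q θ hF.lintegral_kernel, lintegral_smul_measure, clusterRate, smul_eq_mul,
    ← lintegral_mul_const]
  · congr 1 with q
    rw [mul_assoc]
    congr 1
    simp_rw [clusterKernel_apply]
    have h1 : ∀ u, ∫⁻ x, F x ∂(truncKernel q.1).map (fun x => q.2 * x + u) =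
        ∫⁻ x, F (q.2 * x + u) ∂truncKernel q.1 := fun u => lintegral_map hF (by fun_prop)
    simp_rw [h1]
    rw [lintegral_lintegral_swap (by fun_prop)]
    simp_rw [lintegral_add_left_eq_self F]
    rw [lintegral_const, mul_comm]
  · exact ((truncKernel.measurable_coe MeasurableSet.univ).comp measurable_fst).const_mul _

/-- No moment bound is needed: even an infinite multiple of Lebesgue measure gives mass zero to
singletons. -/
instance : NullSingletonClass ((markLaw ν Q θ).bind clusterKernel) := by
  rw [bind_clusterKernel]
  exact ⟨fun x => by simp⟩

theorem lintegral_clusterKernel2 {F : ℝ × ℝ → ℝ≥0∞} (hF : Measurable F) :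
    ∫⁻ z, ∫⁻ p, F p ∂(clusterKernel z).prod (clusterKernel z) ∂markLaw ν Q θ =
      ∫⁻ q, ν * ∫⁻ p, (∫⁻ u, F (q.2 * p.1 + u, q.2 * p.2 + u))
        ∂(truncKernel q.1).prod (truncKernel q.1) ∂Q.prod (signLaw θ) := by
  rw [lintegral_markLaw ν Q θ (measurable_lintegral_prod2 measurable_id' measurable_id' hF)]
  congr 1 with q
  congr 1
  rw [lintegral_lintegral_swap (by fun_prop)]
  congr 1 with u
  rw [clusterKernel_apply, Measure.map_prod_map _ _ (by fun_prop) (by fun_prop),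
    lintegral_map hF (by fun_prop)]
  rfl

theorem lintegral_clusterKernel3 {F : ℝ × ℝ × ℝ → ℝ≥0∞} (hF : Measurable F) :
    ∫⁻ z, ∫⁻ p, F p ∂(clusterKernel z).prod ((clusterKernel z).prod (clusterKernel z))
        ∂markLaw ν Q θ =
      ∫⁻ q, ν * ∫⁻ p, (∫⁻ u, F (q.2 * p.1 + u, q.2 * p.2.1 + u, q.2 * p.2.2 + u))
        ∂(truncKernel q.1).prod ((truncKernel q.1).prod (truncKernel q.1))
          ∂Q.prod (signLaw θ) := by
  rw [lintegral_markLaw ν Q θ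
    (measurable_lintegral_prod3 measurable_id' measurable_id' measurable_id' hF)]
  congr 1 with q
  congr 1
  rw [lintegral_lintegral_swap (by fun_prop)]
  congr 1 with u
  rw [clusterKernel_apply, Measure.map_prod_map _ _ (by fun_prop) (by fun_prop),
    Measure.map_prod_map _ _ (by fun_prop) (by fun_prop), lintegral_map hF (by fun_prop)]
  rfl

/-- For `k ≤ 3`, the `k`-th power of the mass is at most one plus its cube. -/
theorem lintegral_trunc_pow_ne_top (h : ∫⁻ μ, (μ univ) ^ 3 ∂Q < ∞) {k : ℕ} (hk : k ≤ 3) :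
    ∫⁻ q, ν * (truncKernel q.1 univ) ^ k ∂Q.prod (signLaw θ) ≠ ∞ := by
  have hm : Measurable fun μ : Measure ℝ => (ν : ℝ≥0∞) * (truncKernel μ univ) ^ k :=
    ((truncKernel.measurable_coe MeasurableSet.univ).pow_const k).const_mul _
  rw [lintegral_prod _ (by exact (hm.comp measurable_fst).aemeasurable)]
  simp only [lintegral_const]
  rw [lintegral_mul_const _ hm]
  refine ENNReal.mul_ne_top ?_ (measure_ne_top _ _)
  rw [lintegral_const_mul _ ((truncKernel.measurable_coe MeasurableSet.univ).pow_const k)]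
  refine ENNReal.mul_ne_top ENNReal.coe_ne_top (ne_top_of_le_ne_top (b := 1 + ∫⁻ μ, (μ univ) ^ 3 ∂Q)
    (by simp [h.ne]) ?_)
  calc _ ≤ ∫⁻ μ, 1 + (μ univ) ^ 3 ∂Q := by
        refine lintegral_mono fun μ => ?_
        have h1 : truncKernel μ univ ≤ μ univ := by
          rw [truncKernel_apply]; split_ifs <;> simp
        rcases le_total (truncKernel μ univ) 1 with h2 | h2
        · exact (pow_le_one' h2 k).trans le_self_add
        · exact ((pow_le_pow_right₀ h2 hk).trans (pow_le_pow_left' h1 3)).trans le_add_self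
    _ = _ := by rw [lintegral_add_left measurable_const]; simp

theorem clusterRate_ne_top (h : ∫⁻ μ, (μ univ) ^ 3 ∂Q < ∞) : clusterRate ν Q θ ≠ ∞ := by
  simpa [clusterRate] using lintegral_trunc_pow_ne_top ν Q θ h (k := 1) (by norm_num)

/-- Localizing one point suffices: each pair in a cluster contributes `volume K` after integration
over the immigrant, and the number of pairs is at most the squared mass. -/
theorem clusterCumulant2_ne_top (h : ∫⁻ μ, (μ univ) ^ 3 ∂Q < ∞) {K : Set ℝ}
    (hK : MeasurableSet K) (hfin : volume K ≠ ∞) :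
    clusterCumulant2 (markLaw ν Q θ) clusterKernel (K ×ˢ univ) ≠ ∞ := by
  have hKm : MeasurableSet (K ×ˢ (univ : Set ℝ)) := hK.prod MeasurableSet.univ
  rw [← lintegral_indicator_one hKm, lintegral_clusterCumulant2 _ _ (measurable_one.indicator hKm),
    lintegral_clusterKernel2 _ _ _ ((measurable_one.indicator hKm).indicator
      measurableSet_offDiag2)]
  refine ne_top_of_le_ne_top (b := ∫⁻ q, volume K * (ν * (truncKernel q.1 univ) ^ 2)
    ∂Q.prod (signLaw θ)) ?_ (lintegral_mono fun q => ?_)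
  · rw [lintegral_const_mul']
    · exact ENNReal.mul_ne_top hfin (lintegral_trunc_pow_ne_top ν Q θ h (by norm_num))
    · exact hfin
  · calc _ ≤ ν * ∫⁻ p, (∫⁻ u, K.indicator 1 (q.2 * p.1 + u))
          ∂(truncKernel q.1).prod (truncKernel q.1) := by
          gcongr with p u
          refine (indicator_le_self _ _ _).trans ?_
          by_cases hu : q.2 * p.1 + u ∈ K
          · rw [indicator_of_mem (by exact ⟨hu, mem_univ _⟩), indicator_of_mem hu]; simp
          · rw [indicator_of_notMem (by exact fun h' => hu h'.1)]; simp
      _ = _ := by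
          simp_rw [lintegral_add_left_eq_self (K.indicator (1 : ℝ → ℝ≥0∞))]
          rw [lintegral_indicator_one hK, lintegral_const, ← univ_prod_univ, Measure.prod_prod]
          ring

theorem clusterCumulant3_ne_top (h : ∫⁻ μ, (μ univ) ^ 3 ∂Q < ∞) {K : Set ℝ}
    (hK : MeasurableSet K) (hfin : volume K ≠ ∞) :
    clusterCumulant3 (markLaw ν Q θ) clusterKernel (K ×ˢ univ) ≠ ∞ := by
  have hKm : MeasurableSet (K ×ˢ (univ : Set (ℝ × ℝ))) := hK.prod MeasurableSet.univ
  rw [← lintegral_indicator_one hKm, lintegral_clusterCumulant3 _ _ (measurable_one.indicator hKm),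
    lintegral_clusterKernel3 _ _ _ ((measurable_one.indicator hKm).indicator
      measurableSet_offDiag3)]
  refine ne_top_of_le_ne_top (b := ∫⁻ q, volume K * (ν * (truncKernel q.1 univ) ^ 3)
    ∂Q.prod (signLaw θ)) ?_ (lintegral_mono fun q => ?_)
  · rw [lintegral_const_mul']
    · exact ENNReal.mul_ne_top hfin (lintegral_trunc_pow_ne_top ν Q θ h (by norm_num))
    · exact hfin
  · calc _ ≤ ν * ∫⁻ p, (∫⁻ u, K.indicator 1 (q.2 * p.1 + u))
          ∂(truncKernel q.1).prod ((truncKernel q.1).prod (truncKernel q.1)) := by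
          gcongr with p u
          refine (indicator_le_self _ _ _).trans ?_
          by_cases hu : q.2 * p.1 + u ∈ K
          · rw [indicator_of_mem (by exact ⟨hu, mem_univ _⟩), indicator_of_mem hu]; simp
          · rw [indicator_of_notMem (by exact fun h' => hu h'.1)]; simp
      _ = _ := by
          simp_rw [lintegral_add_left_eq_self (K.indicator (1 : ℝ → ℝ≥0∞))]
          rw [lintegral_indicator_one hK, lintegral_const, ← univ_prod_univ, Measure.prod_prod,
            ← univ_prod_univ, Measure.prod_prod]
          ring

end Intensity

/-! ### Factorial moments of the sign-symmetrized family -/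

section Family

variable {Ω : Type*} [MeasurableSpace Ω] {P : Measure Ω} [IsProbabilityMeasure P] {ν : ℝ≥0}
  {Q : Measure (Measure ℝ)} {U : ℕ → Ω → ℝ} {C : ℕ → Ω → Measure ℝ} {S : ℝ → ℕ → Ω → ℝ} {θ : ℝ}

theorem IsFiniteSimpleCounting.measure_univ_lt_top {μ : Measure ℝ}
    (h : IsFiniteSimpleCounting μ) : μ univ < ∞ := by
  obtain ⟨t, ht⟩ := h
  rw [ht, Measure.finsetSum_apply]
  simp

theorem ae_signLaw_ne_zero (θ : ℝ) : ∀ᵐ s ∂signLaw θ, s ≠ 0 := by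
  rw [ae_iff, signLaw, Measure.add_apply, Measure.smul_apply, Measure.smul_apply]
  simp

theorem IsSignSymmetrizedFamily.ae_isSimpleAtomic (h : IsSignSymmetrizedFamily P ν Q U C S)
    (hθ : θ ∈ Icc (-1 : ℝ) 1) :
    ∀ᵐ ω ∂P, signedClusterProcess U C S θ ω =
        Measure.sum (fun j => clusterKernel (U j ω, C j ω, S θ j ω)) ∧
      IsSimpleAtomic (Measure.sum fun j => clusterKernel (U j ω, C j ω, S θ j ω)) := by
  have := h.clusterLaw.isProbability
  have hC : ∀ᵐ ω ∂P, ∀ j, IsFiniteSimpleCounting (C j ω) := ae_all_iff.2 fun j => by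
    refine ae_of_ae_map (h.measurable_cluster j).aemeasurable ?_
    rw [h.law_cluster j]
    exact h.clusterLaw.finiteSimple
  have hS : ∀ᵐ ω ∂P, ∀ j, S θ j ω ≠ 0 := ae_all_iff.2 fun j => by
    refine ae_of_ae_map (p := fun s => s ≠ 0) (h.measurable_sign θ hθ j).aemeasurable ?_
    rw [h.map_sign hθ]
    exact ae_signLaw_ne_zero θ
  have hZ := h.measurable_mark hθ
  let D : ℝ × ℝ → ℝ≥0∞ := offDiag2ᶜ.indicator 1
  have hD : Measurable D := measurable_one.indicator measurableSet_offDiag2.compl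
  have hm := measurable_lintegral_prod2 (η := clusterKernel) measurable_fst measurable_snd hD
  -- The mean number of coincidences between points of different clusters is the mass of the
  -- diagonal under the product of two diffuse intensities, hence zero. So the superposition is
  -- almost surely simple.
  have hdis : ∀ᵐ ω ∂P, ∑' e : Fin 2 ↪ ℕ, ∫⁻ p, D p
      ∂(clusterKernel (U (e 0) ω, C (e 0) ω, S θ (e 0) ω)).prod
        (clusterKernel (U (e 1) ω, C (e 1) ω, S θ (e 1) ω)) = 0 := by
    refine (lintegral_eq_zero_iff (Measurable.tsum fun e : Fin 2 ↪ ℕ =>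
      hm.comp ((hZ (e 0)).prodMk (hZ (e 1))))).1 ?_
    refine (lintegral_cluster2 hZ (h.sum_map_embedding hθ)
      (h := fun z => ∫⁻ p, D p ∂(clusterKernel z.1).prod (clusterKernel z.2)) hm).trans ?_
    have h1 : ∀ z, ∫⁻ z', ∫⁻ p, D p ∂(clusterKernel z).prod (clusterKernel z') ∂markLaw ν Q θ =
        ∫⁻ p, D p ∂(clusterKernel z).prod ((markLaw ν Q θ).bind clusterKernel) := fun z =>
      lintegral_prod_bind_right _ _ _ hD
    simp only [h1]
    rw [lintegral_prod_bind_left _ _ _ hD, lintegral_indicator_one measurableSet_offDiag2.compl]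
    exact mem_ae_iff.1 (ae_prod_snd_ne _ measurable_id)
  filter_upwards [hC, hS, hdis] with ω hC hS hdis
  refine ⟨?_, isSimpleAtomic_sum (fun i => isSimpleAtomic_clusterKernel (hC i) (hS i)) ?_⟩
  · rw [signedClusterProcess]
    congr 1 with j
    rw [clusterKernel_apply, truncKernel_of_finite _ (hC j).measure_univ_lt_top,
      Measure.map_map (by fun_prop) (by fun_prop)]
    rfl
  · intro i j hij x
    have h2 := ENNReal.tsum_eq_zero.1 hdis ⟨![i, j], injective_vec_two.2 hij⟩
    rw [lintegral_indicator_one measurableSet_offDiag2.compl] at h2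
    have h3 := measure_mono_null (s := {x} ×ˢ {x}) (by
      rintro p ⟨hp1, hp2⟩ hp
      exact hp (hp1.trans hp2.symm)) h2
    rw [Measure.prod_prod, mul_eq_zero] at h3
    exact h3

theorem IsSignSymmetrizedFamily.integrable_sumDistinct1 (h : IsSignSymmetrizedFamily P ν Q U C S)
    (hθ : θ ∈ Icc (-1 : ℝ) 1) {f : (Fin 1 → ℝ) → ℝ} (hfm : Measurable f)
    (hf : Integrable (fun x => f ![x]) ((markLaw ν Q θ).bind clusterKernel)) :
    Integrable (fun ω => sumDistinct (points (signedClusterProcess U C S θ ω)) f) P ∧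
      ∫ ω, sumDistinct (points (signedClusterProcess U C S θ ω)) f ∂P =
        ∫ x, f ![x] ∂(markLaw ν Q θ).bind clusterKernel := by
  have := h.clusterLaw.isProbability
  have hZ := h.measurable_mark hθ
  have hv : Measurable fun x : ℝ => ![x] := measurable_pi_lambda _ fun k => by
    fin_cases k; exact measurable_id
  rw [← integral_map hv.aemeasurable hfm.aestronglyMeasurable]
  refine integrable_sumDistinct (fun F hF => ?_) hfm
    ((integrable_map_measure hfm.aestronglyMeasurable hv.aemeasurable).2 hf)
  have hae : (fun ω => ∫⁻ x, F ![x] ∂Measure.sum fun j =>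
      clusterKernel (U j ω, C j ω, S θ j ω)) =ᵐ[P]
      fun ω => ∑' e : Fin 1 ↪ points (signedClusterProcess U C S θ ω), F fun i => e i := by
    filter_upwards [h.ae_isSimpleAtomic hθ] with ω hω
    rw [hω.1, hω.2.lintegral_eq]
    refine Eq.trans ?_ (tsum_embedding_one
      (α := points (Measure.sum fun j => clusterKernel (U j ω, C j ω, S θ j ω)))
      (fun e => F fun i => e i)).symm
    congr 1 with a
    congr 1
    ext k
    fin_cases k; rfl
  refine ⟨(measurable_lintegral_sum1 hZ (hF.comp hv)).aemeasurable.congr hae, ?_⟩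
  rw [← lintegral_congr_ae hae, lintegral_map hF hv]
  exact lintegral_moment1 hZ (h.sum_map_embedding hθ) (hF.comp hv)

theorem IsSignSymmetrizedFamily.integrable_sumDistinct2 (h : IsSignSymmetrizedFamily P ν Q U C S)
    (hθ : θ ∈ Icc (-1 : ℝ) 1) {f : (Fin 2 → ℝ) → ℝ} (hfm : Measurable f)
    (hf : Integrable (fun p : ℝ × ℝ => f ![p.1, p.2])
      (clusterMoment2 (markLaw ν Q θ) clusterKernel)) :
    Integrable (fun ω => sumDistinct (points (signedClusterProcess U C S θ ω)) f) P ∧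
      ∫ ω, sumDistinct (points (signedClusterProcess U C S θ ω)) f ∂P =
        ∫ p, f ![p.1, p.2] ∂clusterMoment2 (markLaw ν Q θ) clusterKernel := by
  have := h.clusterLaw.isProbability
  have hZ := h.measurable_mark hθ
  have hv : Measurable fun p : ℝ × ℝ => ![p.1, p.2] := measurable_pi_lambda _ fun k => by
    fin_cases k
    · exact measurable_fst
    · exact measurable_snd
  rw [← integral_map hv.aemeasurable hfm.aestronglyMeasurable]
  refine integrable_sumDistinct (fun F hF => ?_) hfm
    ((integrable_map_measure hfm.aestronglyMeasurable hv.aemeasurable).2 hf)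
  have hae : (fun ω => ∫⁻ p, offDiag2.indicator (fun p => F ![p.1, p.2]) p ∂(Measure.sum fun j =>
      clusterKernel (U j ω, C j ω, S θ j ω)).prod (Measure.sum fun j =>
      clusterKernel (U j ω, C j ω, S θ j ω))) =ᵐ[P]
      fun ω => ∑' e : Fin 2 ↪ points (signedClusterProcess U C S θ ω), F fun i => e i := by
    filter_upwards [h.ae_isSimpleAtomic hθ] with ω hω
    rw [hω.1, hω.2.lintegral_offDiag2 (F := fun p => F ![p.1, p.2]) (hF.comp hv)]
    congr 1 with e
    congr 1
    ext k
    fin_cases k <;> rfl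
  refine ⟨(measurable_lintegral_sum2 hZ
    ((hF.comp hv).indicator measurableSet_offDiag2)).aemeasurable.congr hae, ?_⟩
  rw [← lintegral_congr_ae hae, lintegral_map hF hv]
  exact lintegral_moment2 hZ (h.sum_map_embedding hθ) (hF.comp hv)

theorem IsSignSymmetrizedFamily.integrable_sumDistinct3 (h : IsSignSymmetrizedFamily P ν Q U C S)
    (hθ : θ ∈ Icc (-1 : ℝ) 1) {f : (Fin 3 → ℝ) → ℝ} (hfm : Measurable f)
    (hf : Integrable (fun p : ℝ × ℝ × ℝ => f ![p.1, p.2.1, p.2.2])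
      (clusterMoment3 (markLaw ν Q θ) clusterKernel)) :
    Integrable (fun ω => sumDistinct (points (signedClusterProcess U C S θ ω)) f) P ∧
      ∫ ω, sumDistinct (points (signedClusterProcess U C S θ ω)) f ∂P =
        ∫ p, f ![p.1, p.2.1, p.2.2] ∂clusterMoment3 (markLaw ν Q θ) clusterKernel := by
  have := h.clusterLaw.isProbability
  have hZ := h.measurable_mark hθ
  have hv : Measurable fun p : ℝ × ℝ × ℝ => ![p.1, p.2.1, p.2.2] :=
    measurable_pi_lambda _ fun k => by
      fin_cases k
      · exact measurable_fst
      · exact measurable_fst.comp measurable_snd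
      · exact measurable_snd.comp measurable_snd
  rw [← integral_map hv.aemeasurable hfm.aestronglyMeasurable]
  refine integrable_sumDistinct (fun F hF => ?_) hfm
    ((integrable_map_measure hfm.aestronglyMeasurable hv.aemeasurable).2 hf)
  have hae : (fun ω => ∫⁻ p, offDiag3.indicator (fun p => F ![p.1, p.2.1, p.2.2]) p
      ∂(Measure.sum fun j => clusterKernel (U j ω, C j ω, S θ j ω)).prod
        ((Measure.sum fun j => clusterKernel (U j ω, C j ω, S θ j ω)).prod
          (Measure.sum fun j => clusterKernel (U j ω, C j ω, S θ j ω)))) =ᵐ[P]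
      fun ω => ∑' e : Fin 3 ↪ points (signedClusterProcess U C S θ ω), F fun i => e i := by
    filter_upwards [h.ae_isSimpleAtomic hθ] with ω hω
    rw [hω.1, hω.2.lintegral_offDiag3 (F := fun p => F ![p.1, p.2.1, p.2.2])
      (hF.comp hv)]
    congr 1 with e
    congr 1
    ext k
    fin_cases k <;> rfl
  refine ⟨(measurable_lintegral_sum3 hZ
    ((hF.comp hv).indicator measurableSet_offDiag3)).aemeasurable.congr hae, ?_⟩
  rw [← lintegral_congr_ae hae, lintegral_map hF hv]
  exact lintegral_moment3 hZ (h.sum_map_embedding hθ) (hF.comp hv)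

end Family

/-! ### Moments of product functions -/

section Product

variable {X : Type*} [MeasurableSpace X] {ρ : Measure X} [SFinite ρ] {η : Kernel X ℝ}
  [IsSFiniteKernel η]

theorem integral_clusterMoment2_mul {f g : ℝ → ℝ} (hf : Integrable f (ρ.bind η))
    (hg : Integrable g (ρ.bind η))
    (hfg : Integrable (fun p : ℝ × ℝ => f p.1 * g p.2) (clusterCumulant2 ρ η)) :
    Integrable (fun p : ℝ × ℝ => f p.1 * g p.2) (clusterMoment2 ρ η) ∧
      ∫ p, f p.1 * g p.2 ∂clusterMoment2 ρ η =
        ∫ p, f p.1 * g p.2 ∂clusterCumulant2 ρ η +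
          (∫ x, f x ∂ρ.bind η) * ∫ x, g x ∂ρ.bind η := by
  have h1 := hf.mul_prod hg
  refine ⟨hfg.add_measure h1, ?_⟩
  rw [clusterMoment2, integral_add_measure hfg h1, integral_prod_mul]

theorem integral_clusterMixed3_mul {f : Fin 3 → ℝ → ℝ} (hm : ∀ i, Measurable (f i))
    (hf : ∀ i, Integrable (f i) (ρ.bind η))
    (hff : ∀ i j, Integrable (fun p : ℝ × ℝ => f i p.1 * f j p.2) (clusterCumulant2 ρ η)) :
    Integrable (fun p : ℝ × ℝ × ℝ => f 0 p.1 * f 1 p.2.1 * f 2 p.2.2) (clusterMixed3 ρ η) ∧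
      ∫ p, f 0 p.1 * f 1 p.2.1 * f 2 p.2.2 ∂clusterMixed3 ρ η =
        (∫ p, f 0 p.1 * f 1 p.2 ∂clusterCumulant2 ρ η) * (∫ x, f 2 x ∂ρ.bind η) +
        (∫ p, f 0 p.1 * f 2 p.2 ∂clusterCumulant2 ρ η) * (∫ x, f 1 x ∂ρ.bind η) +
        (∫ p, f 1 p.1 * f 2 p.2 ∂clusterCumulant2 ρ η) * (∫ x, f 0 x ∂ρ.bind η) +
        (∫ x, f 0 x ∂ρ.bind η) * (∫ x, f 1 x ∂ρ.bind η) * ∫ x, f 2 x ∂ρ.bind η := by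
  have hF : Measurable fun p : ℝ × ℝ × ℝ => f 0 p.1 * f 1 p.2.1 * f 2 p.2.2 :=
    (((hm 0).comp measurable_fst).mul ((hm 1).comp (measurable_fst.comp measurable_snd))).mul
      ((hm 2).comp (measurable_snd.comp measurable_snd))
  have key : ∀ (i j k : Fin 3) (e : (ℝ × ℝ) × ℝ → ℝ × ℝ × ℝ), Measurable e →
      (∀ q, f 0 (e q).1 * f 1 (e q).2.1 * f 2 (e q).2.2 = f i q.1.1 * f j q.1.2 * f k q.2) →
      Integrable (fun p : ℝ × ℝ × ℝ => f 0 p.1 * f 1 p.2.1 * f 2 p.2.2)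
        (((clusterCumulant2 ρ η).prod (ρ.bind η)).map e) ∧
      ∫ p, f 0 p.1 * f 1 p.2.1 * f 2 p.2.2 ∂((clusterCumulant2 ρ η).prod (ρ.bind η)).map e =
        (∫ p, f i p.1 * f j p.2 ∂clusterCumulant2 ρ η) * (∫ x, f k x ∂ρ.bind η) := by
    intro i j k e he heq
    rw [integrable_map_measure hF.aestronglyMeasurable he.aemeasurable,
      integral_map he.aemeasurable hF.aestronglyMeasurable]
    simp only [Function.comp_def, heq]
    exact ⟨(hff i j).mul_prod (hf k),
      integral_prod_mul (fun p : ℝ × ℝ => f i p.1 * f j p.2) (f k)⟩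
  obtain ⟨a1, a2⟩ := key 0 1 2 (fun q => (q.1.1, q.1.2, q.2)) (by fun_prop) (fun q => rfl)
  obtain ⟨b1, b2⟩ := key 0 2 1 (fun q => (q.1.1, q.2, q.1.2)) (by fun_prop) (fun q => by ring)
  obtain ⟨c1, c2⟩ := key 1 2 0 (fun q => (q.2, q.1.1, q.1.2)) (by fun_prop) (fun q => by ring)
  have d1 : Integrable (fun p : ℝ × ℝ × ℝ => f 0 p.1 * f 1 p.2.1 * f 2 p.2.2)
      ((ρ.bind η).prod ((ρ.bind η).prod (ρ.bind η))) := by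
    simpa only [mul_assoc] using (hf 0).mul_prod ((hf 1).mul_prod (hf 2))
  have d2 : ∫ p, f 0 p.1 * f 1 p.2.1 * f 2 p.2.2 ∂(ρ.bind η).prod ((ρ.bind η).prod (ρ.bind η)) =
      (∫ x, f 0 x ∂ρ.bind η) * (∫ x, f 1 x ∂ρ.bind η) * ∫ x, f 2 x ∂ρ.bind η := by
    have := integral_prod_mul (μ := ρ.bind η) (ν := (ρ.bind η).prod (ρ.bind η)) (f 0)
      (fun q : ℝ × ℝ => f 1 q.1 * f 2 q.2)
    rw [integral_prod_mul] at this
    simpa only [mul_assoc] using this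
  refine ⟨((a1.add_measure b1).add_measure c1).add_measure d1, ?_⟩
  rw [clusterMixed3, integral_add_measure ((a1.add_measure b1).add_measure c1) d1,
    integral_add_measure (a1.add_measure b1) c1, integral_add_measure a1 b1, a2, b2, c2, d2]

end Product

/-! ### Reflection of the cumulant measures -/

section Reflection

variable (ν : ℝ≥0) (Q : Measure (Measure ℝ)) [IsProbabilityMeasure Q] (θ T : ℝ)

/-- Reflection of a triple of points in the window `[0, T]`. -/
def reflect3 (p : ℝ × ℝ × ℝ) : ℝ × ℝ × ℝ := (T - p.1, T - p.2.1, T - p.2.2)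

theorem measurable_reflect3 : Measurable (reflect3 T) := by
  unfold reflect3
  fun_prop

theorem measurePreserving_sub_bind :
    MeasurePreserving (fun x => T - x) ((markLaw ν Q θ).bind clusterKernel)
      ((markLaw ν Q θ).bind clusterKernel) := by
  rw [bind_clusterKernel]
  exact (Measure.measurePreserving_sub_left volume T).smul_measure _

/-- The reflected pair `(T - x, T - y)` is the swapped pair `(y, x)` translated by `T - x - y`. The
product of a cluster with itself is symmetric and the immigrant position absorbs the translation,
whatever the sign law. -/
theorem measurePreserving_clusterCumulant2 :
    MeasurePreserving (Prod.map (fun x => T - x) (fun x => T - x))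
      (clusterCumulant2 (markLaw ν Q θ) clusterKernel)
      (clusterCumulant2 (markLaw ν Q θ) clusterKernel) := by
  have hR : Measurable (Prod.map (fun x : ℝ => T - x) (fun x : ℝ => T - x)) := by fun_prop
  refine ⟨hR, Measure.ext_of_lintegral _ fun F hF => ?_⟩
  have hG := hF.indicator measurableSet_offDiag2
  rw [lintegral_map hF hR,
    lintegral_clusterCumulant2 _ _ (F := fun p => F (Prod.map _ _ p)) (hF.comp hR),
    lintegral_clusterCumulant2 _ _ hF, lintegral_clusterKernel2 _ _ _ hG,
    lintegral_clusterKernel2 _ _ _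
      (F := offDiag2.indicator fun p => F (Prod.map (fun x => T - x) (fun x => T - x) p))
      ((hF.comp hR).indicator measurableSet_offDiag2)]
  congr 1 with q
  congr 1
  rw [← lintegral_prod_swap]
  congr 1 with p
  -- This substitution is chosen so that, after the swap of `p`, the reflected points become exactly
  -- `s * p.1 + u` and `s * p.2 + u`, with `s = q.2`.
  rw [← lintegral_sub_left_eq_self _ (T - q.2 * p.1 - q.2 * p.2)]
  congr 1 with u
  have hiff : (q.2 * p.2 + (T - q.2 * p.1 - q.2 * p.2 - u),
      q.2 * p.1 + (T - q.2 * p.1 - q.2 * p.2 - u)) ∈ offDiag2 ↔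
      (q.2 * p.1 + u, q.2 * p.2 + u) ∈ offDiag2 := by
    simp only [offDiag2, mem_ofPred_eq]
    refine not_congr ⟨fun h => by linarith, fun h => by linarith⟩
  simp only [Prod.fst_swap, Prod.snd_swap]
  by_cases hu : (q.2 * p.1 + u, q.2 * p.2 + u) ∈ offDiag2
  · rw [indicator_of_mem (hiff.2 hu), indicator_of_mem hu]
    congr 1
    ext <;> simp <;> ring
  · rw [indicator_of_notMem (fun h => hu (hiff.1 h)), indicator_of_notMem hu]

/-- Every mixed term is built from the intensity and the pair cumulant, both invariant under
reflection, and the slot placements commute with reflecting each coordinate. -/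
theorem map_reflect3_clusterMixed3 :
    (clusterMixed3 (markLaw ν Q θ) clusterKernel).map (reflect3 T) =
      clusterMixed3 (markLaw ν Q θ) clusterKernel := by
  have h1 := measurePreserving_sub_bind ν Q θ T
  have h2 := measurePreserving_clusterCumulant2 ν Q θ T
  have h3 := (h1.prod (h1.prod h1)).map_eq
  have h21 := h2.prod h1
  have hm := measurable_reflect3 T
  have key : ∀ e : (ℝ × ℝ) × ℝ → ℝ × ℝ × ℝ, Measurable e →
      (∀ q, reflect3 T (e q) = e (Prod.map (Prod.map (fun x => T - x) (fun x => T - x))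
        (fun x => T - x) q)) →
      (((clusterCumulant2 (markLaw ν Q θ) clusterKernel).prod
        ((markLaw ν Q θ).bind clusterKernel)).map e).map (reflect3 T) =
      ((clusterCumulant2 (markLaw ν Q θ) clusterKernel).prod
        ((markLaw ν Q θ).bind clusterKernel)).map e := by
    intro e he heq
    conv_rhs => rw [← h21.map_eq]
    rw [Measure.map_map hm he, Measure.map_map he h21.measurable]
    congr 1
    ext1 q
    exact heq q
  rw [clusterMixed3, Measure.map_add _ _ hm, Measure.map_add _ _ hm, Measure.map_add _ _ hm,
    key _ (by fun_prop) (fun q => rfl), key _ (by fun_prop) (fun q => rfl),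
    key _ (by fun_prop) (fun q => rfl)]
  congr 1

theorem lintegral_signLaw {f : ℝ → ℝ≥0∞} :
    ∫⁻ s, f s ∂signLaw θ =
      ENNReal.ofReal ((1 + θ) / 2) * f 1 + ENNReal.ofReal ((1 - θ) / 2) * f (-1) := by
  rw [signLaw, lintegral_add_measure, lintegral_smul_measure, lintegral_smul_measure,
    lintegral_dirac, lintegral_dirac, smul_eq_mul, smul_eq_mul]

theorem measurable_lintegral_shift3 {F : ℝ × ℝ × ℝ → ℝ≥0∞} (hF : Measurable F) :
    Measurable fun q : Measure ℝ × ℝ =>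
      (ν : ℝ≥0∞) * ∫⁻ p, (∫⁻ u, F (q.2 * p.1 + u, q.2 * p.2.1 + u, q.2 * p.2.2 + u))
        ∂(truncKernel q.1).prod ((truncKernel q.1).prod (truncKernel q.1)) := by
  refine Measurable.const_mul ?_ _
  let κ : Kernel (Measure ℝ × ℝ) (ℝ × ℝ × ℝ) :=
    (truncKernel.comap Prod.fst measurable_fst) ×ₖ
      ((truncKernel.comap Prod.fst measurable_fst) ×ₖ (truncKernel.comap Prod.fst measurable_fst))
  have hκ : ∀ q, κ q = (truncKernel q.1).prod ((truncKernel q.1).prod (truncKernel q.1)) := by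
    intro q
    simp [κ, Kernel.prod_apply, Kernel.comap_apply]
  simp_rw [← hκ]
  refine Measurable.lintegral_kernel_prod_right'
    (f := fun r : (Measure ℝ × ℝ) × ℝ × ℝ × ℝ =>
      ∫⁻ u, F (r.1.2 * r.2.1 + u, r.1.2 * r.2.2.1 + u, r.1.2 * r.2.2.2 + u)) ?_
  exact Measurable.lintegral_prod_right' (f := fun r : ((Measure ℝ × ℝ) × ℝ × ℝ × ℝ) × ℝ =>
      F (r.1.1.2 * r.1.2.1 + r.2, r.1.1.2 * r.1.2.2.1 + r.2, r.1.1.2 * r.1.2.2.2 + r.2))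
    (by fun_prop)

theorem lintegral_clusterCumulant3_markLaw {F : ℝ × ℝ × ℝ → ℝ≥0∞} (hF : Measurable F) :
    ∫⁻ p, F p ∂clusterCumulant3 (markLaw ν Q θ) clusterKernel =
      ENNReal.ofReal ((1 + θ) / 2) * (∫⁻ μ, ν * ∫⁻ p, (∫⁻ u, offDiag3.indicator F
        (p.1 + u, p.2.1 + u, p.2.2 + u))
          ∂(truncKernel μ).prod ((truncKernel μ).prod (truncKernel μ)) ∂Q) +
      ENNReal.ofReal ((1 - θ) / 2) * (∫⁻ μ, ν * ∫⁻ p, (∫⁻ u, offDiag3.indicator F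
        (-p.1 + u, -p.2.1 + u, -p.2.2 + u))
          ∂(truncKernel μ).prod ((truncKernel μ).prod (truncKernel μ)) ∂Q) := by
  have hG := hF.indicator measurableSet_offDiag3
  rw [lintegral_clusterCumulant3 _ _ hF, lintegral_clusterKernel3 _ _ _ hG,
    lintegral_prod_symm _ (measurable_lintegral_shift3 ν hG).aemeasurable, lintegral_signLaw]
  simp only [one_mul, neg_mul]

/-- A cluster of sign -1 is a cluster of sign +1 reflected at the origin, and the uniform immigrant
position turns this into reflection about `T / 2`. Conditioning on the sign gives the two weights.
-/
theorem clusterCumulant3_markLaw :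
    clusterCumulant3 (markLaw ν Q θ) clusterKernel =
      ENNReal.ofReal ((1 + θ) / 2) • clusterCumulant3 (markLaw ν Q 1) clusterKernel +
      ENNReal.ofReal ((1 - θ) / 2) •
        (clusterCumulant3 (markLaw ν Q 1) clusterKernel).map (reflect3 T) := by
  have hR := measurable_reflect3 T
  refine Measure.ext_of_lintegral _ fun F hF => ?_
  have hone : ENNReal.ofReal ((1 + 1) / 2) = 1 := by norm_num
  have hzero : ENNReal.ofReal ((1 - 1) / 2) = 0 := by norm_num
  rw [lintegral_add_measure, lintegral_smul_measure, lintegral_smul_measure, lintegral_map hF hR,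
    lintegral_clusterCumulant3_markLaw ν Q θ hF, lintegral_clusterCumulant3_markLaw ν Q 1 hF,
    lintegral_clusterCumulant3_markLaw ν Q 1 (F := fun p => F (reflect3 T p)) (hF.comp hR),
    hone, hzero,
    one_mul, zero_mul, one_mul,
    zero_mul, add_zero, add_zero, smul_eq_mul, smul_eq_mul]
  congr 2
  congr 1 with μ
  congr 2
  ext1 p
  -- With `u` replaced by `T - u`, the point `-x + u` becomes `T - (x + u)`.
  rw [← lintegral_sub_left_eq_self _ T]
  congr 1 with u
  have hiff : (-p.1 + (T - u), -p.2.1 + (T - u), -p.2.2 + (T - u)) ∈ offDiag3 ↔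
      (p.1 + u, p.2.1 + u, p.2.2 + u) ∈ offDiag3 := by
    simp only [offDiag3, mem_ofPred_eq]
    refine and_congr (not_congr ?_) (and_congr (not_congr ?_) (not_congr ?_)) <;>
      exact ⟨fun h => by linarith, fun h => by linarith⟩
  by_cases hu : (p.1 + u, p.2.1 + u, p.2.2 + u) ∈ offDiag3
  · rw [indicator_of_mem (hiff.2 hu), indicator_of_mem hu]
    congr 1
    simp only [reflect3, Prod.mk.injEq]
    refine ⟨?_, ?_, ?_⟩ <;> ring
  · rw [indicator_of_notMem (fun h => hu (hiff.1 h)), indicator_of_notMem hu]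

end Reflection

/-- Reflection shows that the integral equals its own negative. The identities used hold without
integrability, under the convention that a non-integrable function has integral 0. -/
theorem integral_eq_zero_of_reflect {M : Measure (ℝ × ℝ × ℝ)} {T : ℝ}
    (hM : M.map (reflect3 T) = M) {F : ℝ × ℝ × ℝ → ℝ} (hFm : Measurable F)
    (hF : ∀ p, F (reflect3 T p) = -F p) : ∫ p, F p ∂M = 0 := by
  have h1 := integral_map (μ := M) (measurable_reflect3 T).aemeasurable (f := F)
    hFm.aestronglyMeasurable
  rw [hM] at h1
  simp_rw [hF, integral_neg] at h1
  linarith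

/-- The reflected component enters with a minus sign, leaving (1 + θ)/2 - (1 - θ)/2 = θ. -/
theorem integral_clusterCumulant3_of_reflect {ν : ℝ≥0} {Q : Measure (Measure ℝ)}
    [IsProbabilityMeasure Q] {θ T : ℝ} (hθ : θ ∈ Icc (-1 : ℝ) 1) {F : ℝ × ℝ × ℝ → ℝ}
    (hFm : Measurable F) (hF : ∀ p, F (reflect3 T p) = -F p)
    (hi : Integrable F (clusterCumulant3 (markLaw ν Q 1) clusterKernel)) :
    ∫ p, F p ∂clusterCumulant3 (markLaw ν Q θ) clusterKernel =
      θ * ∫ p, F p ∂clusterCumulant3 (markLaw ν Q 1) clusterKernel := by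
  have hR := measurable_reflect3 T
  have hi' : Integrable F ((clusterCumulant3 (markLaw ν Q 1) clusterKernel).map (reflect3 T)) := by
    rw [integrable_map_measure hFm.aestronglyMeasurable hR.aemeasurable]
    refine hi.neg.congr (Eventually.of_forall fun p => ?_)
    simp [hF]
  rw [clusterCumulant3_markLaw ν Q θ T, integral_add_measure
    (hi.smul_measure ENNReal.ofReal_ne_top) (hi'.smul_measure ENNReal.ofReal_ne_top),
    integral_smul_measure, integral_smul_measure,
    integral_map hR.aemeasurable hFm.aestronglyMeasurable]
  simp_rw [hF, integral_neg]
  rw [ENNReal.toReal_ofReal (by linarith [hθ.1]), ENNReal.toReal_ofReal (by linarith [hθ.2]),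
    smul_eq_mul, smul_eq_mul]
  ring

/-! ### Integrability of bounded functions with bounded support -/

theorem integrable_of_bounded {α : Type*} [MeasurableSpace α] {M : Measure α} {f : α → ℝ}
    (hm : Measurable f) {B : ℝ} (hB : ∀ x, |f x| ≤ B) {s : Set α} (hs : M s ≠ ∞)
    (h0 : ∀ x ∉ s, f x = 0) : Integrable f M := by
  refine (integrableOn_iff_integrable_of_support_subset (s := s) fun x hx => ?_).1
    (Measure.integrableOn_of_bounded hs hm.aestronglyMeasurable (M := B)
      (Eventually.of_forall hB))
  by_contra h
  exact hx (h0 x h)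

theorem IsTestFunction.volume_tsupport_ne_top {f : ℝ → ℝ} (hf : IsTestFunction f) :
    volume (tsupport f) ≠ ∞ := (IsCompact.measure_lt_top hf.compactSupport).ne

theorem isTestFunction_indicator {A : Set ℝ} (hA : MeasurableSet A) {K : Set ℝ} (hK : IsCompact K)
    (hAK : A ⊆ K) : IsTestFunction (A.indicator (1 : ℝ → ℝ)) := by
  refine ⟨measurable_one.indicator hA, ⟨1, fun x => ?_⟩, ?_⟩
  · by_cases hx : x ∈ A <;> simp [hx]
  · refine HasCompactSupport.intro hK fun x hx => indicator_of_notMem (fun h => hx (hAK h)) _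

section Integrability

variable {ν : ℝ≥0} {Q : Measure (Measure ℝ)} [IsProbabilityMeasure Q] {θ : ℝ}

theorem IsTestFunction.integrable_bind (h3 : ∫⁻ μ, (μ univ) ^ 3 ∂Q < ∞) {f : ℝ → ℝ}
    (hf : IsTestFunction f) : Integrable f ((markLaw ν Q θ).bind clusterKernel) := by
  obtain ⟨B, hB⟩ := hf.bounded
  refine integrable_of_bounded hf.measurable hB (s := tsupport f) ?_
    fun x hx => image_eq_zero_of_notMem_tsupport hx
  rw [bind_clusterKernel, Measure.smul_apply, smul_eq_mul]
  exact ENNReal.mul_ne_top (clusterRate_ne_top ν Q θ h3) hf.volume_tsupport_ne_top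

theorem IsTestFunction.integrable_clusterCumulant2 (h3 : ∫⁻ μ, (μ univ) ^ 3 ∂Q < ∞)
    {f g : ℝ → ℝ} (hf : IsTestFunction f) (hg : IsTestFunction g) :
    Integrable (fun p : ℝ × ℝ => f p.1 * g p.2)
      (clusterCumulant2 (markLaw ν Q θ) clusterKernel) := by
  obtain ⟨A, hA⟩ := hf.bounded
  obtain ⟨B, hB⟩ := hg.bounded
  refine integrable_of_bounded ((hf.measurable.comp measurable_fst).mul
    (hg.measurable.comp measurable_snd)) (B := A * B) (s := tsupport f ×ˢ univ) (fun p => ?_)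
    (clusterCumulant2_ne_top ν Q θ h3 (isClosed_tsupport f).measurableSet
      hf.volume_tsupport_ne_top) fun p hp => ?_
  · rw [abs_mul]
    exact mul_le_mul (hA _) (hB _) (abs_nonneg _) ((abs_nonneg _).trans (hA 0))
  · rw [image_eq_zero_of_notMem_tsupport (f := f) fun h => hp ⟨h, mem_univ _⟩, zero_mul]

theorem integrable_clusterCumulant3 (h3 : ∫⁻ μ, (μ univ) ^ 3 ∂Q < ∞) {F : ℝ × ℝ × ℝ → ℝ}
    (hFm : Measurable F) {B : ℝ} (hB : ∀ p, |F p| ≤ B) {K : Set ℝ} (hK : IsCompact K)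
    (h0 : ∀ p, p.1 ∉ K → F p = 0) :
    Integrable F (clusterCumulant3 (markLaw ν Q θ) clusterKernel) :=
  integrable_of_bounded hFm hB (s := K ×ˢ univ)
    (clusterCumulant3_ne_top ν Q θ h3 hK.measurableSet hK.measure_lt_top.ne)
    fun p hp => h0 p fun h => hp ⟨h, mem_univ _⟩

end Integrability

theorem bounded_mul_three {f : Fin 3 → ℝ → ℝ} (hf : ∀ i, IsTestFunction (f i)) :
    ∃ B, ∀ p : ℝ × ℝ × ℝ, |f 0 p.1 * f 1 p.2.1 * f 2 p.2.2| ≤ B := by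
  choose B hB using fun i => (hf i).bounded
  have h0 : ∀ i, 0 ≤ B i := fun i => (abs_nonneg _).trans (hB i 0)
  refine ⟨B 0 * B 1 * B 2, fun p => ?_⟩
  rw [abs_mul, abs_mul]
  exact mul_le_mul (mul_le_mul (hB 0 _) (hB 1 _) (abs_nonneg _) (h0 0)) (hB 2 _) (abs_nonneg _)
    (mul_nonneg (h0 0) (h0 1))

theorem measurable_mul_three {f : Fin 3 → ℝ → ℝ} (hm : ∀ i, Measurable (f i)) :
    Measurable fun p : ℝ × ℝ × ℝ => f 0 p.1 * f 1 p.2.1 * f 2 p.2.2 :=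
  (((hm 0).comp measurable_fst).mul ((hm 1).comp (measurable_fst.comp measurable_snd))).mul
    ((hm 2).comp (measurable_snd.comp measurable_snd))

section Family

variable {Ω : Type*} [MeasurableSpace Ω] {P : Measure Ω} [IsProbabilityMeasure P] {ν : ℝ≥0}
  {Q : Measure (Measure ℝ)} {U : ℕ → Ω → ℝ} {C : ℕ → Ω → Measure ℝ} {S : ℝ → ℕ → Ω → ℝ} {θ : ℝ}

/-- The third factorial cumulant of the cluster process is carried by single clusters. -/
theorem IsSignSymmetrizedFamily.factorialCumulant3_eq (h : IsSignSymmetrizedFamily P ν Q U C S)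
    (hθ : θ ∈ Icc (-1 : ℝ) 1) {f : Fin 3 → ℝ → ℝ} (hf : ∀ i, IsTestFunction (f i)) :
    factorialCumulant3 P (signedClusterProcess U C S θ) f =
      ∫ p, f 0 p.1 * f 1 p.2.1 * f 2 p.2.2 ∂clusterCumulant3 (markLaw ν Q θ) clusterKernel := by
  have := h.clusterLaw.isProbability
  have h3 := h.clusterLaw.thirdMoment
  have i1 : ∀ i, Integrable (f i) ((markLaw ν Q θ).bind clusterKernel) := fun i =>
    (hf i).integrable_bind h3
  have i2 : ∀ i j, Integrable (fun p : ℝ × ℝ => f i p.1 * f j p.2)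
      (clusterCumulant2 (markLaw ν Q θ) clusterKernel) := fun i j =>
    (hf i).integrable_clusterCumulant2 h3 (hf j)
  have m1 : ∀ i, factorialMoment P (signedClusterProcess U C S θ) ![f i] =
      ∫ x, f i x ∂(markLaw ν Q θ).bind clusterKernel := by
    intro i
    have hm : Measurable fun x : Fin 1 → ℝ => ∏ k, (![f i] k) (x k) := by
      simp only [Finset.univ_unique, Fin.default_eq_zero, Finset.prod_singleton,
        Matrix.cons_val_fin_one]
      exact (hf i).measurable.comp (measurable_pi_apply _)
    refine (h.integrable_sumDistinct1 hθ hm ?_).2.trans ?_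
    · simpa using i1 i
    · simp
  have m2 : ∀ i j, factorialMoment P (signedClusterProcess U C S θ) ![f i, f j] =
      ∫ p, f i p.1 * f j p.2 ∂clusterMoment2 (markLaw ν Q θ) clusterKernel := by
    intro i j
    have hm : Measurable fun x : Fin 2 → ℝ => ∏ k, (![f i, f j] k) (x k) := by
      simp only [Fin.prod_univ_two, Matrix.cons_val_zero, Matrix.cons_val_one]
      exact ((hf i).measurable.comp (measurable_pi_apply _)).mul
        ((hf j).measurable.comp (measurable_pi_apply _))
    refine (h.integrable_sumDistinct2 hθ hm ?_).2.trans ?_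
    · simpa [Fin.prod_univ_two] using (integral_clusterMoment2_mul (i1 i) (i1 j) (i2 i j)).1
    · simp [Fin.prod_univ_two]
  obtain ⟨B, hB⟩ := bounded_mul_three hf
  have hm3 := measurable_mul_three fun i => (hf i).measurable
  have i3 : Integrable (fun p : ℝ × ℝ × ℝ => f 0 p.1 * f 1 p.2.1 * f 2 p.2.2)
      (clusterCumulant3 (markLaw ν Q θ) clusterKernel) :=
    integrable_clusterCumulant3 h3 hm3 hB (hf 0).compactSupport fun p hp => by
      rw [image_eq_zero_of_notMem_tsupport hp, zero_mul, zero_mul]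
  obtain ⟨x1, x2⟩ := integral_clusterMixed3_mul (fun i => (hf i).measurable) i1 i2
  have m3 : factorialMoment P (signedClusterProcess U C S θ) ![f 0, f 1, f 2] =
      ∫ p, f 0 p.1 * f 1 p.2.1 * f 2 p.2.2 ∂clusterMoment3 (markLaw ν Q θ) clusterKernel := by
    have hm : Measurable fun x : Fin 3 → ℝ => ∏ k, (![f 0, f 1, f 2] k) (x k) := by
      simp only [Fin.prod_univ_three, Matrix.cons_val_zero, Matrix.cons_val_one, Matrix.cons_val]
      exact (((hf 0).measurable.comp (measurable_pi_apply _)).mul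
        ((hf 1).measurable.comp (measurable_pi_apply _))).mul
        ((hf 2).measurable.comp (measurable_pi_apply _))
    refine (h.integrable_sumDistinct3 hθ hm ?_).2.trans ?_
    · simpa [Fin.prod_univ_three, clusterMoment3] using i3.add_measure x1
    · simp [Fin.prod_univ_three]
  -- Expanding all moments in the intensity, the pair cumulant and the single-cluster triples,
  -- everything but the last cancels algebraically.
  rw [factorialCumulant3, m3, m2, m2, m2, m1, m1, m1,
    (integral_clusterMoment2_mul (i1 0) (i1 1) (i2 0 1)).2,
    (integral_clusterMoment2_mul (i1 0) (i1 2) (i2 0 2)).2,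
    (integral_clusterMoment2_mul (i1 1) (i1 2) (i2 1 2)).2, clusterMoment3,
    integral_add_measure i3 x1, x2]
  ring

end Family

/-! ### Identification of the third cumulant measure with its density -/

section Density

/-- The measure with reduced density the positive part of `c`. -/
def densityMeasure (c : ℝ × ℝ → ℝ) : Measure (ℝ × ℝ × ℝ) :=
  ((volume : Measure ℝ).prod (volume.withDensity fun τ => ENNReal.ofReal (c τ))).map
    fun q => (q.1, q.1 + q.2.1, q.1 + q.2.2)

variable {c : ℝ × ℝ → ℝ}

theorem densityMeasure_ne_top (hc : Integrable c) {K : Set ℝ} (hK : IsCompact K) :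
    densityMeasure c (K ×ˢ univ) ≠ ∞ := by
  have := isFiniteMeasure_withDensity_ofReal hc.hasFiniteIntegral
  rw [densityMeasure, Measure.map_apply (by fun_prop) (hK.measurableSet.prod MeasurableSet.univ)]
  have : (fun q : ℝ × ℝ × ℝ => (q.1, q.1 + q.2.1, q.1 + q.2.2)) ⁻¹' (K ×ˢ univ) = K ×ˢ univ := by
    ext q; simp
  rw [this, Measure.prod_prod]
  exact ENNReal.mul_ne_top hK.measure_lt_top.ne (measure_ne_top _ _)

theorem integrable_densityMeasure (hc : Integrable c) {F : ℝ × ℝ × ℝ → ℝ}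
    (hFm : Measurable F) {B : ℝ} (hB : ∀ p, |F p| ≤ B) {K : Set ℝ} (hK : IsCompact K)
    (h0 : ∀ p, p.1 ∉ K → F p = 0) : Integrable F (densityMeasure c) :=
  integrable_of_bounded hFm hB (s := K ×ˢ univ) (densityMeasure_ne_top hc hK)
    fun p hp => h0 p fun h => hp ⟨h, mem_univ _⟩

theorem integral_densityMeasure (hc : Integrable c) {F : ℝ × ℝ × ℝ → ℝ}
    (hFm : Measurable F) {B : ℝ} (hB : ∀ p, |F p| ≤ B) {K : Set ℝ} (hK : IsCompact K)
    (h0 : ∀ p, p.1 ∉ K → F p = 0) :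
    Integrable (fun t => ∫ τ : ℝ × ℝ, F (t, t + τ.1, t + τ.2) * max (c τ) 0) ∧
    ∫ p, F p ∂densityMeasure c =
      ∫ t : ℝ, ∫ τ : ℝ × ℝ, F (t, t + τ.1, t + τ.2) * max (c τ) 0 := by
  have hfin := isFiniteMeasure_withDensity_ofReal hc.hasFiniteIntegral
  have hi := integrable_densityMeasure hc hFm hB hK h0
  have hsh : Measurable fun q : ℝ × ℝ × ℝ => (q.1, q.1 + q.2.1, q.1 + q.2.2) := by fun_prop
  rw [densityMeasure, integrable_map_measure hFm.aestronglyMeasurable hsh.aemeasurable] at hi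
  have hin : ∀ t, ∫ τ : ℝ × ℝ, F (t, t + τ.1, t + τ.2)
      ∂volume.withDensity (fun τ => ENNReal.ofReal (c τ)) =
      ∫ τ : ℝ × ℝ, F (t, t + τ.1, t + τ.2) * max (c τ) 0 := by
    intro t
    rw [integral_withDensity_eq_integral_toReal_smul₀ hc.aemeasurable.ennreal_ofReal (by simp)]
    congr 1 with τ
    rw [ENNReal.toReal_ofReal', smul_eq_mul, mul_comm]
  refine ⟨hi.integral_prod_left.congr (Eventually.of_forall fun t => hin t), ?_⟩
  rw [densityMeasure, integral_map hsh.aemeasurable hFm.aestronglyMeasurable]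
  exact (integral_prod _ hi).trans (integral_congr_ae (Eventually.of_forall fun t => hin t))

theorem integrable_mul_bounded (hc : Integrable c) {G : ℝ × ℝ → ℝ} (hG : Measurable G) {B : ℝ}
    (hB : ∀ τ, |G τ| ≤ B) : Integrable fun τ => G τ * c τ :=
  hc.bdd_mul hG.aestronglyMeasurable (Eventually.of_forall hB)

/-- The density may change sign, so it is represented by two measures, built from the positive parts
of `c` and `-c`. -/
theorem integral_densityMeasure_sub (hc : Integrable c) {F : ℝ × ℝ × ℝ → ℝ}
    (hFm : Measurable F) {B : ℝ} (hB : ∀ p, |F p| ≤ B) {K : Set ℝ} (hK : IsCompact K)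
    (h0 : ∀ p, p.1 ∉ K → F p = 0) :
    Integrable (fun t => ∫ τ : ℝ × ℝ, F (t, t + τ.1, t + τ.2) * c τ) ∧
    ∫ p, F p ∂densityMeasure c - ∫ p, F p ∂densityMeasure (fun τ => -c τ) =
      ∫ t : ℝ, ∫ τ : ℝ × ℝ, F (t, t + τ.1, t + τ.2) * c τ := by
  obtain ⟨a1, a2⟩ := integral_densityMeasure hc hFm hB hK h0
  obtain ⟨b1, b2⟩ := integral_densityMeasure (c := fun τ => -c τ) hc.neg hFm hB hK h0
  have hin : ∀ t, (∫ τ : ℝ × ℝ, F (t, t + τ.1, t + τ.2) * max (c τ) 0) -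
      ∫ τ : ℝ × ℝ, F (t, t + τ.1, t + τ.2) * max (-c τ) 0 =
      ∫ τ : ℝ × ℝ, F (t, t + τ.1, t + τ.2) * c τ := by
    intro t
    have hG : Measurable fun τ : ℝ × ℝ => F (t, t + τ.1, t + τ.2) := by fun_prop
    refine (integral_sub (integrable_mul_bounded hc.pos_part hG fun τ => hB _)
      (integrable_mul_bounded hc.neg.pos_part hG fun τ => hB _)).symm.trans ?_
    congr 1 with τ
    rw [← mul_sub]
    congr 1
    simp only [Pi.neg_apply]
    rcases le_total 0 (c τ) with h | h
    · rw [max_eq_left h, max_eq_right (by linarith), sub_zero]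
    · rw [max_eq_right h, max_eq_left (by linarith)]; ring
  refine ⟨(a1.sub b1).congr (Eventually.of_forall hin), ?_⟩
  rw [a2, b2, ← integral_sub a1 b1]
  congr 1 with t
  exact hin t

/-- Moving the negative part to the left turns an identity with a signed density into one between
measures. Indicators of bounded boxes are products of test functions, and they determine measures
that are finite on the cubes `W n`. -/
theorem eq_densityMeasure {M : Measure (ℝ × ℝ × ℝ)} (hc : Integrable c)
    (hM : ∀ K : Set ℝ, IsCompact K → M (K ×ˢ univ) ≠ ∞)
    (hbox : ∀ f : Fin 3 → ℝ → ℝ, (∀ i, IsTestFunction (f i)) →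
      ∫ p, f 0 p.1 * f 1 p.2.1 * f 2 p.2.2 ∂M =
        ∫ t : ℝ, ∫ τ : ℝ × ℝ, f 0 t * f 1 (t + τ.1) * f 2 (t + τ.2) * c τ) :
    M + densityMeasure (fun τ => -c τ) = densityMeasure c := by
  let K : ℕ → Set ℝ := fun n => Icc (-(n : ℝ)) n
  have hK : ∀ n, IsCompact (K n) := fun n => isCompact_Icc
  let W : ℕ → Set (ℝ × ℝ × ℝ) := fun n => K n ×ˢ K n ×ˢ K n
  have hW : ⋃ n, W n = univ := by
    refine eq_univ_of_forall fun p => ?_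
    obtain ⟨n, hn⟩ := exists_nat_ge (max |p.1| (max |p.2.1| |p.2.2|))
    simp only [max_le_iff] at hn
    exact mem_iUnion.2 ⟨n, abs_le.1 hn.1, abs_le.1 hn.2.1, abs_le.1 hn.2.2⟩
  have hWfin : ∀ n, (M + densityMeasure fun τ => -c τ) (W n) ≠ ∞ := by
    intro n
    have hsub : W n ⊆ K n ×ˢ univ := prod_mono subset_rfl (subset_univ _)
    rw [Measure.add_apply]
    exact ENNReal.add_ne_top.2 ⟨ne_top_of_le_ne_top (hM _ (hK n)) (measure_mono hsub),
      ne_top_of_le_ne_top (densityMeasure_ne_top (c := fun τ => -c τ) hc.neg (hK n))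
        (measure_mono hsub)⟩
  refine Measure.ext_of_iUnion_eq_univ hW fun n => ?_
  have : IsFiniteMeasure ((M + densityMeasure fun τ => -c τ).restrict (W n)) :=
    ⟨by rw [Measure.restrict_apply_univ]; exact (hWfin n).lt_top⟩
  refine Measure.ext_prod₃ fun {A₀ A₁ A₂} hA₀ hA₁ hA₂ => ?_
  have hAm := hA₀.prod (hA₁.prod hA₂)
  rw [Measure.restrict_apply hAm, Measure.restrict_apply hAm, prod_inter_prod, prod_inter_prod]
  let A : Fin 3 → Set ℝ := ![A₀ ∩ K n, A₁ ∩ K n, A₂ ∩ K n]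
  have hA : ∀ i, MeasurableSet (A i) := by
    intro i
    fin_cases i
    · exact hA₀.inter (hK n).measurableSet
    · exact hA₁.inter (hK n).measurableSet
    · exact hA₂.inter (hK n).measurableSet
  have hAK : ∀ i, A i ⊆ K n := by
    intro i
    fin_cases i <;> exact inter_subset_right
  let f : Fin 3 → ℝ → ℝ := fun i => (A i).indicator 1
  have hf : ∀ i, IsTestFunction (f i) := fun i => isTestFunction_indicator (hA i) (hK n) (hAK i)
  obtain ⟨B, hB⟩ := bounded_mul_three hf
  have hm3 := measurable_mul_three fun i => (hf i).measurable
  have h0 : ∀ p : ℝ × ℝ × ℝ, p.1 ∉ K n → f 0 p.1 * f 1 p.2.1 * f 2 p.2.2 = 0 := fun p hp => by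
    rw [show f 0 p.1 = 0 from indicator_of_notMem (fun h => hp (hAK 0 h)) _, zero_mul, zero_mul]
  have key := (integral_densityMeasure_sub hc hm3 hB (hK n) h0).2
  rw [← hbox f hf] at key
  set R := (A₀ ∩ K n) ×ˢ (A₁ ∩ K n) ×ˢ (A₂ ∩ K n) with hR
  have hRm : MeasurableSet R := (hA 0).prod ((hA 1).prod (hA 2))
  have hind : (fun p : ℝ × ℝ × ℝ => f 0 p.1 * f 1 p.2.1 * f 2 p.2.2) = R.indicator 1 := by
    ext p
    by_cases hp : p ∈ R
    · rw [indicator_of_mem hp, show f 0 p.1 = 1 from indicator_of_mem (s := A 0) hp.1 _,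
        show f 1 p.2.1 = 1 from indicator_of_mem (s := A 1) hp.2.1 _,
        show f 2 p.2.2 = 1 from indicator_of_mem (s := A 2) hp.2.2 _]
      simp
    · rw [indicator_of_notMem hp]
      by_cases hp0 : p.1 ∈ A 0
      · by_cases hp1 : p.2.1 ∈ A 1
        · rw [show f 2 p.2.2 = 0 from
            indicator_of_notMem (s := A 2) (fun hp2 => hp ⟨hp0, hp1, hp2⟩) _, mul_zero]
        · rw [show f 1 p.2.1 = 0 from indicator_of_notMem hp1 _, mul_zero, zero_mul]
      · rw [show f 0 p.1 = 0 from indicator_of_notMem hp0 _, zero_mul, zero_mul]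
  simp only [hind, integral_indicator_one hRm] at key
  have hRW : R ⊆ K n ×ˢ univ := prod_mono inter_subset_right (subset_univ _)
  have f1 : M R ≠ ∞ := ne_top_of_le_ne_top (hM _ (hK n)) (measure_mono hRW)
  have f2 : densityMeasure (fun τ => -c τ) R ≠ ∞ :=
    ne_top_of_le_ne_top (densityMeasure_ne_top (c := fun τ => -c τ) hc.neg (hK n))
      (measure_mono hRW)
  have f3 : densityMeasure c R ≠ ∞ :=
    ne_top_of_le_ne_top (densityMeasure_ne_top hc (hK n)) (measure_mono hRW)
  rw [Measure.add_apply, ← ENNReal.toReal_eq_toReal_iff' (ENNReal.add_ne_top.2 ⟨f1, f2⟩) f3,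
    ENNReal.toReal_add f1 f2]
  simp only [measureReal_def] at key
  linarith

end Density

/-! ### The mean of the odd statistic -/

/-- The window of triples in `[0, T]`. -/
def window3 (T : ℝ) : Set (ℝ × ℝ × ℝ) := {p | p.1 ∈ Icc 0 T ∧ p.2.1 ∈ Icc 0 T ∧ p.2.2 ∈ Icc 0 T}

/-- The summand of the odd statistic as a function on triples. -/
def oddSummand (T : ℝ) (g : ℝ × ℝ → ℝ) : ℝ × ℝ × ℝ → ℝ :=
  (window3 T).indicator fun p => g (p.2.1 - p.1, p.2.2 - p.1)

section OddSummand

variable {T : ℝ} {g : ℝ × ℝ → ℝ}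

theorem measurable_oddSummand (hg : Measurable g) : Measurable (oddSummand T g) := by
  refine Measurable.indicator (by fun_prop) ?_
  exact (measurableSet_Icc.preimage (f := fun p : ℝ × ℝ × ℝ => p.1) (by fun_prop)).inter
    ((measurableSet_Icc.preimage (f := fun p : ℝ × ℝ × ℝ => p.2.1) (by fun_prop)).inter
      (measurableSet_Icc.preimage (f := fun p : ℝ × ℝ × ℝ => p.2.2) (by fun_prop)))

/-- Domination by a product function: integrability against the mixed measure is established only
for products. -/
theorem abs_oddSummand_le {B : ℝ} (hB : ∀ τ, |g τ| ≤ B) (p : ℝ × ℝ × ℝ) :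
    |oddSummand T g p| ≤ B * ((Icc 0 T).indicator 1 p.1 * (Icc 0 T).indicator 1 p.2.1 *
      (Icc 0 T).indicator 1 p.2.2) := by
  by_cases hp : p ∈ window3 T
  · rw [oddSummand, indicator_of_mem hp, indicator_of_mem hp.1, indicator_of_mem hp.2.1,
      indicator_of_mem hp.2.2]
    simpa using hB _
  · rw [oddSummand, indicator_of_notMem hp, abs_zero]
    refine mul_nonneg ((abs_nonneg _).trans (hB 0)) (mul_nonneg (mul_nonneg ?_ ?_) ?_) <;>
      exact indicator_nonneg (fun _ _ => zero_le_one) _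

theorem abs_oddSummand_le' {B : ℝ} (hB : ∀ τ, |g τ| ≤ B) (p : ℝ × ℝ × ℝ) :
    |oddSummand T g p| ≤ B := by
  by_cases hp : p ∈ window3 T
  · rw [oddSummand, indicator_of_mem hp]
    exact hB _
  · rw [oddSummand, indicator_of_notMem hp, abs_zero]
    exact (abs_nonneg _).trans (hB 0)

theorem oddSummand_eq_zero (p : ℝ × ℝ × ℝ) (hp : p.1 ∉ Icc 0 T) : oddSummand T g p = 0 :=
  indicator_of_notMem (fun h => hp h.1) _

/-- Reflection preserves the window and negates both differences, so joint oddness of `g` gives the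
sign. -/
theorem oddSummand_reflect3 (hodd : ∀ τ, g (-τ) = -g τ) (p : ℝ × ℝ × ℝ) :
    oddSummand T g (reflect3 T p) = -oddSummand T g p := by
  have hiff : reflect3 T p ∈ window3 T ↔ p ∈ window3 T := by
    simp only [reflect3, window3, mem_ofPred_eq, mem_Icc]
    refine and_congr ?_ (and_congr ?_ ?_) <;>
      exact ⟨fun h => ⟨by linarith [h.2], by linarith [h.1]⟩,
        fun h => ⟨by linarith [h.2], by linarith [h.1]⟩⟩
  by_cases hp : p ∈ window3 T
  · rw [oddSummand, indicator_of_mem (hiff.2 hp), indicator_of_mem hp, ← hodd]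
    congr 1
    ext <;> simp [reflect3]
  · rw [oddSummand, indicator_of_notMem (fun h => hp (hiff.1 h)), indicator_of_notMem hp, neg_zero]

theorem oddStatistic_eq (μ : Measure ℝ) :
    oddStatistic T g μ =
      1 / T * sumDistinct (points μ) fun x : Fin 3 → ℝ => oddSummand T g (x 0, x 1, x 2) := by
  rw [oddStatistic, sumDistinct_inter]
  congr 2
  ext x
  have hiff : x ∈ {x : Fin 3 → ℝ | ∀ i, x i ∈ Icc 0 T} ↔ (x 0, x 1, x 2) ∈ window3 T := by
    simp only [mem_ofPred_eq, Fin.forall_fin_succ, window3]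
    simp
  by_cases hx : (x 0, x 1, x 2) ∈ window3 T
  · rw [oddSummand, indicator_of_mem hx, indicator_of_mem (hiff.2 hx)]
  · rw [oddSummand, indicator_of_notMem hx, indicator_of_notMem (fun h => hx (hiff.1 h))]

/-- The indicator of the displacements which keep the three points in the window. -/
def windowIndicator (T t : ℝ) : ℝ × ℝ → ℝ :=
  indicator {τ : ℝ × ℝ | t + τ.1 ∈ Icc 0 T ∧ t + τ.2 ∈ Icc 0 T} 1

theorem oddSummand_shift {t : ℝ} (ht : t ∈ Icc 0 T) (τ : ℝ × ℝ) :
    oddSummand T g (t, t + τ.1, t + τ.2) = g τ * windowIndicator T t τ := by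
  by_cases hτ : t + τ.1 ∈ Icc 0 T ∧ t + τ.2 ∈ Icc 0 T
  · rw [oddSummand, indicator_of_mem (by exact ⟨ht, hτ⟩), windowIndicator,
      indicator_of_mem (by exact hτ)]
    simp
  · rw [oddSummand, indicator_of_notMem (fun h => hτ h.2), windowIndicator,
      indicator_of_notMem (by exact hτ), mul_zero]

theorem measurable_windowIndicator (T t : ℝ) : Measurable (windowIndicator T t) :=
  measurable_one.indicator
    ((measurableSet_Icc.preimage (f := fun τ : ℝ × ℝ => t + τ.1) (by fun_prop)).inter
      (measurableSet_Icc.preimage (f := fun τ : ℝ × ℝ => t + τ.2) (by fun_prop)))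

/-- Negating the displacements amounts to reflecting the base point in the window. -/
theorem windowIndicator_neg (T t : ℝ) (τ : ℝ × ℝ) :
    windowIndicator T t (-τ) = windowIndicator T (T - t) τ := by
  have hiff : (t + (-τ).1 ∈ Icc 0 T ∧ t + (-τ).2 ∈ Icc 0 T) ↔
      (T - t + τ.1 ∈ Icc 0 T ∧ T - t + τ.2 ∈ Icc 0 T) := by
    simp only [mem_Icc, Prod.fst_neg, Prod.snd_neg]
    refine and_congr ?_ ?_ <;>
      exact ⟨fun h => ⟨by linarith [h.2], by linarith [h.1]⟩,
        fun h => ⟨by linarith [h.2], by linarith [h.1]⟩⟩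
  by_cases h : t + (-τ).1 ∈ Icc 0 T ∧ t + (-τ).2 ∈ Icc 0 T
  · rw [windowIndicator, windowIndicator, indicator_of_mem (by exact h),
      indicator_of_mem (by exact hiff.1 h)]
    rfl
  · rw [windowIndicator, windowIndicator, indicator_of_notMem (by exact h),
      indicator_of_notMem (by exact fun h' => h (hiff.2 h'))]

theorem abs_mul_windowIndicator_le {B : ℝ} (hB : ∀ τ, |g τ| ≤ B) (t : ℝ) (τ : ℝ × ℝ) :
    |g τ * windowIndicator T t τ| ≤ B := by
  by_cases h : τ ∈ {τ : ℝ × ℝ | t + τ.1 ∈ Icc 0 T ∧ t + τ.2 ∈ Icc 0 T}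
  · rw [windowIndicator, indicator_of_mem h, Pi.one_apply, mul_one]
    exact hB τ
  · rw [windowIndicator, indicator_of_notMem h, mul_zero, abs_zero]
    exact (abs_nonneg _).trans (hB 0)

/-- With `J t` the inner integral against `c`, oddness of `g` makes the inner integral against the
odd part equal to `(J t + J (T - t)) / 2`. Both halves have the same integral over the window, so
passing to the odd part changes nothing. -/
theorem integral_oddSummand (hT : 0 < T) {c : ℝ × ℝ → ℝ} (hc : Integrable c)
    (hg : IsTestFunction g) (hodd : ∀ τ, g (-τ) = -g τ) :
    1 / T * ∫ t : ℝ, ∫ τ : ℝ × ℝ, oddSummand T g (t, t + τ.1, t + τ.2) * c τ =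
      windowContrast c g T := by
  obtain ⟨B, hB⟩ := hg.bounded
  let J : ℝ → ℝ := fun t => ∫ τ, g τ * windowIndicator T t τ * c τ
  have hFJ : (fun t => ∫ τ : ℝ × ℝ, oddSummand T g (t, t + τ.1, t + τ.2) * c τ) =
      (Icc 0 T).indicator J := by
    ext t
    by_cases ht : t ∈ Icc 0 T
    · rw [indicator_of_mem ht]
      simp_rw [oddSummand_shift ht]
      rfl
    · rw [indicator_of_notMem ht]
      simp_rw [oddSummand_eq_zero (T := T) (g := g) (t, _) ht]
      simp
  obtain ⟨i1, -⟩ := integral_densityMeasure_sub hc (measurable_oddSummand (T := T) hg.measurable)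
    (abs_oddSummand_le' hB) isCompact_Icc oddSummand_eq_zero
  rw [hFJ, integrable_indicator_iff measurableSet_Icc] at i1
  have iJ : IntervalIntegrable J volume 0 T := by
    rw [intervalIntegrable_iff_integrableOn_Icc_of_le hT.le]
    exact i1
  have iJ' : IntervalIntegrable (fun t => J (T - t)) volume 0 T := by
    simpa using (iJ.comp_sub_left T).symm
  have hinner : ∀ t, ∫ τ : ℝ × ℝ, g τ *
      indicator {τ : ℝ × ℝ | t + τ.1 ∈ Icc 0 T ∧ t + τ.2 ∈ Icc 0 T} 1 τ * oddPart c τ =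
      (J t + J (T - t)) / 2 := by
    intro t
    have hm : ∀ s, Measurable fun τ => g τ * windowIndicator T s τ := fun s =>
      hg.measurable.mul (measurable_windowIndicator T s)
    have j1 := integrable_mul_bounded hc (hm t) (abs_mul_windowIndicator_le hB t)
    have j2 := integrable_mul_bounded hc.comp_neg (hm t) (abs_mul_windowIndicator_le hB t)
    have hneg : ∫ τ, g τ * windowIndicator T t τ * c (-τ) = -J (T - t) := by
      rw [← integral_neg_eq_self, ← integral_neg]
      congr 1 with τ
      rw [hodd, windowIndicator_neg, neg_neg]
      ring
    have : ∫ τ : ℝ × ℝ, g τ *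
        indicator {τ : ℝ × ℝ | t + τ.1 ∈ Icc 0 T ∧ t + τ.2 ∈ Icc 0 T} 1 τ * oddPart c τ =
        ∫ τ, (g τ * windowIndicator T t τ * c τ - g τ * windowIndicator T t τ * c (-τ)) / 2 := by
      congr 1 with τ
      rw [oddPart, windowIndicator]
      ring
    rw [this, integral_div, integral_sub j1 j2, hneg, sub_neg_eq_add]
  rw [windowContrast]
  simp_rw [hinner]
  rw [hFJ, integral_indicator measurableSet_Icc, integral_Icc_eq_integral_Ioc,
    ← intervalIntegral.integral_of_le hT.le, intervalIntegral.integral_div,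
    intervalIntegral.integral_add iJ iJ', intervalIntegral.integral_comp_sub_left]
  simp

end OddSummand

section Family

variable {Ω : Type*} [MeasurableSpace Ω] {P : Measure Ω} [IsProbabilityMeasure P] {ν : ℝ≥0}
  {Q : Measure (Measure ℝ)} {U : ℕ → Ω → ℝ} {C : ℕ → Ω → Measure ℝ} {S : ℝ → ℕ → Ω → ℝ} {θ : ℝ}

/-- Extends the disintegration hypothesis beyond product functions; the odd summand depends on
differences of points and is not a product. -/
theorem IsSignSymmetrizedFamily.integral_clusterCumulant3
    (h : IsSignSymmetrizedFamily P ν Q U C S) {c : ℝ × ℝ → ℝ}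
    (hc : IsReducedCumulantDensity3 P (signedClusterProcess U C S 1) c) {F : ℝ × ℝ × ℝ → ℝ}
    (hFm : Measurable F) {B : ℝ} (hB : ∀ p, |F p| ≤ B) {K : Set ℝ} (hK : IsCompact K)
    (h0 : ∀ p, p.1 ∉ K → F p = 0) :
    ∫ p, F p ∂clusterCumulant3 (markLaw ν Q 1) clusterKernel =
      ∫ t : ℝ, ∫ τ : ℝ × ℝ, F (t, t + τ.1, t + τ.2) * c τ := by
  have := h.clusterLaw.isProbability
  have h3 := h.clusterLaw.thirdMoment
  have hone : (1 : ℝ) ∈ Icc (-1 : ℝ) 1 := by norm_num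
  have heq := eq_densityMeasure (M := clusterCumulant3 (markLaw ν Q 1) clusterKernel)
    hc.integrable
    (fun K hK => clusterCumulant3_ne_top ν Q 1 h3 hK.measurableSet hK.measure_lt_top.ne)
    (fun f hf => by rw [← h.factorialCumulant3_eq hone hf, hc.disintegration f hf])
  rw [← (integral_densityMeasure_sub hc.integrable hFm hB hK h0).2, ← heq, integral_add_measure
    (integrable_clusterCumulant3 h3 hFm hB hK h0)
    (integrable_densityMeasure (c := fun τ => -c τ) hc.integrable.neg hFm hB hK h0)]
  ring

theorem IsSignSymmetrizedFamily.integral_oddStatistic (h : IsSignSymmetrizedFamily P ν Q U C S)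
    {c : ℝ × ℝ → ℝ} (hc : IsReducedCumulantDensity3 P (signedClusterProcess U C S 1) c)
    {g : ℝ × ℝ → ℝ} (hg : IsTestFunction g) (hodd : ∀ τ, g (-τ) = -g τ) {T : ℝ} (hT : 0 < T)
    (hθ : θ ∈ Icc (-1 : ℝ) 1) :
    Integrable (fun ω => oddStatistic T g (signedClusterProcess U C S θ ω)) P ∧
      ∫ ω, oddStatistic T g (signedClusterProcess U C S θ ω) ∂P = θ * windowContrast c g T := by
  have := h.clusterLaw.isProbability
  have h3 := h.clusterLaw.thirdMoment
  obtain ⟨B, hB⟩ := hg.bounded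
  have hFm := measurable_oddSummand (T := T) hg.measurable
  have iK : ∀ θ, Integrable (oddSummand T g) (clusterCumulant3 (markLaw ν Q θ) clusterKernel) :=
    fun θ => integrable_clusterCumulant3 h3 hFm (abs_oddSummand_le' hB) isCompact_Icc
      oddSummand_eq_zero
  have ht : IsTestFunction ((Icc 0 T).indicator (1 : ℝ → ℝ)) :=
    isTestFunction_indicator measurableSet_Icc isCompact_Icc subset_rfl
  have iM : Integrable (oddSummand T g) (clusterMixed3 (markLaw ν Q θ) clusterKernel) := by
    have h1 := (integral_clusterMixed3_mul (ρ := markLaw ν Q θ) (η := clusterKernel)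
      (f := fun _ => (Icc 0 T).indicator 1) (fun _ => ht.measurable)
      (fun _ => ht.integrable_bind h3) (fun _ _ => ht.integrable_clusterCumulant2 h3 ht)).1
    exact (h1.const_mul B).mono' hFm.aestronglyMeasurable
      (Eventually.of_forall (abs_oddSummand_le hB))
  have hfm : Measurable fun x : Fin 3 → ℝ => oddSummand T g (x 0, x 1, x 2) := by fun_prop
  obtain ⟨r1, r2⟩ := h.integrable_sumDistinct3 hθ hfm (by exact (iK θ).add_measure iM)
  simp_rw [oddStatistic_eq]
  refine ⟨r1.const_mul _, ?_⟩
  rw [integral_const_mul, r2]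
  have e1 : ∫ p : ℝ × ℝ × ℝ, oddSummand T g (![p.1, p.2.1, p.2.2] 0, ![p.1, p.2.1, p.2.2] 1,
      ![p.1, p.2.1, p.2.2] 2) ∂clusterMoment3 (markLaw ν Q θ) clusterKernel =
      ∫ p, oddSummand T g p ∂clusterMoment3 (markLaw ν Q θ) clusterKernel := rfl
  -- The mixed part vanishes by reflection, and the single-cluster part equals θ times its value at
  -- parameter 1, where the density is available.
  rw [e1, clusterMoment3, integral_add_measure (iK θ) iM,
    integral_eq_zero_of_reflect (map_reflect3_clusterMixed3 ν Q θ T) hFm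
      (oddSummand_reflect3 hodd), add_zero,
    integral_clusterCumulant3_of_reflect hθ hFm (oddSummand_reflect3 hodd) (iK 1),
    h.integral_clusterCumulant3 hc hFm (abs_oddSummand_le' hB) isCompact_Icc oddSummand_eq_zero,
    ← integral_oddSummand hT hc.integrable hg hodd]
  ring

end Family

/-! ### The large-window limit -/

section Limit

variable {T : ℝ} {c g : ℝ × ℝ → ℝ}

theorem integrable_oddPart (hc : Integrable c) : Integrable (oddPart c) :=
  (hc.sub hc.comp_neg).div_const 2

theorem windowIndicator_eq_one {R t : ℝ} (ht : t ∈ Icc R (T - R)) {τ : ℝ × ℝ} (hτ : ‖τ‖ ≤ R) :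
    windowIndicator T t τ = 1 := by
  have h1 := abs_le.1 ((norm_fst_le τ).trans hτ)
  have h2 := abs_le.1 ((norm_snd_le τ).trans hτ)
  rw [windowIndicator, indicator_of_mem (by
    exact ⟨⟨by linarith [ht.1, h1.1], by linarith [ht.2, h1.2]⟩,
      ⟨by linarith [ht.1, h2.1], by linarith [ht.2, h2.2]⟩⟩), Pi.one_apply]

theorem integrableOn_window (hc : Integrable c) (hg : IsTestFunction g) (T : ℝ) :
    IntegrableOn (fun t => ∫ τ, g τ * windowIndicator T t τ * c τ) (Icc 0 T) := by
  obtain ⟨B, hB⟩ := hg.bounded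
  obtain ⟨i1, -⟩ := integral_densityMeasure_sub hc (measurable_oddSummand (T := T) hg.measurable)
    (abs_oddSummand_le' hB) isCompact_Icc oddSummand_eq_zero
  refine i1.integrableOn.congr_fun (fun t ht => ?_) measurableSet_Icc
  simp_rw [oddSummand_shift ht]

theorem abs_window_sub_le (hc : Integrable c) (hg : Measurable g) {B : ℝ} (hB : ∀ τ, |g τ| ≤ B)
    (T t : ℝ) :
    |(∫ τ, g τ * windowIndicator T t τ * c τ) - ∫ τ, g τ * c τ| ≤ B * ∫ τ, |c τ| := by
  have hm : Measurable fun τ => g τ * windowIndicator T t τ :=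
    hg.mul (measurable_windowIndicator T t)
  rw [← integral_sub (integrable_mul_bounded hc hm (abs_mul_windowIndicator_le hB t))
    (integrable_mul_bounded hc hg hB), ← integral_const_mul]
  refine (norm_integral_le_of_norm_le (hc.abs.const_mul B) (Eventually.of_forall fun τ => ?_) :
    ‖∫ τ, (g τ * windowIndicator T t τ * c τ - g τ * c τ)‖ ≤ _)
  rw [← sub_mul, Real.norm_eq_abs, abs_mul]
  refine mul_le_mul_of_nonneg_right ?_ (abs_nonneg _)
  by_cases h : τ ∈ {τ : ℝ × ℝ | t + τ.1 ∈ Icc 0 T ∧ t + τ.2 ∈ Icc 0 T}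
  · rw [windowIndicator, indicator_of_mem h, Pi.one_apply, mul_one, sub_self, abs_zero]
    exact (abs_nonneg _).trans (hB τ)
  · rw [windowIndicator, indicator_of_notMem h, mul_zero, zero_sub, abs_neg]
    exact hB τ

/-- If `g` is supported in radius `R`, the window imposes nothing for base points in `[R, T - R]`.
The two end intervals have total length `2 * R`, and there the error is at most `K`, whence the
constant `2 * R * K`. -/
theorem windowContrast_sub_limitContrast_isBigO (hc : Integrable c) (hg : IsTestFunction g) :
    (fun T => windowContrast c g T - limitContrast c g) =O[atTop] fun T : ℝ => T⁻¹ := by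
  obtain ⟨B, hB⟩ := hg.bounded
  obtain ⟨R, hR0, hR⟩ := hg.compactSupport.isCompact.isBounded.exists_pos_norm_le
  have ho := integrable_oddPart hc
  set K := B * ∫ τ, |oddPart c τ|
  refine IsBigO.of_bound (2 * R * K) ?_
  filter_upwards [eventually_ge_atTop (2 * R)] with T hT
  have hT0 : 0 < T := by linarith
  let D : ℝ → ℝ := fun t => (∫ τ, g τ * windowIndicator T t τ * oddPart c τ) - limitContrast c g
  have iW : IntervalIntegrable (fun t => ∫ τ, g τ * windowIndicator T t τ * oddPart c τ)
      volume 0 T := by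
    rw [intervalIntegrable_iff_integrableOn_Icc_of_le hT0.le]
    exact integrableOn_window ho hg T
  have iD : IntervalIntegrable D volume 0 T := iW.sub intervalIntegrable_const
  have hbd : ∀ t, ‖D t‖ ≤ K := fun t => abs_window_sub_le ho hg.measurable hB T t
  have hzero : ∀ t ∈ Icc R (T - R), D t = 0 := by
    intro t ht
    refine sub_eq_zero.2 (integral_congr_ae (Eventually.of_forall fun τ => ?_))
    by_cases h : g τ = 0
    · simp [h]
    · simp only [windowIndicator_eq_one ht (hR τ (subset_tsupport _ h)), mul_one]
  have hdiff : windowContrast c g T - limitContrast c g = T⁻¹ * ∫ t in (0 : ℝ)..T, D t := by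
    rw [intervalIntegral.integral_sub iW intervalIntegrable_const,
      intervalIntegral.integral_const, windowContrast, smul_eq_mul, sub_zero, mul_sub,
      inv_mul_cancel_left₀ hT0.ne', one_div]
    rfl
  have i1 : IntervalIntegrable D volume 0 R :=
    iD.mono_set (by
      rw [uIcc_of_le hR0.le, uIcc_of_le hT0.le]
      exact Icc_subset_Icc_right (by linarith))
  have i2 : IntervalIntegrable D volume R T :=
    iD.mono_set (by
      rw [uIcc_of_le (by linarith), uIcc_of_le hT0.le]
      exact Icc_subset_Icc_left hR0.le)
  have i3 : IntervalIntegrable D volume R (T - R) :=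
    i2.mono_set (by
      rw [uIcc_of_le (by linarith), uIcc_of_le (by linarith)]
      exact Icc_subset_Icc_right (by linarith))
  have i4 : IntervalIntegrable D volume (T - R) T :=
    i2.mono_set (by
      rw [uIcc_of_le (by linarith), uIcc_of_le (by linarith)]
      exact Icc_subset_Icc_left (by linarith))
  have hmid : ∫ t in R..(T - R), D t = 0 :=
    (intervalIntegral.integral_congr fun t ht => by
      rw [uIcc_of_le (by linarith)] at ht
      exact hzero t ht).trans intervalIntegral.integral_zero
  have b1 := intervalIntegral.norm_integral_le_of_norm_le_const (a := 0) (b := R)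
    fun t _ => hbd t
  have b2 := intervalIntegral.norm_integral_le_of_norm_le_const (a := T - R) (b := T)
    fun t _ => hbd t
  rw [sub_zero, abs_of_pos hR0] at b1
  rw [sub_sub_cancel, abs_of_pos hR0] at b2
  rw [hdiff, norm_mul, mul_comm,
    ← intervalIntegral.integral_add_adjacent_intervals i1 i2,
    ← intervalIntegral.integral_add_adjacent_intervals i3 i4, hmid, zero_add]
  refine mul_le_mul_of_nonneg_right ?_ (norm_nonneg _)
  linarith [norm_add_le (∫ t in (0 : ℝ)..R, D t) (∫ t in (T - R)..T, D t)]

end Limit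

/-! ### The bispectral form of the limiting contrast -/

section Inversion

open scoped FourierTransform SchwartzMap ContDiff ComplexConjugate

variable {V : Type*} [NormedAddCommGroup V] [InnerProductSpace ℝ V] [MeasurableSpace V]
  [BorelSpace V] [FiniteDimensional ℝ V] {f h : V → ℂ}

theorem integral_fourier_mul (hf : Integrable f) (hh : Integrable h) :
    ∫ x, 𝓕 f x * h x = ∫ x, f x * 𝓕 h x := by
  have := VectorFourier.integral_fourierIntegral_smul_eq_flip (L := innerₗ V)
    Real.continuous_fourierChar continuous_inner hf hh
  rwa [flip_innerₗ] at this

theorem integral_fourierInv_mul (hf : Integrable f) (hh : Integrable h) :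
    ∫ x, 𝓕⁻ f x * h x = ∫ x, f x * 𝓕⁻ h x := by
  have := integral_fourier_mul hf hh.comp_neg
  rw [← integral_neg_eq_self] at this
  rw [Real.fourierInv_eq_fourier_comp_neg h]
  simp_rw [Real.fourierInv_eq_fourier_neg f]
  simpa only [neg_neg] using this

theorem continuous_fourier (hf : Integrable f) : Continuous (𝓕 f) :=
  VectorFourier.fourierIntegral_continuous Real.continuous_fourierChar continuous_inner hf

theorem norm_fourier_le (f : V → ℂ) (w : V) : ‖𝓕 f w‖ ≤ ∫ v, ‖f v‖ :=
  VectorFourier.norm_fourierIntegral_le_integral_norm _ _ _ _ _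

theorem continuous_fourierInv (hf : Integrable f) : Continuous (𝓕⁻ f) := by
  have : 𝓕⁻ f = fun w => 𝓕 f (-w) := funext (Real.fourierInv_eq_fourier_neg f)
  rw [this]
  exact (continuous_fourier hf).comp continuous_neg

/-- Inversion without continuity of `f`, hence only almost everywhere. Tested against a smooth
compactly supported function, both transforms move to the test function by the multiplication
formula, where Schwartz inversion applies. -/
theorem fourierInv_fourier_ae_eq (hf : Integrable f) (hf' : Integrable (𝓕 f)) :
    𝓕⁻ (𝓕 f) =ᵐ[volume] f := by
  refine ae_eq_of_integral_contDiff_smul_eq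
    (continuous_fourierInv hf').locallyIntegrable hf.locallyIntegrable fun φ hφ hφc => ?_
  let φc : V → ℂ := fun x => (φ x : ℂ)
  have hφc' : HasCompactSupport φc := hφc.comp_left (g := Complex.ofReal) Complex.ofReal_zero
  let Φ : 𝓢(V, ℂ) := hφc'.toSchwartzMap (Complex.ofRealCLM.contDiff.comp hφ)
  have hΦ : (Φ : V → ℂ) = φc := rfl
  have hΨ : 𝓕 (𝓕⁻ (Φ : V → ℂ)) = Φ := by
    rw [← SchwartzMap.fourierInv_coe, ← SchwartzMap.fourier_coe,
      FourierTransform.fourier_fourierInv_eq]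
  have hΨi : Integrable (𝓕⁻ (Φ : V → ℂ)) := by
    rw [← SchwartzMap.fourierInv_coe]
    exact SchwartzMap.integrable _
  calc ∫ x, φ x • 𝓕⁻ (𝓕 f) x = ∫ x, 𝓕⁻ (𝓕 f) x * Φ x := by
        congr 1 with x
        rw [Complex.real_smul, mul_comm]
        rfl
    _ = ∫ x, 𝓕 f x * 𝓕⁻ (Φ : V → ℂ) x := integral_fourierInv_mul hf' Φ.integrable
    _ = ∫ x, f x * Φ x := by rw [integral_fourier_mul hf hΨi, hΨ]
    _ = ∫ x, φ x • f x := by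
        congr 1 with x
        rw [Complex.real_smul, mul_comm]
        rfl

/-- Parseval's identity in an asymmetric form: only `f` is inverted, so `h` need only be integrable.
-/
theorem integral_mul_eq_integral_fourier (hf : Integrable f) (hf' : Integrable (𝓕 f))
    (hh : Integrable h) : ∫ x, f x * h x = ∫ w, 𝓕 f w * 𝓕⁻ h w := by
  rw [← integral_fourierInv_mul hf' hh]
  refine integral_congr_ae ?_
  filter_upwards [fourierInv_fourier_ae_eq hf hf'] with x hx
  rw [hx]

theorem integrable_fourier_mul_fourierInv (hf' : Integrable (𝓕 f)) (hh : Integrable h) :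
    Integrable fun w => 𝓕 f w * 𝓕⁻ h w :=
  hf'.mul_bdd (c := ∫ v, ‖h v‖) (continuous_fourierInv hh).aestronglyMeasurable
    (Eventually.of_forall fun w => by
      rw [Real.fourierInv_eq_fourier_neg]
      exact norm_fourier_le h _)

end Inversion

section Bispectrum

open scoped FourierTransform ComplexConjugate

/-- A real function on the plane as a complex function on the Euclidean plane. -/
def euclideanLift (f : ℝ × ℝ → ℝ) (x : WithLp 2 (ℝ × ℝ)) : ℂ := (f (WithLp.ofLp x) : ℂ)

variable {c g f Hg : ℝ × ℝ → ℝ}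

theorem integral_ofLp {E : Type*} [NormedAddCommGroup E] [NormedSpace ℝ E] (F : ℝ × ℝ → E) :
    ∫ x : WithLp 2 (ℝ × ℝ), F (WithLp.ofLp x) = ∫ τ, F τ :=
  (WithLp.volume_preserving_symm_measurableEquiv_toLp_prod ℝ ℝ).integral_comp' F

theorem integrable_ofLp {E : Type*} [NormedAddCommGroup E] {F : ℝ × ℝ → E} (hF : Integrable F) :
    Integrable fun x : WithLp 2 (ℝ × ℝ) => F (WithLp.ofLp x) :=
  (WithLp.volume_preserving_ofLp ℝ ℝ).integrable_comp_of_integrable hF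

theorem integrable_euclideanLift (hf : Integrable f) : Integrable (euclideanLift f) :=
  integrable_ofLp (F := fun τ => (f τ : ℂ)) hf.ofReal

/-- The Fourier theory lives on an inner product space, whereas `ℝ × ℝ` carries the sup norm; the
kernel exp(-2πi⟨x, w⟩) accounts for the rescaled frequency. -/
theorem fourier_euclideanLift (f : ℝ × ℝ → ℝ) (w : WithLp 2 (ℝ × ℝ)) :
    𝓕 (euclideanLift f) w = planeFourier f ((2 * Real.pi) • WithLp.ofLp w) := by
  rw [Real.fourier_eq', planeFourier, ← integral_ofLp]
  congr 1 with x
  rw [euclideanLift, smul_eq_mul]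
  congr 2
  simp [WithLp.prod_inner_apply]
  ring

theorem planeFourier_neg (f : ℝ × ℝ → ℝ) (ω : ℝ × ℝ) :
    planeFourier f (-ω) = conj (planeFourier f ω) := by
  rw [planeFourier, planeFourier, ← integral_conj]
  congr 1 with τ
  rw [map_mul, ← Complex.exp_conj, Complex.conj_ofReal, map_mul, map_neg, Complex.conj_I,
    Complex.conj_ofReal]
  congr 2
  push_cast [Prod.fst_neg, Prod.snd_neg]
  ring

theorem fourierInv_euclideanLift (f : ℝ × ℝ → ℝ) (w : WithLp 2 (ℝ × ℝ)) :
    𝓕⁻ (euclideanLift f) w = conj (planeFourier f ((2 * Real.pi) • WithLp.ofLp w)) := by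
  rw [Real.fourierInv_eq_fourier_neg, fourier_euclideanLift, ← planeFourier_neg]
  simp

/-- The Jacobian of the frequency rescaling in dimension two is the source of the prefactor in the
bispectral formula. -/
theorem integral_comp_two_pi_smul (F : ℝ × ℝ → ℝ) :
    ∫ ω : ℝ × ℝ, F ((2 * Real.pi) • ω) = 1 / (2 * Real.pi) ^ 2 * ∫ ω, F ω := by
  rw [Measure.integral_comp_smul_of_nonneg _ _ _ (hR := by positivity)]
  simp

theorem IsTestFunction.integrable_plane (hg : IsTestFunction g) : Integrable g := by
  obtain ⟨B, hB⟩ := hg.bounded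
  exact integrable_of_bounded hg.measurable hB
    (IsCompact.measure_lt_top hg.compactSupport).ne fun x hx => image_eq_zero_of_notMem_tsupport hx

/-- The even part of `c` integrates to zero against the odd function `g`. -/
theorem limitContrast_eq_integral_mul (hc : Integrable c) (hg : IsTestFunction g)
    (hodd : ∀ τ, g (-τ) = -g τ) : limitContrast c g = ∫ τ, g τ * c τ := by
  obtain ⟨B, hB⟩ := hg.bounded
  have i1 := integrable_mul_bounded hc hg.measurable hB
  have i2 := integrable_mul_bounded hc.comp_neg hg.measurable hB
  have hneg : ∫ τ, g τ * c (-τ) = -∫ τ, g τ * c τ := by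
    rw [← integral_neg_eq_self, ← integral_neg]
    congr 1 with τ
    rw [hodd, neg_neg, neg_mul]
  have : limitContrast c g = ∫ τ, (g τ * c τ - g τ * c (-τ)) / 2 := by
    rw [limitContrast]
    congr 1 with τ
    rw [oddPart]
    ring
  rw [this, integral_div, integral_sub i1 i2, hneg]
  ring

theorem limitContrast_eq_bispectrum (hc : Integrable c) (hg : IsTestFunction g)
    (hodd : ∀ τ, g (-τ) = -g τ) (hgH : ∀ ω, planeFourier g ω = Complex.I * (Hg ω : ℂ))
    (hH : Integrable Hg) :
    limitContrast c g =
      1 / (2 * Real.pi) ^ 2 * ∫ ω : ℝ × ℝ, Hg ω * (planeFourier c ω).im := by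
  have ig := integrable_euclideanLift hg.integrable_plane
  have ic := integrable_euclideanLift hc
  have iF : Integrable (𝓕 (euclideanLift g)) := by
    have : 𝓕 (euclideanLift g) = fun w : WithLp 2 (ℝ × ℝ) =>
        Complex.I * (Hg ((2 * Real.pi) • WithLp.ofLp w) : ℂ) := by
      ext w
      rw [fourier_euclideanLift, hgH]
    rw [this]
    exact ((integrable_ofLp ((integrable_comp_smul_iff volume Hg (R := 2 * Real.pi)
      (by positivity)).2 hH)).ofReal).const_mul _
  -- As `c` is real, its inverse transform is the conjugate of its bispectrum B, and the real part
  -- of i H times the conjugate of B is H Im B.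
  have hre : ∀ w : WithLp 2 (ℝ × ℝ),
      (𝓕 (euclideanLift g) w * 𝓕⁻ (euclideanLift c) w).re =
        (fun ω : ℝ × ℝ => Hg ((2 * Real.pi) • ω) * (planeFourier c ((2 * Real.pi) • ω)).im)
          (WithLp.ofLp w) := by
    intro w
    rw [fourier_euclideanLift, fourierInv_euclideanLift, hgH]
    simp
  have hlim : ((limitContrast c g : ℝ) : ℂ) =
      ∫ x, euclideanLift g x * euclideanLift c x := by
    rw [limitContrast_eq_integral_mul hc hg hodd, ← integral_ofLp, ← integral_complex_ofReal]
    congr 1 with x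
    rw [Complex.ofReal_mul]
    rfl
  rw [← integral_comp_two_pi_smul (fun ω => Hg ω * (planeFourier c ω).im), ← integral_ofLp]
  simp_rw [← hre]
  rw [← Complex.ofReal_re (limitContrast c g), hlim, integral_mul_eq_integral_fourier ig iF ic]
  exact (integral_re (integrable_fourier_mul_fourierInv iF ic)).symm

end Bispectrum

end ClusterContrast

end

theorem mainTheorem6 {Ω : Type*} [MeasurableSpace Ω] (P : Measure Ω) [IsProbabilityMeasure P]
    (ν : ℝ≥0) (Q : Measure (Measure ℝ)) (U : ℕ → Ω → ℝ) (C : ℕ → Ω → Measure ℝ)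
    (S : ℝ → ℕ → Ω → ℝ)
    (hfam : ClusterContrast.IsSignSymmetrizedFamily P ν Q U C S)
    (c : ℝ × ℝ → ℝ)
    (hc : ClusterContrast.IsReducedCumulantDensity3 P
      (ClusterContrast.signedClusterProcess U C S 1) c)
    (g : ℝ × ℝ → ℝ) (hg : ClusterContrast.IsTestFunction g) (hodd : ∀ τ, g (-τ) = -g τ) :
    (∀ T : ℝ, 0 < T → ∀ θ ∈ Icc (-1 : ℝ) 1,
      Integrable (fun ω => ClusterContrast.oddStatistic T g
        (ClusterContrast.signedClusterProcess U C S θ ω)) P ∧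
      ∫ ω, ClusterContrast.oddStatistic T g
        (ClusterContrast.signedClusterProcess U C S θ ω) ∂P =
          θ * ClusterContrast.windowContrast c g T) ∧
    ((fun T : ℝ => ClusterContrast.windowContrast c g T - ClusterContrast.limitContrast c g)
      =O[atTop] fun T : ℝ => T⁻¹) ∧
    (∀ Hg : ℝ × ℝ → ℝ,
      (∀ ω, ClusterContrast.planeFourier g ω = Complex.I * (Hg ω : ℂ)) → Integrable Hg →
      ClusterContrast.limitContrast c g =
        1 / (2 * Real.pi) ^ 2 *
          ∫ ω : ℝ × ℝ, Hg ω * (ClusterContrast.planeFourier c ω).im) :=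
  ⟨fun _ hT _ hθ => hfam.integral_oddStatistic hc hg hodd hT hθ,
    ClusterContrast.windowContrast_sub_limitContrast_isBigO hc.integrable hg,
    fun _ hgH hH => ClusterContrast.limitContrast_eq_bispectrum hc.integrable hg hodd hgH hH⟩
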